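/- Let $(\mathcal M,g)$ be a smooth time-oriented 4-dimensional spacetime of signature $(+,-,-,-)$ with Levi-Civita connection $\nabla$, $R_{abc}{}^{d}V^c=(\nabla_a\nabla_b-\nabla_b\nabla_a)V^d$, $\mathrm{Ric}_{ab}=R_{acb}{}^{c}$ and Weyl tensor $C_{abcd}$. Let $\mathcal H\subset\mathcal M$ be a non-expanding horizon: an embedded null hypersurface homeomorphic to $\mathbb R\times S^2$ such that every null normal of $\mathcal H$ has vanishing expansion, Einstein's equations $\mathrm{Ric}_{ab}-\tfrac12 R g_{ab}=-8\pi T_{ab}$ hold on $\mathcal H$, and for every future pointing null normal $l^a$ the vector $T^a{}_b l^b$ is future pointing (causal or zero). Let $l^a$ be a null normal of $\mathcal H$, smooth near $\mathcal H$, and let $\mathcal S\subset\mathcal H$ be a spherical cross-section (an embedded spacelike 2-sphere). Then there is exactly one 1-form $\omega$ on $\mathcal H$ with $X^a\nabla_a l^b=(X^a\omega_a)\,l^b$ for all $X$ tangent to $\mathcal H$ (the rotational 1-form), and $\omega$ is smooth. Let ${}^{(2)}\omega$ be its pull-back to $\mathcal S$. Let $(l,n,m,\bar m)$ be a null tetrad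 defined near a point of $\mathcal S$ and adapted to $\mathcal H$ and $\mathcal S$: on $\mathcal H$ the complex vector field $m$ is tangent to $\mathcal H$ with $\pounds_l m=0$; on $\mathcal S$ it is tangent to $\mathcal S$ with $m_am^a=0$, $m_a\bar m^a=-1$; and on $\mathcal H$ the real vector field $n$ satisfies $n_an^a=0$, $l_an^a=1$, $n_am^a=0$. Put $D=l^a\nabla_a$, $\epsilon=\tfrac12(n^aDl_a-\bar m^aDm_a)$, $\pi=-\bar m^aDn_a$ and $\Psi_2=C_{abcd}l^am^b\bar m^cn^d$. Then, at the points of $\mathcal S$ where the tetrad is defined, $\omega_a=(\epsilon+\bar\epsilon)n_a-\pi m_a-\bar\pi\bar m_a$ on vectors tangent to $\mathcal H$; hence $$ {}^{(2)}\omega=-\pi\,m-\bar\pi\,\bar m ,$$ and $$ \mathrm d\,{}^{(2)}\omega = 2\,\mathrm{Im}\,\Psi_2\;{}^{(2)}\varepsilon ,$$ where $(\mathrm d\alpha)_{ab}=2\nabla_{[a}\alpha_{b]}$ and ${}^{(2)}\varepsilon_{ab}=2i\,m_{[a}\bar m_{b]}=i(m_a\bar m_b-\bar m_a m_b)$ is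 the area form of $\mathcal S$ (its square on a pair of vectors tangent to $\mathcal S$ is their Gram determinant with respect to $g$). -/

import Mathlib

open Bundle Manifold VectorField
open scoped Manifold ContDiff Topology

noncomputable section

namespace NullHorizon

/-- A smooth Lorentz metric of signature `(+,-,-,-)` on a 4-manifold. -/
structure LorentzMetric (M : Type*) [TopologicalSpace M] [ChartedSpace (EuclideanSpace ℝ (Fin 4)) M]
    [IsManifold (𝓡 4) ∞ M] where
  val (p : M) : TangentSpace (𝓡 4) p →L[ℝ] TangentSpace (𝓡 4) p →L[ℝ] ℝ
  symm (p : M) (u v : TangentSpace (𝓡 4) p) : val p u v = val p v u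
  signature (p : M) : ∃ e : Fin 4 → TangentSpace (𝓡 4) p, ∀ i j,
    val p (e i) (e j) = if i = j then (if i = 0 then 1 else -1) else 0
  contMDiff : ContMDiff (𝓡 4) ((𝓡 4).prod
      𝓘(ℝ, EuclideanSpace ℝ (Fin 4) →L[ℝ] EuclideanSpace ℝ (Fin 4) →L[ℝ] ℝ)) ∞
    (fun p => TotalSpace.mk'
      (EuclideanSpace ℝ (Fin 4) →L[ℝ] EuclideanSpace ℝ (Fin 4) →L[ℝ] ℝ) p (val p))

/-- Differentiability of a vector field at a point. -/
abbrev FieldDiffAt {M : Type*} [TopologicalSpace M] [ChartedSpace (EuclideanSpace ℝ (Fin 4)) M]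
    [IsManifold (𝓡 4) ∞ M] (X : ∀ p : M, TangentSpace (𝓡 4) p) (p : M) : Prop :=
  MDifferentiableAt (𝓡 4) ((𝓡 4).prod 𝓘(ℝ, EuclideanSpace ℝ (Fin 4)))
    (fun q => TotalSpace.mk' (EuclideanSpace ℝ (Fin 4)) q (X q)) p

/-- Smoothness of a vector field at a point. -/
abbrev FieldSmoothAt {M : Type*} [TopologicalSpace M] [ChartedSpace (EuclideanSpace ℝ (Fin 4)) M]
    [IsManifold (𝓡 4) ∞ M] (X : ∀ p : M, TangentSpace (𝓡 4) p) (p : M) : Prop :=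
  ContMDiffAt (𝓡 4) ((𝓡 4).prod 𝓘(ℝ, EuclideanSpace ℝ (Fin 4))) ∞
    (fun q => TotalSpace.mk' (EuclideanSpace ℝ (Fin 4)) q (X q)) p

namespace LorentzMetric

variable {M : Type*} [TopologicalSpace M] [ChartedSpace (EuclideanSpace ℝ (Fin 4)) M]
  [IsManifold (𝓡 4) ∞ M] (g : LorentzMetric M)

theorem injective_val (p : M) : Function.Injective (g.val p) := by
  obtain ⟨e, he⟩ := g.signature p
  have hli : LinearIndependent ℝ e := by
    rw [Fintype.linearIndependent_iff]
    intro c hc j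
    have h : g.val p (∑ i, c i • e i) (e j) = 0 := by rw [hc]; simp
    simp only [map_sum, map_smul, _root_.sum_apply, _root_.smul_apply,
      he, smul_eq_mul, mul_ite, mul_zero, Finset.sum_ite_eq', Finset.mem_univ, if_true] at h
    split_ifs at h <;> linarith
  have hfr : Module.finrank ℝ (TangentSpace (𝓡 4) p) = 4 :=
    (by simp : Module.finrank ℝ (EuclideanSpace ℝ (Fin 4)) = 4)
  have hspan : Submodule.span ℝ (Set.range e) = ⊤ :=
    hli.span_eq_top_of_card_eq_finrank (by simp [hfr])
  rw [injective_iff_map_eq_zero]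
  intro u hu
  have hmem : u ∈ Submodule.span ℝ (Set.range e) := by rw [hspan]; trivial
  obtain ⟨c, rfl⟩ := (Submodule.mem_span_range_iff_exists_fun ℝ).1 hmem
  refine Finset.sum_eq_zero fun j _ => ?_
  have h : g.val p (∑ i, c i • e i) (e j) = 0 := by rw [hu]; simp
  simp only [map_sum, map_smul, _root_.sum_apply, _root_.smul_apply,
    he, smul_eq_mul, mul_ite, mul_zero, Finset.sum_ite_eq', Finset.mem_univ, if_true] at h
  have : c j = 0 := by split_ifs at h <;> linarith
  rw [this, zero_smul]

/-- The index-lowering isomorphism `T_p M ≃ T_p^* M` of the metric. -/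
def flatEquiv (p : M) : TangentSpace (𝓡 4) p ≃L[ℝ] (TangentSpace (𝓡 4) p →L[ℝ] ℝ) :=
  haveI : T2Space (TangentSpace (𝓡 4) p) := inferInstanceAs (T2Space (EuclideanSpace ℝ (Fin 4)))
  haveI : FiniteDimensional ℝ (TangentSpace (𝓡 4) p) :=
    inferInstanceAs (FiniteDimensional ℝ (EuclideanSpace ℝ (Fin 4)))
  haveI : FiniteDimensional ℝ (TangentSpace (𝓡 4) p →L[ℝ] ℝ) :=
    inferInstanceAs (FiniteDimensional ℝ (EuclideanSpace ℝ (Fin 4) →L[ℝ] ℝ))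
  (LinearMap.linearEquivOfInjective (g.val p).toLinearMap (g.injective_val p) (by
    rw [(LinearMap.toContinuousLinearMap (𝕜 := ℝ) (E := TangentSpace (𝓡 4) p)
      (F' := ℝ)).symm.finrank_eq, Module.finrank_linearMap, Module.finrank_self,
      mul_one])).toContinuousLinearEquiv

theorem flatEquiv_apply (p : M) (u : TangentSpace (𝓡 4) p) : g.flatEquiv p u = g.val p u := rfl

theorem mdifferentiableAt_val {X Y : ∀ p : M, TangentSpace (𝓡 4) p} {p : M}
    (hX : FieldDiffAt X p) (hY : FieldDiffAt Y p) :
    MDifferentiableAt (𝓡 4) 𝓘(ℝ) (fun q => g.val q (X q) (Y q)) p := by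
  have h : MDifferentiableAt (𝓡 4) ((𝓡 4).prod 𝓘(ℝ))
      (fun q => TotalSpace.mk' ℝ (E := Bundle.Trivial M ℝ) q (g.val q (X q) (Y q))) p := by
    apply MDifferentiableAt.clm_bundle_apply₂ (F₁ := EuclideanSpace ℝ (Fin 4))
      (F₂ := EuclideanSpace ℝ (Fin 4))
    · exact g.contMDiff.mdifferentiable (by simp) p
    · exact hX
    · exact hY
  simp only [mdifferentiableAt_totalSpace] at h
  exact h.2

/-- The right-hand side of the Koszul formula for `g(∇_X Y, Z)`. -/
def koszul (X Y Z : ∀ p : M, TangentSpace (𝓡 4) p) (p : M) : ℝ :=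
  (1 / 2) * (mvfderiv (𝓡 4) (fun q => g.val q (Y q) (Z q)) p (X p) + mvfderiv (𝓡 4) (fun q => g.val q (X q) (Z q)) p (Y p)
    - mvfderiv (𝓡 4) (fun q => g.val q (X q) (Y q)) p (Z p)
    + g.val p (mlieBracket (𝓡 4) X Y p) (Z p) - g.val p (mlieBracket (𝓡 4) X Z p) (Y p)
    - g.val p (mlieBracket (𝓡 4) Y Z p) (X p))

theorem koszul_tensorial_left {Y Z : ∀ p : M, TangentSpace (𝓡 4) p} {p : M}
    (hY : FieldDiffAt Y p) (hZ : FieldDiffAt Z p) :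
    TensorialAt (𝓡 4) (EuclideanSpace ℝ (Fin 4)) (fun X => g.koszul X Y Z p) p where
  smul {f X} hf hX := by
    have e1 : mvfderiv (𝓡 4) (fun q => g.val q ((f • X) q) (Z q)) p =
        f p • mvfderiv (𝓡 4) (fun q => g.val q (X q) (Z q)) p + g.val p (X p) (Z p) • mvfderiv (𝓡 4) f p := by
      simpa using mvfderiv_fun_mul hf (g.mdifferentiableAt_val hX hZ)
    have e2 : mvfderiv (𝓡 4) (fun q => g.val q ((f • X) q) (Y q)) p =
        f p • mvfderiv (𝓡 4) (fun q => g.val q (X q) (Y q)) p + g.val p (X p) (Y p) • mvfderiv (𝓡 4) f p := by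
      simpa using mvfderiv_fun_mul hf (g.mdifferentiableAt_val hX hY)
    simp only [koszul, e1, e2, mlieBracket_smul_left hf hX]
    simp
    ring
  add {X X'} hX hX' := by
    have e1 : mvfderiv (𝓡 4) (fun q => g.val q ((X + X') q) (Z q)) p =
        mvfderiv (𝓡 4) (fun q => g.val q (X q) (Z q)) p + mvfderiv (𝓡 4) (fun q => g.val q (X' q) (Z q)) p := by
      simpa using mvfderiv_fun_add (g.mdifferentiableAt_val hX hZ) (g.mdifferentiableAt_val hX' hZ)
    have e2 : mvfderiv (𝓡 4) (fun q => g.val q ((X + X') q) (Y q)) p =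
        mvfderiv (𝓡 4) (fun q => g.val q (X q) (Y q)) p + mvfderiv (𝓡 4) (fun q => g.val q (X' q) (Y q)) p := by
      simpa using mvfderiv_fun_add (g.mdifferentiableAt_val hX hY) (g.mdifferentiableAt_val hX' hY)
    simp only [koszul, e1, e2, mlieBracket_add_left hX hX']
    simp
    ring

theorem koszul_tensorial_right {X Y : ∀ p : M, TangentSpace (𝓡 4) p} {p : M}
    (hX : FieldDiffAt X p) (hY : FieldDiffAt Y p) :
    TensorialAt (𝓡 4) (EuclideanSpace ℝ (Fin 4)) (fun Z => g.koszul X Y Z p) p where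
  smul {f Z} hf hZ := by
    have e1 : mvfderiv (𝓡 4) (fun q => g.val q (X q) ((f • Z) q)) p =
        f p • mvfderiv (𝓡 4) (fun q => g.val q (X q) (Z q)) p + g.val p (X p) (Z p) • mvfderiv (𝓡 4) f p := by
      simpa using mvfderiv_fun_mul hf (g.mdifferentiableAt_val hX hZ)
    have e2 : mvfderiv (𝓡 4) (fun q => g.val q (Y q) ((f • Z) q)) p =
        f p • mvfderiv (𝓡 4) (fun q => g.val q (Y q) (Z q)) p + g.val p (Y p) (Z p) • mvfderiv (𝓡 4) f p := by
      simpa using mvfderiv_fun_mul hf (g.mdifferentiableAt_val hY hZ)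
    simp only [koszul, e1, e2, mlieBracket_smul_right hf hZ]
    simp [g.symm p (Z p) (X p), g.symm p (Z p) (Y p)]
    ring
  add {Z Z'} hZ hZ' := by
    have e1 : mvfderiv (𝓡 4) (fun q => g.val q (X q) ((Z + Z') q)) p =
        mvfderiv (𝓡 4) (fun q => g.val q (X q) (Z q)) p + mvfderiv (𝓡 4) (fun q => g.val q (X q) (Z' q)) p := by
      simpa using mvfderiv_fun_add (g.mdifferentiableAt_val hX hZ) (g.mdifferentiableAt_val hX hZ')
    have e2 : mvfderiv (𝓡 4) (fun q => g.val q (Y q) ((Z + Z') q)) p =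
        mvfderiv (𝓡 4) (fun q => g.val q (Y q) (Z q)) p + mvfderiv (𝓡 4) (fun q => g.val q (Y q) (Z' q)) p := by
      simpa using mvfderiv_fun_add (g.mdifferentiableAt_val hY hZ) (g.mdifferentiableAt_val hY hZ')
    simp only [koszul, e1, e2, mlieBracket_add_right hZ hZ']
    simp
    ring

/-- The bilinear form `(X, Z) ↦ g(∇_X Y, Z)` at `p`. -/
def koszulForm (Y : ∀ p : M, TangentSpace (𝓡 4) p) (p : M) (hY : FieldDiffAt Y p) :
    TangentSpace (𝓡 4) p →L[ℝ] TangentSpace (𝓡 4) p →L[ℝ] ℝ :=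
  TensorialAt.mkHom₂ (I := 𝓡 4) (F := EuclideanSpace ℝ (Fin 4)) (F' := EuclideanSpace ℝ (Fin 4))
    (fun X Z => g.koszul X Y Z p) p
    (fun _ hZ => g.koszul_tensorial_left hY hZ) (fun _ hX => g.koszul_tensorial_right hX hY)

theorem koszulForm_apply {X Y Z : ∀ p : M, TangentSpace (𝓡 4) p} {p : M} (hX : FieldDiffAt X p)
    (hY : FieldDiffAt Y p) (hZ : FieldDiffAt Z p) :
    g.koszulForm Y p hY (X p) (Z p) = g.koszul X Y Z p :=
  TensorialAt.mkHom₂_apply _ _ hX hZ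

open Classical in
/-- `g.nablaAux Y p v` is `∇_v Y`, for a vector field `Y` differentiable at `p`. -/
def nablaAux (Y : ∀ p : M, TangentSpace (𝓡 4) p) (p : M) :
    TangentSpace (𝓡 4) p →L[ℝ] TangentSpace (𝓡 4) p :=
  if hY : FieldDiffAt Y p then
    ((g.flatEquiv p).symm : (TangentSpace (𝓡 4) p →L[ℝ] ℝ) →L[ℝ] TangentSpace (𝓡 4) p).comp
      (g.koszulForm Y p hY)
  else 0

theorem val_nablaAux {X Y Z : ∀ p : M, TangentSpace (𝓡 4) p} {p : M} (hX : FieldDiffAt X p)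
    (hY : FieldDiffAt Y p) (hZ : FieldDiffAt Z p) :
    g.val p (g.nablaAux Y p (X p)) (Z p) = g.koszul X Y Z p := by
  rw [← g.koszulForm_apply hX hY hZ, ← g.flatEquiv_apply]
  simp [nablaAux, hY]

theorem ext_val {p : M} {u v : TangentSpace (𝓡 4) p}
    (h : ∀ w, g.val p u w = g.val p v w) : u = v :=
  g.injective_val p (ContinuousLinearMap.ext h)

/-- The Levi-Civita connection of `g`; `g.leviCivita Y p v` is `∇_v Y` at `p`. -/
def leviCivita : CovariantDerivative (𝓡 4) (EuclideanSpace ℝ (Fin 4))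
    (TangentSpace (𝓡 4) : M → Type _) where
  toFun := g.nablaAux
  isCovariantDerivativeOnUniv :=
    { add := by
        intro Y Y' p hY hY' _
        ext1 v
        refine g.ext_val fun w => ?_
        have hv := FiberBundle.mdifferentiableAt_extend (𝓡 4) (EuclideanSpace ℝ (Fin 4)) v
        have hw := FiberBundle.mdifferentiableAt_extend (𝓡 4) (EuclideanSpace ℝ (Fin 4)) w
        have hs := mdifferentiableAt_add_section hY hY'
        have k1 := g.val_nablaAux hv hY hw
        have k2 := g.val_nablaAux hv hY' hw
        have k3 := g.val_nablaAux hv hs hw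
        simp only [FiberBundle.extend_apply_self] at k1 k2 k3
        rw [k3, _root_.add_apply, map_add, _root_.add_apply, k1, k2]
        have e1 := mvfderiv_fun_add (g.mdifferentiableAt_val hY hw) (g.mdifferentiableAt_val hY' hw)
        have e2 := mvfderiv_fun_add (g.mdifferentiableAt_val hv hY) (g.mdifferentiableAt_val hv hY')
        simp only [koszul, mlieBracket_add_left hY hY', mlieBracket_add_right hY hY', Pi.add_apply,
          map_add, _root_.add_apply, e1, e2]
        ring
      leibniz := by
        intro Y f p hY hf _
        ext1 v
        refine g.ext_val fun w => ?_
        have hv := FiberBundle.mdifferentiableAt_extend (𝓡 4) (EuclideanSpace ℝ (Fin 4)) v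
        have hw := FiberBundle.mdifferentiableAt_extend (𝓡 4) (EuclideanSpace ℝ (Fin 4)) w
        have hs := hf.smul_section hY
        have k1 := g.val_nablaAux hv hY hw
        have k3 := g.val_nablaAux hv hs hw
        simp only [FiberBundle.extend_apply_self] at k1 k3
        have e1 := mvfderiv_fun_mul hf (g.mdifferentiableAt_val hY hw)
        have e2 := mvfderiv_fun_mul hf (g.mdifferentiableAt_val hv hY)
        rw [k3]
        simp only [koszul] at k1 ⊢
        simp [e1, e2, mlieBracket_smul_left hf hY, mlieBracket_smul_right hf hY, k1, g.symm p v (Y p)]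
        ring }

theorem leviCivita_apply {X Y Z : ∀ p : M, TangentSpace (𝓡 4) p} {p : M} (hX : FieldDiffAt X p)
    (hY : FieldDiffAt Y p) (hZ : FieldDiffAt Z p) :
    g.val p (g.leviCivita Y p (X p)) (Z p) = g.koszul X Y Z p :=
  g.val_nablaAux hX hY hZ

/-- The Levi-Civita connection is torsion-free. -/
theorem leviCivita_torsion {X Y : ∀ p : M, TangentSpace (𝓡 4) p} {p : M} (hX : FieldDiffAt X p)
    (hY : FieldDiffAt Y p) :
    g.leviCivita Y p (X p) - g.leviCivita X p (Y p) = mlieBracket (𝓡 4) X Y p := by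
  refine g.ext_val fun w => ?_
  have hw := FiberBundle.mdifferentiableAt_extend (𝓡 4) (EuclideanSpace ℝ (Fin 4)) w
  have k1 := g.leviCivita_apply hX hY hw
  have k2 := g.leviCivita_apply hY hX hw
  have hs : (fun q => g.val q (Y q) (X q)) = fun q => g.val q (X q) (Y q) :=
    funext fun q => g.symm q _ _
  have hb : mlieBracket (𝓡 4) Y X p = - mlieBracket (𝓡 4) X Y p := by
    rw [mlieBracket_swap]; rfl
  simp only [koszul, FiberBundle.extend_apply_self, hs, hb] at k1 k2
  simp only [map_sub, map_neg, _root_.sub_apply, _root_.neg_apply, k1, k2]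
  ring

/-- The Levi-Civita connection is metric. -/
theorem leviCivita_metric {X Y Z : ∀ p : M, TangentSpace (𝓡 4) p} {p : M} (hX : FieldDiffAt X p)
    (hY : FieldDiffAt Y p) (hZ : FieldDiffAt Z p) :
    mvfderiv (𝓡 4) (fun q => g.val q (Y q) (Z q)) p (X p) =
      g.val p (g.leviCivita Y p (X p)) (Z p) + g.val p (Y p) (g.leviCivita Z p (X p)) := by
  have hs (A B : ∀ p : M, TangentSpace (𝓡 4) p) :
      (fun q => g.val q (A q) (B q)) = fun q => g.val q (B q) (A q) :=
    funext fun q => g.symm q _ _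
  have hb (A B : ∀ p : M, TangentSpace (𝓡 4) p) :
      mlieBracket (𝓡 4) A B p = - mlieBracket (𝓡 4) B A p := by
    rw [mlieBracket_swap]; rfl
  rw [g.symm p (Y p), g.leviCivita_apply hX hY hZ, g.leviCivita_apply hX hZ hY]
  simp only [koszul, hs Z Y, hb Z Y]
  simp only [map_neg, _root_.neg_apply]
  ring

/-- The Riemann curvature `R(x, y) z = ∇_x ∇_y z - ∇_y ∇_x z - ∇_[x,y] z` at `p`, evaluated on
smooth local extensions of the vectors `x, y, z`. -/
def riemann (p : M) (x y z : TangentSpace (𝓡 4) p) : TangentSpace (𝓡 4) p :=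
  let X : ∀ q : M, TangentSpace (𝓡 4) q := FiberBundle.extend (EuclideanSpace ℝ (Fin 4)) x
  let Y : ∀ q : M, TangentSpace (𝓡 4) q := FiberBundle.extend (EuclideanSpace ℝ (Fin 4)) y
  let Z : ∀ q : M, TangentSpace (𝓡 4) q := FiberBundle.extend (EuclideanSpace ℝ (Fin 4)) z
  g.leviCivita (fun q => g.leviCivita Z q (Y q)) p x
    - g.leviCivita (fun q => g.leviCivita Z q (X q)) p y
    - g.leviCivita Z p (mlieBracket (𝓡 4) X Y p)

/-- The curvature tensor with all indices down, `R_{abcd} x^a y^b z^c w^d = g(R(x, y) z, w)`. -/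
def riemannLow (p : M) (x y z w : TangentSpace (𝓡 4) p) : ℝ := g.val p (g.riemann p x y z) w

/-- A chosen orthonormal frame at `p`, used to take traces. -/
def frame (p : M) : Fin 4 → TangentSpace (𝓡 4) p := Classical.choose (g.signature p)

/-- The diagonal entries `1, -1, -1, -1` of the metric in an orthonormal frame. -/
def eta (i : Fin 4) : ℝ := if i = 0 then 1 else -1

/-- The Ricci tensor in the sign convention `Ric_{ab} = R_{acb}{}^c`, that is
`Ric(y, z) = - trace (x ↦ R(x, y) z)`. -/
def ricci (p : M) (y z : TangentSpace (𝓡 4) p) : ℝ :=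
  ∑ i, eta i * g.riemannLow p y (g.frame p i) z (g.frame p i)

/-- The scalar curvature `g^{ab} Ric_{ab}`. -/
def scalar (p : M) : ℝ := ∑ i, eta i * g.ricci p (g.frame p i) (g.frame p i)

/-- The Weyl tensor `C_{abcd} x^a y^b z^c w^d`, the trace-free part of `R_{abcd}`. -/
def weyl (p : M) (x y z w : TangentSpace (𝓡 4) p) : ℝ :=
  g.riemannLow p x y z w
    - (1 / 2) * (g.val p x z * g.ricci p y w - g.val p y z * g.ricci p x w
        + g.ricci p x z * g.val p y w - g.ricci p y z * g.val p x w)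
    + (g.scalar p / 6) * (g.val p x z * g.val p y w - g.val p y z * g.val p x w)

end LorentzMetric

/-! ### Complex vectors

A complex vector `z = a + i b` with `a, b` in a real vector space is written as the pair `(a, b)`. -/

/-- The complex conjugate `a - i b`. -/
def conjVec {V : Type*} [Neg V] (z : V × V) : V × V := (z.1, -z.2)

/-- The complex-linear extension of a real linear form. -/
def complexLin {V : Type*} (f : V → ℝ) (z : V × V) : ℂ := f z.1 + f z.2 * Complex.I

/-- The complex-bilinear extension of a real bilinear form. -/
def complexBilin {V : Type*} (B : V → V → ℝ) (z w : V × V) : ℂ :=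
  ((B z.1 w.1 - B z.2 w.2 : ℝ) : ℂ) + ((B z.1 w.2 + B z.2 w.1 : ℝ) : ℂ) * Complex.I

section Spacetime

variable {M : Type*} [TopologicalSpace M] [ChartedSpace (EuclideanSpace ℝ (Fin 4)) M]
  [IsManifold (𝓡 4) ∞ M]

/-- A time orientation: a continuous timelike vector field. -/
structure TimeOrientation (g : LorentzMetric M) where
  val (p : M) : TangentSpace (𝓡 4) p
  timelike (p : M) : 0 < g.val p (val p) (val p)
  continuous : Continuous
    (fun p => TotalSpace.mk' (EuclideanSpace ℝ (Fin 4)) p (val p))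

/-- `v` lies in the closed future light cone at `p`: it is zero, or causal and future pointing. -/
def TimeOrientation.FutureCausal {g : LorentzMetric M} (t : TimeOrientation g) (p : M)
    (v : TangentSpace (𝓡 4) p) : Prop :=
  0 ≤ g.val p v v ∧ 0 ≤ g.val p (t.val p) v

/-! ### Newman-Penrose scalars of a null tetrad `(l, n, m, m̄)`

The vector fields `l, n` are real and `m` is complex. -/

section NewmanPenrose

variable (g : LorentzMetric M) (l n : ∀ p : M, TangentSpace (𝓡 4) p)
  (m : ∀ p : M, TangentSpace (𝓡 4) p × TangentSpace (𝓡 4) p) (p : M)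

/-- The operator `D = l^a ∇_a` on vector fields. -/
def opD (Y : ∀ p : M, TangentSpace (𝓡 4) p) : TangentSpace (𝓡 4) p :=
  g.leviCivita Y p (l p)

/-- The operator `D = l^a ∇_a` on complex vector fields. -/
def opDC (Y : ∀ p : M, TangentSpace (𝓡 4) p × TangentSpace (𝓡 4) p) :
    TangentSpace (𝓡 4) p × TangentSpace (𝓡 4) p :=
  (opD g l p (fun q => (Y q).1), opD g l p (fun q => (Y q).2))

/-- The spin coefficient `π = - m̄^a D n_a`. -/
def spinPi : ℂ := - complexLin (fun u => g.val p u (opD g l p n)) (conjVec (m p))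

/-- The spin coefficient `ε = (n^a D l_a - m̄^a D m_a) / 2`. -/
def spinEps : ℂ :=
  (1 / 2) * ((g.val p (n p) (opD g l p l) : ℂ)
    - complexBilin (fun u v => g.val p u v) (conjVec (m p)) (opDC g l p m))

/-- The Weyl scalar `Ψ₂ = C_{abcd} l^a m^b m̄^c n^d`. -/
def weylPsi2 : ℂ :=
  complexBilin (fun u v => g.weyl p (l p) u v (n p)) (m p) (conjVec (m p))

/-- The value `z_a u^a` on a real vector `u` of the covector `z_a` of a complex vector `z`. -/
def lowerC (z : TangentSpace (𝓡 4) p × TangentSpace (𝓡 4) p) (u : TangentSpace (𝓡 4) p) : ℂ :=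
  complexLin (fun v => g.val p v u) z

/-- The 2-form `ε_{ab} = 2 i m_{[a} m̄_{b]} = i (m_a m̄_b - m̄_a m_b)`. -/
def areaForm (u v : TangentSpace (𝓡 4) p) : ℂ :=
  Complex.I * (lowerC g p (m p) u * lowerC g p (conjVec (m p)) v
    - lowerC g p (conjVec (m p)) u * lowerC g p (m p) v)

end NewmanPenrose

/-! ### Non-expanding horizons

A hypersurface is given by an embedding `ψ : H → M` of a 3-manifold. -/

section Horizon

variable {H : Type*} [TopologicalSpace H] [ChartedSpace (EuclideanSpace ℝ (Fin 3)) H]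

/-- `N`, a tangent vector of `M` at `ψ x`, is orthogonal to the hypersurface at `x`. -/
def IsNormalAt (g : LorentzMetric M) (ψ : H → M) (x : H) (N : TangentSpace (𝓡 4) (ψ x)) : Prop :=
  ∀ X : TangentSpace (𝓡 3) x, g.val (ψ x) N (mfderiv (𝓡 3) (𝓡 4) ψ x X) = 0

/-- A null normal of a null hypersurface: a vector field which is smooth near the hypersurface
and which on the hypersurface is nowhere zero and orthogonal to it. -/
structure IsNullNormal (g : LorentzMetric M) (ψ : H → M) (l : ∀ p : M, TangentSpace (𝓡 4) p) :
    Prop where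
  smooth : ∀ x, FieldSmoothAt l (ψ x)
  ne_zero : ∀ x, l (ψ x) ≠ 0
  normal : ∀ x, IsNormalAt g ψ x (l (ψ x))

/-- The expansion `q^{ab} ∇_a l_b` of `l`, where `q^{ab} = - (e₁^a e₁^b + e₂^a e₂^b)` and
`e₁, e₂` is an orthonormal pair of spacelike vectors tangent to the hypersurface. In terms of
`m = (e₁ + i e₂) / √2` one has `q^{ab} = - m^a m̄^b - m̄^a m^b`. -/
def expansion (g : LorentzMetric M) (ψ : H → M) (l : ∀ p : M, TangentSpace (𝓡 4) p) (x : H)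
    (e₁ e₂ : TangentSpace (𝓡 3) x) : ℝ :=
  - (g.val (ψ x) (g.leviCivita l (ψ x) (mfderiv (𝓡 3) (𝓡 4) ψ x e₁))
        (mfderiv (𝓡 3) (𝓡 4) ψ x e₁)
    + g.val (ψ x) (g.leviCivita l (ψ x) (mfderiv (𝓡 3) (𝓡 4) ψ x e₂))
        (mfderiv (𝓡 3) (𝓡 4) ψ x e₂))

/-- A non-expanding horizon `ψ : H → M` in a time-oriented spacetime with energy-momentum
tensor `T`. -/
structure IsNonExpandingHorizon (g : LorentzMetric M) (t : TimeOrientation g)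
    (T : ∀ p : M, TangentSpace (𝓡 4) p →L[ℝ] TangentSpace (𝓡 4) p →L[ℝ] ℝ) (ψ : H → M) :
    Prop where
  embedding : IsSmoothEmbedding (𝓡 3) (𝓡 4) ∞ ψ
  topology : Nonempty (H ≃ₜ ℝ × Metric.sphere (0 : EuclideanSpace ℝ (Fin 3)) 1)
  /-- `H` is null: it has a nonzero null normal at each point. -/
  null : ∀ x, ∃ N : TangentSpace (𝓡 4) (ψ x), N ≠ 0 ∧ IsNormalAt g ψ x N ∧ g.val (ψ x) N N = 0
  /-- Any null normal has vanishing expansion. -/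
  expansion_eq_zero : ∀ l, IsNullNormal g ψ l → ∀ x, ∀ e₁ e₂ : TangentSpace (𝓡 3) x,
    g.val (ψ x) (mfderiv (𝓡 3) (𝓡 4) ψ x e₁) (mfderiv (𝓡 3) (𝓡 4) ψ x e₁) = -1 →
    g.val (ψ x) (mfderiv (𝓡 3) (𝓡 4) ψ x e₂) (mfderiv (𝓡 3) (𝓡 4) ψ x e₂) = -1 →
    g.val (ψ x) (mfderiv (𝓡 3) (𝓡 4) ψ x e₁) (mfderiv (𝓡 3) (𝓡 4) ψ x e₂) = 0 →
    expansion g ψ l x e₁ e₂ = 0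
  /-- Einstein's equations `Ric_{ab} - R g_{ab} / 2 = - 8 π T_{ab}` hold on `H`; the sign on the
  right is that of the sign convention for `Ric_{ab}`. -/
  einstein : ∀ x, ∀ u v : TangentSpace (𝓡 4) (ψ x),
    g.ricci (ψ x) u v - (1 / 2) * g.scalar (ψ x) * g.val (ψ x) u v
      = - (8 * Real.pi * T (ψ x) u v)
  /-- For every future pointing null normal `N` the vector `w^a = T^a{}_b N^b` is zero or causal
  and future pointing. -/
  energy : ∀ x, ∀ N w : TangentSpace (𝓡 4) (ψ x), N ≠ 0 → IsNormalAt g ψ x N →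
    t.FutureCausal (ψ x) N → (∀ u, g.val (ψ x) w u = T (ψ x) N u) → t.FutureCausal (ψ x) w

/-- The rotational 1-form `ω` of a null normal `l`: the 1-form on `H` with `D_a l^b = ω_a l^b`. -/
def IsRotationalForm (g : LorentzMetric M) (ψ : H → M) (l : ∀ p : M, TangentSpace (𝓡 4) p)
    (rot : ∀ x : H, TangentSpace (𝓡 3) x →L[ℝ] ℝ) : Prop :=
  ∀ (x : H) (X : TangentSpace (𝓡 3) x),
    g.leviCivita l (ψ x) (mfderiv (𝓡 3) (𝓡 4) ψ x X) = rot x X • l (ψ x)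

/-! ### Cross-sections and adapted tetrads -/

variable {S : Type*} [TopologicalSpace S] [ChartedSpace (EuclideanSpace ℝ (Fin 2)) S]

/-- The push-forward to `M` of a vector tangent to a surface `σ : S → H` in the hypersurface. -/
def push (ψ : H → M) (σ : S → H) (s : S) (u : TangentSpace (𝓡 2) s) :
    TangentSpace (𝓡 4) (ψ (σ s)) :=
  mfderiv (𝓡 3) (𝓡 4) ψ (σ s) (mfderiv (𝓡 2) (𝓡 3) σ s u)

/-- A spherical cross-section of the horizon: an embedded 2-sphere which is spacelike,
equivalently, transversal to the null generators. -/
structure IsSphericalSection (g : LorentzMetric M) (ψ : H → M) (σ : S → H) : Prop where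
  embedding : IsSmoothEmbedding (𝓡 2) (𝓡 3) ∞ σ
  sphere : Nonempty (S ≃ₜ Metric.sphere (0 : EuclideanSpace ℝ (Fin 3)) 1)
  spacelike : ∀ s, ∀ u : TangentSpace (𝓡 2) s, u ≠ 0 →
    g.val (ψ (σ s)) (push ψ σ s u) (push ψ σ s u) < 0

/-- `(l, n, m, m̄)`, for a null normal `l`, is a null tetrad on the open set `U` adapted to the
horizon and to its cross-section `S`: on `S` the complex vector `m` is tangent to `S` and
normalized, it is Lie dragged along `l` over the horizon, and `n` completes the tetrad.
(A frame `m` of `S` exists only locally, hence the open set `U`.) -/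
structure IsAdaptedTetrad (g : LorentzMetric M) (ψ : H → M) (σ : S → H)
    (l n : ∀ p : M, TangentSpace (𝓡 4) p)
    (m : ∀ p : M, TangentSpace (𝓡 4) p × TangentSpace (𝓡 4) p) (U : Set M) : Prop where
  isOpen : IsOpen U
  smooth_n : ∀ p ∈ U, FieldSmoothAt n p
  smooth_m_re : ∀ p ∈ U, FieldSmoothAt (fun q => (m q).1) p
  smooth_m_im : ∀ p ∈ U, FieldSmoothAt (fun q => (m q).2) p
  /-- `m` is tangent to the horizon. -/
  tangent : ∀ x, ψ x ∈ U → ∃ a b : TangentSpace (𝓡 3) x,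
    m (ψ x) = (mfderiv (𝓡 3) (𝓡 4) ψ x a, mfderiv (𝓡 3) (𝓡 4) ψ x b)
  /-- The Lie derivative of `m` along `l` vanishes on the horizon. -/
  lie_re : ∀ x, ψ x ∈ U → mlieBracket (𝓡 4) l (fun q => (m q).1) (ψ x) = 0
  lie_im : ∀ x, ψ x ∈ U → mlieBracket (𝓡 4) l (fun q => (m q).2) (ψ x) = 0
  n_null : ∀ x, ψ x ∈ U → g.val (ψ x) (n (ψ x)) (n (ψ x)) = 0
  l_n : ∀ x, ψ x ∈ U → g.val (ψ x) (l (ψ x)) (n (ψ x)) = 1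
  m_n : ∀ x, ψ x ∈ U → lowerC g (ψ x) (m (ψ x)) (n (ψ x)) = 0
  /-- On the cross-section `m` is tangent to it. -/
  tangent_section : ∀ s, ψ (σ s) ∈ U → ∃ a b : TangentSpace (𝓡 2) s,
    m (ψ (σ s)) = (push ψ σ s a, push ψ σ s b)
  m_m : ∀ s, ψ (σ s) ∈ U → complexBilin (fun u v => g.val (ψ (σ s)) u v)
    (m (ψ (σ s))) (m (ψ (σ s))) = 0
  m_conj_m : ∀ s, ψ (σ s) ∈ U → complexBilin (fun u v => g.val (ψ (σ s)) u v)
    (m (ψ (σ s))) (conjVec (m (ψ (σ s)))) = -1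

end Horizon

end Spacetime

/-! ### Differential 1-forms -/

/-- Smoothness of a 1-form on a `k`-manifold. -/
def SmoothOneForm {k : ℕ} {N : Type*} [TopologicalSpace N]
    [ChartedSpace (EuclideanSpace ℝ (Fin k)) N] [IsManifold (𝓡 k) ∞ N]
    (α : ∀ x : N, TangentSpace (𝓡 k) x →L[ℝ] ℝ) : Prop :=
  ContMDiff (𝓡 k) ((𝓡 k).prod 𝓘(ℝ, EuclideanSpace ℝ (Fin k) →L[ℝ] ℝ)) ∞
    (fun x => TotalSpace.mk' (EuclideanSpace ℝ (Fin k) →L[ℝ] ℝ) x (α x))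

/-- The pull-back `σ^* ω` of a 1-form under a map `σ`. -/
def pullbackForm {j k : ℕ} {N N' : Type*} [TopologicalSpace N]
    [ChartedSpace (EuclideanSpace ℝ (Fin j)) N] [TopologicalSpace N']
    [ChartedSpace (EuclideanSpace ℝ (Fin k)) N'] (σ : N → N')
    (rot : ∀ x : N', TangentSpace (𝓡 k) x →L[ℝ] ℝ) (s : N) : TangentSpace (𝓡 j) s →L[ℝ] ℝ :=
  (rot (σ s)).comp (mfderiv (𝓡 j) (𝓡 k) σ s)

/-- The exterior derivative `(dα)(u, v)` at `x` of a 1-form `α` on a `k`-manifold, with the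
normalization `(dα)_{ab} = 2 ∇_{[a} α_{b]}`: the exterior derivative of the coordinate expression
of `α` in the preferred chart at `x`. -/
def extDerivOneForm {k : ℕ} {N : Type*} [TopologicalSpace N]
    [ChartedSpace (EuclideanSpace ℝ (Fin k)) N]
    (α : ∀ x : N, TangentSpace (𝓡 k) x →L[ℝ] ℝ) (x : N) (u v : TangentSpace (𝓡 k) x) : ℝ :=
  extDeriv (fun y : EuclideanSpace ℝ (Fin k) =>
      ContinuousAlternatingMap.ofSubsingleton ℝ (EuclideanSpace ℝ (Fin k)) ℝ (0 : Fin 1)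
        ((α ((extChartAt (𝓡 k) x).symm y)).comp
          (mfderiv 𝓘(ℝ, EuclideanSpace ℝ (Fin k)) (𝓡 k) (extChartAt (𝓡 k) x).symm y)))
    (extChartAt (𝓡 k) x x)
    ![mfderiv (𝓡 k) 𝓘(ℝ, EuclideanSpace ℝ (Fin k)) (extChartAt (𝓡 k) x) x u,
      mfderiv (𝓡 k) 𝓘(ℝ, EuclideanSpace ℝ (Fin k)) (extChartAt (𝓡 k) x) x v]

end NullHorizon

end

open NullHorizon

set_option linter.unusedSectionVars false

/-! For `X`, `Y` tangent to the horizon put `B(X, Y) = g(∇_X l, Y)`. Differentiating `g(l, Y) = 0`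
along the horizon gives `B(X, Y) = - g(l, ∇_X Y)`, and absence of torsion makes `B` symmetric. The
horizon is null, so `l` is tangent to it as well as normal; from `g(l, l) = 0` one gets `B(X, l) =
0`, hence `B(l, X) = 0`, and `∇_l l` is a multiple of `l`.

The horizon condition is used to show `B = 0`. Expanding `R(l, X, l, X)` for tangential `X`, tracing
over the spacelike directions and differentiating along `l` the vanishing of the trace of `B` gives
the Raychaudhuri identity `Ric(l, l) = |B|²` (`ricci_l_l`). Einstein's equations and the energy
condition give `Ric(l, l) = - 8 π T(l, l) ≤ 0`, so `B = 0` (`leviCivita_l_tangent_eq_zero`). Then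
`∇_X l` is orthogonal to the horizon, hence a multiple of `l`; the factor is `ω(X)`.

For `n` with `g(l, n) = 1`, `ω` is the pull-back of the ambient form `g(n, ∇l)`. This gives
smoothness, and the exterior derivative can be computed in spacetime. For commuting `X`, `Y` the
derivative of `g(n, ∇_Y l)` along `X` is `g(n, ∇_X ∇_Y l) + g(∇_X n, ∇_Y l)`; the last term is `-
ω(X) ω(Y)` and drops out on antisymmetrizing, leaving `dω(X, Y) = R(X, Y, l, n)`
(`extDerivOneForm_rot`). With `m = a + i b`, the Ricci and scalar parts of the Weyl tensor entering
`Ψ₂` are symmetric in `a`, `b`, so by the first Bianchi identity `Im Ψ₂ = R(a, b, l, n)`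
(`im_weylPsi2`), while the area form takes the value `1/2` on `(a, b)`. Contracting `∇_l m = ∇_m l`
with the tetrad identifies `ε` and `π`.

Since the curvature is defined through chosen extensions and the exterior derivative through charts,
tensoriality and the symmetries of the curvature, and naturality of the exterior derivative, are
established along the way. -/

namespace NullHorizon

set_option linter.unusedSectionVars false

/-! ### Smooth vector fields near a point and local frames. -/

section Calculus

variable {M : Type*} [TopologicalSpace M] [ChartedSpace (EuclideanSpace ℝ (Fin 4)) M]
  [IsManifold (𝓡 4) ∞ M]

theorem FieldSmoothAt.diffAt {X : ∀ p : M, TangentSpace (𝓡 4) p} {p : M}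
    (hX : FieldSmoothAt X p) : FieldDiffAt X p :=
  ContMDiffAt.mdifferentiableAt hX (by simp)

theorem FieldSmoothAt.eventually_diffAt {X : ∀ p : M, TangentSpace (𝓡 4) p} {p : M}
    (hX : FieldSmoothAt X p) : ∀ᶠ q in 𝓝 p, FieldDiffAt X q := by
  have h : ContMDiffAt (𝓡 4) ((𝓡 4).prod 𝓘(ℝ, EuclideanSpace ℝ (Fin 4))) 1
    (fun q => TotalSpace.mk' (EuclideanSpace ℝ (Fin 4)) q (X q)) p := hX.of_le (by simp)
  exact ((contMDiffAt_iff_contMDiffAt_nhds (by simp)).1 h).mono fun q hq =>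
    hq.mdifferentiableAt (by simp)

theorem eventually_mdifferentiableAt {f : M → ℝ} {p : M}
    (hf : ContMDiffAt (𝓡 4) 𝓘(ℝ) ∞ f p) : ∀ᶠ q in 𝓝 p, MDifferentiableAt (𝓡 4) 𝓘(ℝ) f q := by
  have h : ContMDiffAt (𝓡 4) 𝓘(ℝ) 1 f p := hf.of_le (by simp)
  exact ((contMDiffAt_iff_contMDiffAt_nhds (by simp)).1 h).mono fun q hq =>
    hq.mdifferentiableAt (by simp)

theorem fieldSmoothAt_extend {p : M} (v : TangentSpace (𝓡 4) p) :
    FieldSmoothAt (FiberBundle.extend (EuclideanSpace ℝ (Fin 4)) v) p :=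
  FiberBundle.contMDiffAt_extend (𝓡 4) (EuclideanSpace ℝ (Fin 4)) v

theorem FieldSmoothAt.add {X Y : ∀ p : M, TangentSpace (𝓡 4) p} {p : M}
    (hX : FieldSmoothAt X p) (hY : FieldSmoothAt Y p) : FieldSmoothAt (X + Y) p :=
  ContMDiffAt.add_section hX hY

theorem FieldSmoothAt.smul {f : M → ℝ} {X : ∀ p : M, TangentSpace (𝓡 4) p} {p : M}
    (hf : ContMDiffAt (𝓡 4) 𝓘(ℝ) ∞ f p) (hX : FieldSmoothAt X p) : FieldSmoothAt (f • X) p :=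
  hf.smul_section hX

theorem FieldSmoothAt.sum {ι : Type*} {s : Finset ι} {X : ι → ∀ p : M, TangentSpace (𝓡 4) p}
    {p : M} (hX : ∀ i ∈ s, FieldSmoothAt (X i) p) : FieldSmoothAt (∑ i ∈ s, X i) p := by
  have := ContMDiffAt.sum_section hX
  simpa [FieldSmoothAt, Finset.sum_apply] using this

theorem FieldSmoothAt.congr {X Y : ∀ p : M, TangentSpace (𝓡 4) p} {p : M}
    (hX : FieldSmoothAt X p) (h : ∀ᶠ q in 𝓝 p, Y q = X q) : FieldSmoothAt Y p :=
  ContMDiffAt.congr_of_eventuallyEq hX (h.mono fun q hq => by simp [hq])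

theorem FieldSmoothAt.dirDeriv {f : M → ℝ} {X : ∀ p : M, TangentSpace (𝓡 4) p} {p : M}
    (hf : ContMDiffAt (𝓡 4) 𝓘(ℝ) ∞ f p) (hX : FieldSmoothAt X p) :
    ContMDiffAt (𝓡 4) 𝓘(ℝ) ∞ (fun q => mvfderiv (𝓡 4) f q (X q)) p := by
  have h1 := hf.mfderiv_const (m := ∞) (by simp)
  have h2 : ContMDiffAt (𝓡 4) ((𝓘(ℝ)).prod 𝓘(ℝ)) ∞
      (fun q => TotalSpace.mk' ℝ (E := (TangentSpace 𝓘(ℝ) : ℝ → Type _)) (f q)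
        (mfderiv (𝓡 4) 𝓘(ℝ) f q (X q))) p :=
    ContMDiffAt.clm_apply_of_inCoordinates h1 hX hf
  exact ((contMDiff_snd_tangentBundle_modelSpace ℝ 𝓘(ℝ)).contMDiffAt.comp p h2 :)

theorem FieldSmoothAt.bracket {X Y : ∀ p : M, TangentSpace (𝓡 4) p} {p : M}
    (hX : FieldSmoothAt X p) (hY : FieldSmoothAt Y p) :
    FieldSmoothAt (mlieBracket (𝓡 4) X Y) p := by
  have : IsManifold (𝓡 4) (minSmoothness ℝ 2) M := by
    rw [minSmoothness_of_isRCLikeNormedField]; infer_instance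
  have : IsManifold (𝓡 4) (minSmoothness ℝ 3) M := by
    rw [minSmoothness_of_isRCLikeNormedField]; infer_instance
  have : IsManifold (𝓡 4) (((⊤ : ℕ∞) : WithTop ℕ∞) + 1) M := ‹IsManifold (𝓡 4) ∞ M›
  exact ContMDiffAt.mlieBracket_vectorField (m := ⊤) (n := ⊤) hX hY (by simp)

theorem mlieBracket_congr_left {X X' Y : ∀ p : M, TangentSpace (𝓡 4) p} {p : M}
    (h : ∀ᶠ q in 𝓝 p, X' q = X q) : mlieBracket (𝓡 4) X' Y p = mlieBracket (𝓡 4) X Y p :=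
  Filter.EventuallyEq.mlieBracket_vectorField_eq h (W := Y) (W₁ := Y)
    (Filter.Eventually.of_forall fun _ => rfl)

theorem mlieBracket_congr_right {X Y Y' : ∀ p : M, TangentSpace (𝓡 4) p} {p : M}
    (h : ∀ᶠ q in 𝓝 p, Y' q = Y q) : mlieBracket (𝓡 4) X Y' p = mlieBracket (𝓡 4) X Y p :=
  Filter.EventuallyEq.mlieBracket_vectorField_eq (V := X) (V₁ := X)
    (Filter.Eventually.of_forall fun _ => rfl) h

theorem mvfderiv_congr {f h : M → ℝ} {p : M} (hfh : f =ᶠ[𝓝 p] h) :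
    mvfderiv (𝓡 4) f p = mvfderiv (𝓡 4) h p := by
  ext v
  simp only [mvfderiv, hfh.mfderiv_eq]
  rfl

/-- A smooth vector field is locally a smooth combination of a smooth frame which does not depend
on the field, with coefficients at the base point which depend only on the value there. -/
theorem exists_frame (p : M) : ∃ e : Fin 4 → ∀ q : M, TangentSpace (𝓡 4) q,
    (∀ i, FieldSmoothAt (e i) p) ∧
    (∀ᶠ q in 𝓝 p, LinearIndependent ℝ fun i => e i q) ∧
    ∃ c : Fin 4 → ∀ q : M, TangentSpace (𝓡 4) q →ₗ[ℝ] ℝ,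
      (∀ᶠ q in 𝓝 p, ∀ v : TangentSpace (𝓡 4) q, v = ∑ i, c i q v • e i q) ∧
      ∀ X : ∀ q : M, TangentSpace (𝓡 4) q, FieldSmoothAt X p →
        ∀ i, ContMDiffAt (𝓡 4) 𝓘(ℝ) ∞ (fun q => c i q (X q)) p := by
  let t := trivializationAt (EuclideanSpace ℝ (Fin 4)) (TangentSpace (𝓡 4) : M → Type _) p
  let b := (EuclideanSpace.basisFun (Fin 4) ℝ).toBasis
  have hp : p ∈ t.baseSet := FiberBundle.mem_baseSet_trivializationAt' p
  have hev : ∀ᶠ q in 𝓝 p, q ∈ t.baseSet := t.open_baseSet.mem_nhds hp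
  have : ContMDiffVectorBundle 1 (EuclideanSpace ℝ (Fin 4)) (TangentSpace (𝓡 4) : M → Type _) (𝓡 4) :=
    inferInstance
  refine ⟨t.localFrame b, fun i => ?_, ?_, t.localFrameCoeff (𝓡 4) b, ?_, ?_⟩
  · exact contMDiffAt_localFrame_of_mem (I := 𝓡 4) ∞ t b i hp
  · filter_upwards [hev] with q hq
    exact (t.isLocalFrameOn_localFrame_baseSet (𝓡 4) 1 b).linearIndependent hq
  · filter_upwards [hev] with q hq v
    have := t.eq_sum_localFrameCoeff_smul (I := 𝓡 4) (b := b)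
      (s := FiberBundle.extend (EuclideanSpace ℝ (Fin 4)) v) hq
    simpa using this
  · intro X hX i
    exact contMDiffAt_localFrameCoeff b hp hX i

end Calculus
end NullHorizon

namespace NullHorizon

/-! ### The Lie bracket acting on functions. -/

section CommutatorOnFunctions

variable {M : Type*} [TopologicalSpace M] [ChartedSpace (EuclideanSpace ℝ (Fin 4)) M]
  [IsManifold (𝓡 4) ∞ M]

/-- `[X, Y] f = X (Y f) - Y (X f)`. -/
theorem mvfderiv_mlieBracket {f : M → ℝ} {X Y : ∀ p : M, TangentSpace (𝓡 4) p} {p : M}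
    (hf : ContMDiffAt (𝓡 4) 𝓘(ℝ) ∞ f p) (hX : FieldSmoothAt X p) (hY : FieldSmoothAt Y p) :
    mvfderiv (𝓡 4) f p (mlieBracket (𝓡 4) X Y p) =
      mvfderiv (𝓡 4) (fun q => mvfderiv (𝓡 4) f q (Y q)) p (X p)
        - mvfderiv (𝓡 4) (fun q => mvfderiv (𝓡 4) f q (X q)) p (Y p) := by
  have : IsManifold (𝓡 4) (minSmoothness ℝ 3) M := by
    rw [minSmoothness_of_isRCLikeNormedField]; infer_instance
  obtain ⟨e, he, hli, -⟩ := exists_frame p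
  set Z := e 0
  have hZ : FieldSmoothAt Z p := he 0
  have hZ0 : Z p ≠ 0 := hli.self_of_nhds.ne_zero 0
  have hfd := eventually_mdifferentiableAt hf
  have h2 {W : ∀ p : M, TangentSpace (𝓡 4) p} (hW : FieldSmoothAt W p) :
      ContMDiffAt (𝓡 4) ((𝓡 4).prod 𝓘(ℝ, EuclideanSpace ℝ (Fin 4))) (minSmoothness ℝ 2)
        (fun q => TotalSpace.mk' (EuclideanSpace ℝ (Fin 4)) q (W q)) p :=
    ContMDiffAt.of_le hW (by
      rw [minSmoothness_of_isRCLikeNormedField]; exact WithTop.coe_le_coe.2 le_top)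
  have hb {W : ∀ p : M, TangentSpace (𝓡 4) p} (hW : FieldSmoothAt W p) :
      mlieBracket (𝓡 4) W (f • Z) =ᶠ[𝓝 p]
        (fun q => mvfderiv (𝓡 4) f q (W q)) • Z + f • mlieBracket (𝓡 4) W Z := by
    filter_upwards [hfd, hW.eventually_diffAt, hZ.eventually_diffAt] with q h1 h2 h3
    rw [mlieBracket_smul_right h1 h3]
    rfl
  have hbb {V W : ∀ p : M, TangentSpace (𝓡 4) p} (hV : FieldSmoothAt V p)
      (hW : FieldSmoothAt W p) :
      mlieBracket (𝓡 4) V (mlieBracket (𝓡 4) W (f • Z)) p =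
        mvfderiv (𝓡 4) (fun q => mvfderiv (𝓡 4) f q (W q)) p (V p) • Z p
          + mvfderiv (𝓡 4) f p (W p) • mlieBracket (𝓡 4) V Z p
          + (mvfderiv (𝓡 4) f p (V p) • mlieBracket (𝓡 4) W Z p
            + f p • mlieBracket (𝓡 4) V (mlieBracket (𝓡 4) W Z) p) := by
    have hd := hW.dirDeriv hf
    rw [mlieBracket_congr_right (hb hW),
      mlieBracket_add_right (FieldSmoothAt.smul hd hZ).diffAt
        (FieldSmoothAt.smul hf (hW.bracket hZ)).diffAt,
      mlieBracket_smul_right (hd.mdifferentiableAt (by simp)) hZ.diffAt,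
      mlieBracket_smul_right hfd.self_of_nhds (hW.bracket hZ).diffAt]
  -- The Jacobi identity for `X, Y, fZ` minus `f` times the one for `X, Y, Z`: the first-order terms
  -- in `f` match on both sides, and what remains is the claimed identity multiplied by the
  -- nonvanishing vector `Z p`.
  have hJ := leibniz_identity_mlieBracket_apply (h2 hX) (h2 hY) (h2 (FieldSmoothAt.smul hf hZ))
  have hJ0 := leibniz_identity_mlieBracket_apply (h2 hX) (h2 hY) (h2 hZ)
  rw [hbb hX hY, hbb hY hX, (hb (hX.bracket hY)).eq_of_nhds, hJ0] at hJ
  simp only [Pi.add_apply, Pi.smul_apply', smul_add] at hJ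
  have key : (mvfderiv (𝓡 4) f p (mlieBracket (𝓡 4) X Y p) -
      (mvfderiv (𝓡 4) (fun q => mvfderiv (𝓡 4) f q (Y q)) p (X p)
        - mvfderiv (𝓡 4) (fun q => mvfderiv (𝓡 4) f q (X q)) p (Y p))) • Z p = 0 := by
    rw [sub_smul, sub_smul]
    linear_combination (norm := module) -hJ
  exact sub_eq_zero.1 ((smul_eq_zero.1 key).resolve_right hZ0)

end CommutatorOnFunctions

/-! ### Smoothness and locality of the Levi-Civita connection. -/

namespace LorentzMetric

variable {M : Type*} [TopologicalSpace M] [ChartedSpace (EuclideanSpace ℝ (Fin 4)) M]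
  [IsManifold (𝓡 4) ∞ M] (g : LorentzMetric M)

theorem contMDiffAt_val {X Y : ∀ p : M, TangentSpace (𝓡 4) p} {p : M}
    (hX : FieldSmoothAt X p) (hY : FieldSmoothAt Y p) :
    ContMDiffAt (𝓡 4) 𝓘(ℝ) ∞ (fun q => g.val q (X q) (Y q)) p := by
  have h : ContMDiffAt (𝓡 4) ((𝓡 4).prod 𝓘(ℝ)) ∞
      (fun q => TotalSpace.mk' ℝ (E := Bundle.Trivial M ℝ) q (g.val q (X q) (Y q))) p := by
    apply ContMDiffAt.clm_bundle_apply₂ (F₁ := EuclideanSpace ℝ (Fin 4))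
      (F₂ := EuclideanSpace ℝ (Fin 4))
    · exact g.contMDiff p
    · exact hX
    · exact hY
  simp only [contMDiffAt_totalSpace] at h
  exact h.2

theorem contMDiffAt_koszul {X Y Z : ∀ p : M, TangentSpace (𝓡 4) p} {p : M}
    (hX : FieldSmoothAt X p) (hY : FieldSmoothAt Y p) (hZ : FieldSmoothAt Z p) :
    ContMDiffAt (𝓡 4) 𝓘(ℝ) ∞ (g.koszul X Y Z) p := by
  unfold koszul
  refine contMDiffAt_const.mul ?_
  exact ((((hX.dirDeriv (g.contMDiffAt_val hY hZ)).add
    (hY.dirDeriv (g.contMDiffAt_val hX hZ))).sub (hZ.dirDeriv (g.contMDiffAt_val hX hY))).add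
    (g.contMDiffAt_val (hX.bracket hY) hZ)).sub (g.contMDiffAt_val (hX.bracket hZ) hY) |>.sub
    (g.contMDiffAt_val (hY.bracket hZ) hX)

theorem contMDiffAt_val_leviCivita {X Y Z : ∀ p : M, TangentSpace (𝓡 4) p} {p : M}
    (hX : FieldSmoothAt X p) (hY : FieldSmoothAt Y p) (hZ : FieldSmoothAt Z p) :
    ContMDiffAt (𝓡 4) 𝓘(ℝ) ∞ (fun q => g.val q (g.leviCivita Y q (X q)) (Z q)) p := by
  refine (g.contMDiffAt_koszul hX hY hZ).congr_of_eventuallyEq ?_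
  filter_upwards [hX.eventually_diffAt, hY.eventually_diffAt, hZ.eventually_diffAt]
    with q h1 h2 h3 using g.leviCivita_apply h1 h2 h3

/-- A vector field is smooth if its inner products with smooth vector fields are. -/
theorem fieldSmoothAt_of_val {V : ∀ p : M, TangentSpace (𝓡 4) p} {p : M}
    (h : ∀ Z : ∀ p : M, TangentSpace (𝓡 4) p, FieldSmoothAt Z p →
      ContMDiffAt (𝓡 4) 𝓘(ℝ) ∞ (fun q => g.val q (V q) (Z q)) p) : FieldSmoothAt V p := by
  obtain ⟨e, he, hli, c, hc, -⟩ := exists_frame p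
  -- The coefficients of `V` in the frame solve a linear system with the Gram matrix of the frame
  -- and right-hand sides `g(V, e_j)`. Cramer's rule exhibits them as smooth functions once the Gram
  -- determinant is nonzero, which is nondegeneracy of the metric.
  let G : M → Matrix (Fin 4) (Fin 4) ℝ := fun q => Matrix.of fun i j => g.val q (e i q) (e j q)
  have hG : ∀ i j, ContMDiffAt (𝓡 4) 𝓘(ℝ) ∞ (fun q => G q i j) p := fun i j =>
    g.contMDiffAt_val (he i) (he j)
  have hdet : ContMDiffAt (𝓡 4) 𝓘(ℝ) ∞ (fun q => (G q).det) p := by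
    simp only [Matrix.det_apply']
    refine ContMDiffAt.sum fun τ _ => contMDiffAt_const.mul ?_
    exact ContMDiffAt.prod fun i _ => hG _ _
  have hdet0 : ∀ᶠ q in 𝓝 p, (G q).det ≠ 0 := by
    filter_upwards [hli, hc] with q hq hcq hd
    obtain ⟨v, hv0, hv⟩ := Matrix.exists_vecMul_eq_zero_iff.2 hd
    have hz : (∑ i, v i • e i q : TangentSpace (𝓡 4) q) = 0 := by
      have hj : ∀ j, g.val q (∑ i, v i • e i q) (e j q) = 0 := fun j => by
        simpa [Matrix.vecMul, dotProduct, G] using congrFun hv j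
      refine g.ext_val fun w => ?_
      rw [hcq w, map_sum, map_zero, _root_.zero_apply]
      refine Finset.sum_eq_zero fun j _ => ?_
      rw [map_smul, hj j, smul_zero]
    exact hv0 (funext fun i => Fintype.linearIndependent_iff.1 hq v hz i)
  have hcof : ∀ i, ContMDiffAt (𝓡 4) 𝓘(ℝ) ∞
      (fun q => ((G q).det)⁻¹ * (G q).cramer (fun j => g.val q (V q) (e j q)) i) p := by
    intro i
    refine ContMDiffAt.mul (hdet.inv₀ hdet0.self_of_nhds) ?_
    simp only [Matrix.cramer_apply, Matrix.det_apply']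
    refine ContMDiffAt.sum fun τ _ => contMDiffAt_const.mul (ContMDiffAt.prod fun k _ => ?_)
    by_cases hk : k = i
    · subst hk
      simpa using h _ (he _)
    · simpa [Matrix.updateCol_ne hk] using hG _ _
  refine (FieldSmoothAt.sum (s := Finset.univ) fun i _ =>
    FieldSmoothAt.smul (hcof i) (he i)).congr ?_
  filter_upwards [hdet0, hc] with q hd hcq
  have hsymm : (G q).transpose = G q := by
    ext i j; exact g.symm q _ _
  have hu : (fun i => c i q (V q)) = (G q).det⁻¹ • (G q).cramer (fun j => g.val q (V q) (e j q)) := by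
    have : (fun j => g.val q (V q) (e j q)) = (G q).mulVec (fun i => c i q (V q)) := by
      ext j
      conv_lhs => rw [hcq (V q)]
      simp [Matrix.mulVec, dotProduct, G, g.symm q (e j q), mul_comm]
    rw [this, Matrix.cramer_eq_adjugate_mulVec, Matrix.mulVec_mulVec, Matrix.adjugate_mul,
      Matrix.smul_mulVec, Matrix.one_mulVec, smul_smul, inv_mul_cancel₀ hd, one_smul]
  conv_lhs => rw [hcq (V q)]
  simp only [Finset.sum_apply, Pi.smul_apply']
  refine Finset.sum_congr rfl fun i _ => ?_
  rw [show c i q (V q) = _ from congrFun hu i]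
  rfl

theorem fieldSmoothAt_leviCivita {X Y : ∀ p : M, TangentSpace (𝓡 4) p} {p : M}
    (hX : FieldSmoothAt X p) (hY : FieldSmoothAt Y p) :
    FieldSmoothAt (fun q => g.leviCivita Y q (X q)) p :=
  g.fieldSmoothAt_of_val fun _ hZ => g.contMDiffAt_val_leviCivita hX hY hZ

/-- Every term of the Koszul formula depends only on the germ of the field. This permits replacing a
field inside a second covariant derivative by an expression valid only near the point. -/
theorem leviCivita_congr {Y Y' : ∀ p : M, TangentSpace (𝓡 4) p} {p : M} (hY : FieldDiffAt Y p)
    (h : ∀ᶠ q in 𝓝 p, Y' q = Y q) : g.leviCivita Y' p = g.leviCivita Y p := by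
  have hY' : FieldDiffAt Y' p :=
    MDifferentiableAt.congr_of_eventuallyEq hY (h.mono fun q hq => by simp [hq])
  ext1 v
  refine g.ext_val fun w => ?_
  have hv := FiberBundle.mdifferentiableAt_extend (𝓡 4) (EuclideanSpace ℝ (Fin 4)) v
  have hw := FiberBundle.mdifferentiableAt_extend (𝓡 4) (EuclideanSpace ℝ (Fin 4)) w
  have k1 := g.leviCivita_apply hv hY hw
  have k2 := g.leviCivita_apply hv hY' hw
  simp only [FiberBundle.extend_apply_self] at k1 k2
  rw [k1, k2]
  unfold koszul
  rw [mlieBracket_congr_right h,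
    mlieBracket_congr_left h, h.self_of_nhds]
  have e1 (W : ∀ p : M, TangentSpace (𝓡 4) p) :
      mvfderiv (𝓡 4) (fun q => g.val q (Y' q) (W q)) p =
        mvfderiv (𝓡 4) (fun q => g.val q (Y q) (W q)) p :=
    mvfderiv_congr (h.mono fun q hq => by simp only [hq])
  have e2 (W : ∀ p : M, TangentSpace (𝓡 4) p) :
      mvfderiv (𝓡 4) (fun q => g.val q (W q) (Y' q)) p =
        mvfderiv (𝓡 4) (fun q => g.val q (W q) (Y q)) p :=
    mvfderiv_congr (h.mono fun q hq => by simp only [hq])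
  rw [e1, e2]

end LorentzMetric
end NullHorizon

namespace NullHorizon

/-! ### Tensoriality of the curvature. -/

section Tensorial

variable {M : Type*} [TopologicalSpace M] [ChartedSpace (EuclideanSpace ℝ (Fin 4)) M]
  [IsManifold (𝓡 4) ∞ M]

/-- A local operator on smooth vector fields which is linear over smooth functions depends only on
the value of the field at the point. -/
theorem eq_of_smooth_tensorial {W : Type*} [AddCommGroup W] [Module ℝ W] {p : M}
    (Φ : (∀ q : M, TangentSpace (𝓡 4) q) → W)
    (hadd : ∀ X Y, FieldSmoothAt X p → FieldSmoothAt Y p → Φ (X + Y) = Φ X + Φ Y)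
    (hsmul : ∀ (f : M → ℝ) X, ContMDiffAt (𝓡 4) 𝓘(ℝ) ∞ f p → FieldSmoothAt X p →
      Φ (f • X) = f p • Φ X)
    (hcongr : ∀ X X', FieldSmoothAt X p → (∀ᶠ q in 𝓝 p, X' q = X q) → Φ X' = Φ X)
    {X X' : ∀ q : M, TangentSpace (𝓡 4) q} (hX : FieldSmoothAt X p) (hX' : FieldSmoothAt X' p)
    (h : X p = X' p) : Φ X = Φ X' := by
  obtain ⟨e, he, -, c, hc, hcs⟩ := exists_frame p
  have key : ∀ Y, FieldSmoothAt Y p → Φ Y = ∑ i, c i p (Y p) • Φ (e i) := by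
    intro Y hY
    have hf i : FieldSmoothAt ((fun q => c i q (Y q)) • e i) p :=
      FieldSmoothAt.smul (hcs Y hY i) (he i)
    have hev : ∀ᶠ q in 𝓝 p, Y q = (((fun q => c 0 q (Y q)) • e 0 + (fun q => c 1 q (Y q)) • e 1)
        + (fun q => c 2 q (Y q)) • e 2 + (fun q => c 3 q (Y q)) • e 3) q := by
      filter_upwards [hc] with q hq
      conv_lhs => rw [hq (Y q)]
      rw [Fin.sum_univ_four]
      rfl
    rw [hcongr _ _ ((((hf 0).add (hf 1)).add (hf 2)).add (hf 3)) hev,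
      hadd _ _ (((hf 0).add (hf 1)).add (hf 2)) (hf 3), hadd _ _ ((hf 0).add (hf 1)) (hf 2),
      hadd _ _ (hf 0) (hf 1), Fin.sum_univ_four]
    simp only [hsmul _ _ (hcs Y hY _) (he _)]
  rw [key X hX, key X' hX', h]

end Tensorial

namespace LorentzMetric

variable {M : Type*} [TopologicalSpace M] [ChartedSpace (EuclideanSpace ℝ (Fin 4)) M]
  [IsManifold (𝓡 4) ∞ M] (g : LorentzMetric M)

theorem leviCivita_add {Y Y' : ∀ p : M, TangentSpace (𝓡 4) p} {p : M} (hY : FieldDiffAt Y p)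
    (hY' : FieldDiffAt Y' p) :
    g.leviCivita (Y + Y') p = g.leviCivita Y p + g.leviCivita Y' p :=
  g.leviCivita.isCovariantDerivativeOnUniv.add hY hY'

theorem leviCivita_smul {f : M → ℝ} {Y : ∀ p : M, TangentSpace (𝓡 4) p} {p : M}
    (hf : MDifferentiableAt (𝓡 4) 𝓘(ℝ) f p) (hY : FieldDiffAt Y p) (v : TangentSpace (𝓡 4) p) :
    g.leviCivita (f • Y) p v = f p • g.leviCivita Y p v + mvfderiv (𝓡 4) f p v • Y p := by
  rw [g.leviCivita.isCovariantDerivativeOnUniv.leibniz hY hf]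
  rfl

/-- The curvature `∇_X ∇_Y Z - ∇_Y ∇_X Z - ∇_[X,Y] Z` of three vector fields. -/
noncomputable def curv (X Y Z : ∀ p : M, TangentSpace (𝓡 4) p) (p : M) : TangentSpace (𝓡 4) p :=
  g.leviCivita (fun q => g.leviCivita Z q (Y q)) p (X p)
    - g.leviCivita (fun q => g.leviCivita Z q (X q)) p (Y p)
    - g.leviCivita Z p (mlieBracket (𝓡 4) X Y p)

variable {g} {X X' Y Y' Z Z' : ∀ p : M, TangentSpace (𝓡 4) p} {p : M}

theorem curv_swap : g.curv Y X Z p = - g.curv X Y Z p := by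
  have : mlieBracket (𝓡 4) Y X p = - mlieBracket (𝓡 4) X Y p := by
    rw [mlieBracket_swap]; rfl
  simp only [curv, this, map_neg]
  abel

theorem curv_add_left (hX : FieldSmoothAt X p) (hX' : FieldSmoothAt X' p)
    (hZ : FieldSmoothAt Z p) : g.curv (X + X') Y Z p =
      g.curv X Y Z p + g.curv X' Y Z p := by
  have h1 : (fun q => g.leviCivita Z q ((X + X') q)) =
      (fun q => g.leviCivita Z q (X q)) + (fun q => g.leviCivita Z q (X' q)) :=
    funext fun q => map_add _ _ _
  unfold curv
  rw [h1, mlieBracket_add_left hX.diffAt hX'.diffAt, g.leviCivita_add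
      (g.fieldSmoothAt_leviCivita hX hZ).diffAt (g.fieldSmoothAt_leviCivita hX' hZ).diffAt]
  simp only [Pi.add_apply, map_add, _root_.add_apply]
  abel

/-- The term `(Y f) ∇_X Z` produced by `∇_Y (f ∇_X Z)` is cancelled by the one coming from `[fX,
Y]`. -/
theorem curv_smul_left {f : M → ℝ} (hf : ContMDiffAt (𝓡 4) 𝓘(ℝ) ∞ f p) (hX : FieldSmoothAt X p)
    (hZ : FieldSmoothAt Z p) : g.curv (f • X) Y Z p = f p • g.curv X Y Z p := by
  have h1 : (fun q => g.leviCivita Z q ((f • X) q)) =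
      f • (fun q => g.leviCivita Z q (X q)) :=
    funext fun q => (g.leviCivita Z q).map_smul (f q) (X q)
  have hfd := hf.mdifferentiableAt (by simp)
  have hb : mlieBracket (𝓡 4) (f • X) Y p =
      - (mvfderiv (𝓡 4) f p (Y p)) • X p + f p • mlieBracket (𝓡 4) X Y p := by
    rw [mlieBracket_smul_left hfd hX.diffAt]
  unfold curv
  rw [h1, hb, g.leviCivita_smul hfd (g.fieldSmoothAt_leviCivita hX hZ).diffAt]
  simp only [Pi.smul_apply', map_add, map_smul]
  module

theorem curv_add_right (hX : FieldSmoothAt X p)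
    (hY : FieldSmoothAt Y p) (hZ : FieldSmoothAt Z p) (hZ' : FieldSmoothAt Z' p) :
    g.curv X Y (Z + Z') p = g.curv X Y Z p + g.curv X Y Z' p := by
  have h1 {W : ∀ p : M, TangentSpace (𝓡 4) p} (hW : FieldSmoothAt W p) :
      g.leviCivita (fun q => g.leviCivita (Z + Z') q (W q)) p =
        g.leviCivita (fun q => g.leviCivita Z q (W q)) p
          + g.leviCivita (fun q => g.leviCivita Z' q (W q)) p := by
    rw [← g.leviCivita_add (g.fieldSmoothAt_leviCivita hW hZ).diffAt
      (g.fieldSmoothAt_leviCivita hW hZ').diffAt]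
    refine g.leviCivita_congr
      ((g.fieldSmoothAt_leviCivita hW hZ).add (g.fieldSmoothAt_leviCivita hW hZ')).diffAt ?_
    filter_upwards [hZ.eventually_diffAt, hZ'.eventually_diffAt] with q h h'
    rw [g.leviCivita_add h h']
    rfl
  simp only [curv, h1 hX, h1 hY, g.leviCivita_add hZ.diffAt hZ'.diffAt, _root_.add_apply]
  abel

/-- The mixed first-order terms in `f` are symmetric in `X`, `Y` and cancel; the second-order terms
combine to `X(Y f) - Y(X f) - [X, Y] f`, which vanishes by `mvfderiv_mlieBracket`. -/
theorem curv_smul_right {f : M → ℝ} (hf : ContMDiffAt (𝓡 4) 𝓘(ℝ) ∞ f p) (hX : FieldSmoothAt X p)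
    (hY : FieldSmoothAt Y p) (hZ : FieldSmoothAt Z p) :
    g.curv X Y (f • Z) p = f p • g.curv X Y Z p := by
  have hfd := eventually_mdifferentiableAt hf
  have h1 {W : ∀ p : M, TangentSpace (𝓡 4) p} (hW : FieldSmoothAt W p)
      (v : TangentSpace (𝓡 4) p) :
      g.leviCivita (fun q => g.leviCivita (f • Z) q (W q)) p v =
        f p • g.leviCivita (fun q => g.leviCivita Z q (W q)) p v
          + mvfderiv (𝓡 4) f p v • g.leviCivita Z p (W p)
          + (mvfderiv (𝓡 4) f p (W p) • g.leviCivita Z p v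
            + mvfderiv (𝓡 4) (fun q => mvfderiv (𝓡 4) f q (W q)) p v • Z p) := by
    have hs := g.fieldSmoothAt_leviCivita hW hZ
    have hd := hW.dirDeriv hf
    rw [← g.leviCivita_smul hfd.self_of_nhds hs.diffAt,
      ← g.leviCivita_smul (f := fun q => mvfderiv (𝓡 4) f q (W q))
        (hd.mdifferentiableAt (by simp)) hZ.diffAt,
      ← _root_.add_apply, ← g.leviCivita_add (FieldSmoothAt.smul hf hs).diffAt
        (FieldSmoothAt.smul hd hZ).diffAt]
    rw [g.leviCivita_congr ((FieldSmoothAt.smul hf hs).add (FieldSmoothAt.smul hd hZ)).diffAt]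
    filter_upwards [hfd, hZ.eventually_diffAt] with q h h'
    rw [g.leviCivita_smul h h']
    rfl
  simp only [curv, h1 hX, h1 hY, g.leviCivita_smul hfd.self_of_nhds hZ.diffAt,
    mvfderiv_mlieBracket hf hX hY]
  module

theorem curv_congr_left (hX : FieldSmoothAt X p) (hZ : FieldSmoothAt Z p)
    (h : ∀ᶠ q in 𝓝 p, X' q = X q) : g.curv X' Y Z p = g.curv X Y Z p := by
  have h1 : ∀ᶠ q in 𝓝 p, g.leviCivita Z q (X' q) = g.leviCivita Z q (X q) :=
    h.mono fun q hq => by rw [hq]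
  rw [curv, curv, g.leviCivita_congr (g.fieldSmoothAt_leviCivita hX hZ).diffAt h1,
    mlieBracket_congr_left h, h.self_of_nhds]

theorem curv_congr_right (hX : FieldSmoothAt X p) (hY : FieldSmoothAt Y p) (hZ : FieldSmoothAt Z p)
    (h : ∀ᶠ q in 𝓝 p, Z' q = Z q) : g.curv X Y Z' p = g.curv X Y Z p := by
  have h1 (W : ∀ p : M, TangentSpace (𝓡 4) p) :
      ∀ᶠ q in 𝓝 p, g.leviCivita Z' q (W q) = g.leviCivita Z q (W q) := by
    filter_upwards [h.eventually_nhds, hZ.eventually_diffAt] with q hq hd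
    rw [g.leviCivita_congr hd hq]
  rw [curv, curv, g.leviCivita_congr (g.fieldSmoothAt_leviCivita hX hZ).diffAt (h1 X),
    g.leviCivita_congr (g.fieldSmoothAt_leviCivita hY hZ).diffAt (h1 Y),
    g.leviCivita_congr hZ.diffAt h]

theorem curv_eq_of_eq (hX : FieldSmoothAt X p) (hX' : FieldSmoothAt X' p)
    (hY : FieldSmoothAt Y p) (hY' : FieldSmoothAt Y' p) (hZ : FieldSmoothAt Z p)
    (hZ' : FieldSmoothAt Z' p) (h1 : X p = X' p) (h2 : Y p = Y' p) (h3 : Z p = Z' p) :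
    g.curv X Y Z p = g.curv X' Y' Z' p := by
  have left {X X' Y Z : ∀ p : M, TangentSpace (𝓡 4) p} (hX : FieldSmoothAt X p)
      (hX' : FieldSmoothAt X' p) (hY : FieldSmoothAt Y p) (hZ : FieldSmoothAt Z p)
      (h : X p = X' p) : g.curv X Y Z p = g.curv X' Y Z p :=
    eq_of_smooth_tensorial (fun X => g.curv X Y Z p)
      (fun _ _ hA hB => curv_add_left hA hB hZ) (fun _ _ hf hA => curv_smul_left hf hA hZ)
      (fun _ _ hA h => curv_congr_left hA hZ h) hX hX' h
  rw [left hX hX' hY hZ h1, curv_swap, left hY hY' hX' hZ h2, ← curv_swap]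
  exact eq_of_smooth_tensorial (fun Z => g.curv X' Y' Z p)
      (fun _ _ hA hB => curv_add_right hX' hY' hA hB)
      (fun _ _ hf hA => curv_smul_right hf hX' hY' hA)
      (fun _ _ hA h => curv_congr_right hX' hY' hA h) hZ hZ' h3

theorem riemann_eq_curv_extend (x y z : TangentSpace (𝓡 4) p) :
    g.riemann p x y z = g.curv (FiberBundle.extend (EuclideanSpace ℝ (Fin 4)) x)
      (FiberBundle.extend (EuclideanSpace ℝ (Fin 4)) y)
      (FiberBundle.extend (EuclideanSpace ℝ (Fin 4)) z) p := by
  simp only [riemann, curv, FiberBundle.extend_apply_self]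

/-- Frees the curvature from the particular extensions in its definition, so that later computations
may use `l` itself and fields tangent to the horizon. -/
theorem riemann_eq_curv (hX : FieldSmoothAt X p) (hY : FieldSmoothAt Y p)
    (hZ : FieldSmoothAt Z p) : g.riemann p (X p) (Y p) (Z p) = g.curv X Y Z p := by
  rw [riemann_eq_curv_extend]
  exact curv_eq_of_eq (fieldSmoothAt_extend _) hX (fieldSmoothAt_extend _) hY (fieldSmoothAt_extend _) hZ
    (FiberBundle.extend_apply_self _ _) (FiberBundle.extend_apply_self _ _)
    (FiberBundle.extend_apply_self _ _)

/-! ### Algebraic symmetries of the curvature tensor. -/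

section Pointwise

variable {x x' y z w w' : TangentSpace (𝓡 4) p} {c : ℝ}

theorem riemann_add_left : g.riemann p (x + x') y z = g.riemann p x y z + g.riemann p x' y z := by
  have hx := fieldSmoothAt_extend x
  have hx' := fieldSmoothAt_extend x'
  have hy := fieldSmoothAt_extend y
  have hz := fieldSmoothAt_extend z
  have := riemann_eq_curv (g := g) (hx.add hx') hy hz
  rw [curv_add_left hx hx' hz, ← riemann_eq_curv hx hy hz, ← riemann_eq_curv hx' hy hz] at this
  simpa using this

theorem riemann_smul_left : g.riemann p (c • x) y z = c • g.riemann p x y z := by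
  have hx := fieldSmoothAt_extend x
  have hy := fieldSmoothAt_extend y
  have hz := fieldSmoothAt_extend z
  have hc : ContMDiffAt (𝓡 4) 𝓘(ℝ) ∞ (fun _ : M => c) p := contMDiffAt_const
  have := riemann_eq_curv (g := g) (FieldSmoothAt.smul hc hx) hy hz
  rw [curv_smul_left hc hx hz, ← riemann_eq_curv hx hy hz] at this
  simpa using this

theorem riemann_swap : g.riemann p y x z = - g.riemann p x y z := by
  rw [riemann_eq_curv_extend, riemann_eq_curv_extend, curv_swap]

theorem riemann_smul_right : g.riemann p x y (c • z) = c • g.riemann p x y z := by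
  have hx := fieldSmoothAt_extend x
  have hy := fieldSmoothAt_extend y
  have hz := fieldSmoothAt_extend z
  have hc : ContMDiffAt (𝓡 4) 𝓘(ℝ) ∞ (fun _ : M => c) p := contMDiffAt_const
  have := riemann_eq_curv (g := g) hx hy (FieldSmoothAt.smul hc hz)
  rw [curv_smul_right hc hx hy hz, ← riemann_eq_curv hx hy hz] at this
  simpa using this

/-- The first Bianchi identity for vector fields. -/
theorem curv_bianchi (hX : FieldSmoothAt X p) (hY : FieldSmoothAt Y p) (hZ : FieldSmoothAt Z p) :
    g.curv X Y Z p + g.curv Y Z X p + g.curv Z X Y p = 0 := by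
  have : IsManifold (𝓡 4) (minSmoothness ℝ 3) M := by
    rw [minSmoothness_of_isRCLikeNormedField]; infer_instance
  have h2 {W : ∀ p : M, TangentSpace (𝓡 4) p} (hW : FieldSmoothAt W p) :
      ContMDiffAt (𝓡 4) ((𝓡 4).prod 𝓘(ℝ, EuclideanSpace ℝ (Fin 4))) (minSmoothness ℝ 2)
        (fun q => TotalSpace.mk' (EuclideanSpace ℝ (Fin 4)) q (W q)) p :=
    ContMDiffAt.of_le hW (by
      rw [minSmoothness_of_isRCLikeNormedField]; exact WithTop.coe_le_coe.2 le_top)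
  have hJ := leibniz_identity_mlieBracket_apply (h2 hX) (h2 hY) (h2 hZ)
  -- Absence of torsion is used twice: `∇_A (∇_B C - ∇_C B) = ∇_A [B, C] = ∇_[B,C] A + [A, [B, C]]`.
  -- In the cyclic sum the `∇_[B,C] A` terms cancel against those of the curvature and the double
  -- brackets vanish by Jacobi.
  have key {A B C : ∀ p : M, TangentSpace (𝓡 4) p} (hA : FieldSmoothAt A p)
      (hB : FieldSmoothAt B p) (hC : FieldSmoothAt C p) :
      g.leviCivita (fun q => g.leviCivita C q (B q)) p (A p)
        - g.leviCivita (fun q => g.leviCivita B q (C q)) p (A p)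
        = g.leviCivita A p (mlieBracket (𝓡 4) B C p)
          + mlieBracket (𝓡 4) A (mlieBracket (𝓡 4) B C) p := by
    have s1 := g.fieldSmoothAt_leviCivita hB hC
    have s2 := g.fieldSmoothAt_leviCivita hC hB
    have e : g.leviCivita (mlieBracket (𝓡 4) B C) p =
        g.leviCivita (fun q => g.leviCivita C q (B q)) p
          - g.leviCivita (fun q => g.leviCivita B q (C q)) p := by
      have e1 : g.leviCivita (mlieBracket (𝓡 4) B C + fun q => g.leviCivita B q (C q)) p =
          g.leviCivita (fun q => g.leviCivita C q (B q)) p := by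
        refine g.leviCivita_congr s1.diffAt ?_
        filter_upwards [hB.eventually_diffAt, hC.eventually_diffAt] with q h h'
        rw [Pi.add_apply, ← g.leviCivita_torsion h h', sub_add_cancel]
      rw [← e1, g.leviCivita_add (hB.bracket hC).diffAt s2.diffAt, add_sub_cancel_right]
    rw [← g.leviCivita_torsion hA.diffAt (hB.bracket hC).diffAt, e, _root_.sub_apply]
    abel
  have swap (A B : ∀ p : M, TangentSpace (𝓡 4) p) :
      mlieBracket (𝓡 4) A B p = - mlieBracket (𝓡 4) B A p := by
    rw [mlieBracket_swap]; rfl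
  have k1 := key hX hY hZ
  have k2 := key hY hZ hX
  have k3 := key hZ hX hY
  have j2 : mlieBracket (𝓡 4) Y (mlieBracket (𝓡 4) Z X) p =
      - mlieBracket (𝓡 4) Y (mlieBracket (𝓡 4) X Z) p := by
    have := mlieBracket_const_smul_right (I := 𝓡 4) (V := Y) (c := (-1 : ℝ)) (hX.bracket hZ).diffAt
    rw [mlieBracket_swap (V := Z)]
    simpa using this
  rw [swap (mlieBracket (𝓡 4) X Y)] at hJ
  rw [j2] at k2
  simp only [curv]
  linear_combination (norm := module) k1 + k2 + k3 + hJ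

theorem riemann_bianchi : g.riemann p x y z + g.riemann p y z x + g.riemann p z x y = 0 := by
  simp only [riemann_eq_curv_extend]
  exact curv_bianchi (fieldSmoothAt_extend x) (fieldSmoothAt_extend y) (fieldSmoothAt_extend z)

/-- The function `g(Z, Z')` is differentiated twice using compatibility with the metric. In `XY - YX
- [X, Y]`, which annihilates it, the products of first derivatives of `Z` and `Z'` cancel, and the
two curvature terms remain. -/
theorem val_curv_swap (hX : FieldSmoothAt X p) (hY : FieldSmoothAt Y p) (hZ : FieldSmoothAt Z p)
    (hW : FieldSmoothAt Z' p) : g.val p (g.curv X Y Z p) (Z' p) = - g.val p (Z p) (g.curv X Y Z' p) := by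
  have key {A B : ∀ p : M, TangentSpace (𝓡 4) p} (hA : FieldSmoothAt A p)
      (hB : FieldSmoothAt B p) :
      mvfderiv (𝓡 4) (fun q => mvfderiv (𝓡 4) (fun q => g.val q (Z q) (Z' q)) q (B q)) p (A p) =
        g.val p (g.leviCivita (fun q => g.leviCivita Z q (B q)) p (A p)) (Z' p)
        + g.val p (g.leviCivita Z p (B p)) (g.leviCivita Z' p (A p))
        + (g.val p (g.leviCivita Z p (A p)) (g.leviCivita Z' p (B p))
        + g.val p (Z p) (g.leviCivita (fun q => g.leviCivita Z' q (B q)) p (A p))) := by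
    have s1 := g.fieldSmoothAt_leviCivita hB hZ
    have s2 := g.fieldSmoothAt_leviCivita hB hW
    have e : (fun q => mvfderiv (𝓡 4) (fun q => g.val q (Z q) (Z' q)) q (B q)) =ᶠ[𝓝 p]
        fun q => g.val q (g.leviCivita Z q (B q)) (Z' q)
          + g.val q (Z q) (g.leviCivita Z' q (B q)) := by
      filter_upwards [hB.eventually_diffAt, hZ.eventually_diffAt, hW.eventually_diffAt]
        with q h1 h2 h3 using g.leviCivita_metric h1 h2 h3
    rw [mvfderiv_congr e, mvfderiv_fun_add (g.mdifferentiableAt_val s1.diffAt hW.diffAt)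
      (g.mdifferentiableAt_val hZ.diffAt s2.diffAt), _root_.add_apply,
      g.leviCivita_metric hA.diffAt s1.diffAt hW.diffAt,
      g.leviCivita_metric hA.diffAt hZ.diffAt s2.diffAt]
  have h1 := key hX hY
  have h2 := key hY hX
  have h3 := mvfderiv_mlieBracket (g.contMDiffAt_val hZ hW) hX hY
  have h4 := g.leviCivita_metric (hX.bracket hY).diffAt hZ.diffAt hW.diffAt
  simp only [curv, map_sub, _root_.sub_apply]
  linarith

/-- Multilinearity and the symmetries of the curvature tensor. -/
theorem riemannLow_swap_left : g.riemannLow p y x z w = - g.riemannLow p x y z w := by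
  rw [riemannLow, riemann_swap, map_neg]; rfl

theorem riemannLow_swap_right : g.riemannLow p x y w z = - g.riemannLow p x y z w := by
  have := val_curv_swap (g := g) (fieldSmoothAt_extend x) (fieldSmoothAt_extend y)
    (fieldSmoothAt_extend w) (fieldSmoothAt_extend z)
  rw [← riemann_eq_curv (fieldSmoothAt_extend x) (fieldSmoothAt_extend y) (fieldSmoothAt_extend w),
    ← riemann_eq_curv (fieldSmoothAt_extend x) (fieldSmoothAt_extend y)
    (fieldSmoothAt_extend z)] at this
  simp only [FiberBundle.extend_apply_self] at this
  rw [riemannLow, this, g.symm p w]; rfl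

theorem riemannLow_bianchi :
    g.riemannLow p x y z w + g.riemannLow p y z x w + g.riemannLow p z x y w = 0 := by
  have := congrArg (fun v => g.val p v w) (riemann_bianchi (g := g) (x := x) (y := y) (z := z))
  simp only [map_add, _root_.add_apply, map_zero, _root_.zero_apply] at this
  exact this

/-- The octahedron argument: a linear combination of four Bianchi identities in which skew-symmetry
in each pair cancels everything but the two terms compared. -/
theorem riemannLow_pair_swap : g.riemannLow p x y z w = g.riemannLow p z w x y := by
  have b1 := riemannLow_bianchi (g := g) (x := x) (y := y) (z := z) (w := w)
  have b2 := riemannLow_bianchi (g := g) (x := y) (y := z) (z := w) (w := x)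
  have b3 := riemannLow_bianchi (g := g) (x := z) (y := w) (z := x) (w := y)
  have b4 := riemannLow_bianchi (g := g) (x := w) (y := x) (z := y) (w := z)
  have sl (a b c d : TangentSpace (𝓡 4) p) := riemannLow_swap_left (g := g) (x := a) (y := b) (z := c) (w := d)
  have sr (a b c d : TangentSpace (𝓡 4) p) := riemannLow_swap_right (g := g) (x := a) (y := b) (z := c) (w := d)
  linarith [sr x y z w, sr y z x w, sr z x y w, sr y z w x, sr z w y x, sr w y z x, sr z w x y,
    sr w x z y, sr x z w y, sr w x y z, sr x y w z, sr y w x z, sl x y z w, sl x y w z, sl y z x w,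
    sl y z w x, sl z x y w, sl z x w y, sl z w x y, sl z w y x, sl w y z x, sl w y x z, sl w x y z,
    sl w x z y]

theorem riemannLow_add_fourth :
    g.riemannLow p x y z (w + w') = g.riemannLow p x y z w + g.riemannLow p x y z w' := map_add _ _ _

theorem riemannLow_smul_fourth :
    g.riemannLow p x y z (c • w) = c * g.riemannLow p x y z w := map_smul _ _ _

theorem riemannLow_smul_third :
    g.riemannLow p x y (c • z) w = c * g.riemannLow p x y z w := by
  simp only [riemannLow, riemann_smul_right, map_smul, _root_.smul_apply, smul_eq_mul]

theorem riemannLow_add_left :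
    g.riemannLow p (x + x') y z w = g.riemannLow p x y z w + g.riemannLow p x' y z w := by
  simp only [riemannLow, riemann_add_left, map_add, _root_.add_apply]

theorem riemannLow_smul_left :
    g.riemannLow p (c • x) y z w = c * g.riemannLow p x y z w := by
  simp only [riemannLow, riemann_smul_left, map_smul, _root_.smul_apply, smul_eq_mul]

theorem ricci_symm : g.ricci p x y = g.ricci p y x := by
  unfold ricci
  refine Finset.sum_congr rfl fun i _ => ?_
  rw [riemannLow_pair_swap]

end Pointwise

end LorentzMetric
end NullHorizon

namespace NullHorizon

/-! ### Tangential extensions from charts straightening an immersion. -/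

section Immersion

theorem mlieBracket_eq_zero_of_const {V W : ∀ y : EuclideanSpace ℝ (Fin 4), TangentSpace (𝓡 4) y}
    {v w : EuclideanSpace ℝ (Fin 4)} (hV : ∀ y, V y = v) (hW : ∀ y, W y = w)
    (y : EuclideanSpace ℝ (Fin 4)) : mlieBracket (𝓡 4) V W y = 0 := by
  have e : mlieBracket (𝓡 4) V W y =
      fderiv ℝ (F := EuclideanSpace ℝ (Fin 4)) W y (V y)
        - fderiv ℝ (F := EuclideanSpace ℝ (Fin 4)) V y (W y) := by
    rw [← mlieBracketWithin_univ, mlieBracketWithin_eq_lieBracketWithin]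
    exact congrFun lieBracketWithin_univ y
  have h (U : ∀ y : EuclideanSpace ℝ (Fin 4), TangentSpace (𝓡 4) y)
      {u : EuclideanSpace ℝ (Fin 4)} (hU : ∀ y, U y = u) :
      fderiv ℝ (F := EuclideanSpace ℝ (Fin 4)) U y = 0 := by
    obtain rfl : U = fun _ => u := funext hU
    exact (hasFDerivAt_const u y).fderiv
  rw [e, h V hV, h W hW]
  exact sub_self _

variable {M : Type*} [TopologicalSpace M] [ChartedSpace (EuclideanSpace ℝ (Fin 4)) M]
  [IsManifold (𝓡 4) ∞ M]
  {H : Type*} [TopologicalSpace H] [ChartedSpace (EuclideanSpace ℝ (Fin 3)) H]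
  [IsManifold (𝓡 3) ∞ H]

/-- Tangent vectors of an immersed hypersurface extend to commuting smooth vector fields of the
ambient space which are tangent to the hypersurface. -/
theorem exists_tangent_extension {ψ : H → M} {x : H} (h : IsImmersionAt (𝓡 3) (𝓡 4) ∞ ψ x) :
    Function.Injective (mfderiv (𝓡 3) (𝓡 4) ψ x) ∧
    ∃ X : EuclideanSpace ℝ (Fin 3) → ∀ q : M, TangentSpace (𝓡 4) q,
      (∀ w, FieldSmoothAt (X w) (ψ x)) ∧
      (∀ w w', mlieBracket (𝓡 4) (X w) (X w') (ψ x) = 0) ∧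
      (∀ᶠ x' in 𝓝 x, ∀ w, ∃ a : TangentSpace (𝓡 3) x',
        X w (ψ x') = mfderiv (𝓡 3) (𝓡 4) ψ x' a) ∧
      ∀ a : TangentSpace (𝓡 3) x, ∃ w, X w (ψ x) = mfderiv (𝓡 3) (𝓡 4) ψ x a := by
  have hcd := h.contMDiffAt
  obtain ⟨F, _, _, hF⟩ := h
  set φ := hF.domChart
  set χ := hF.codChart
  let L := hF.equiv
  have hxφ : x ∈ φ.source := hF.mem_domChart_source
  have hxχ : ψ x ∈ χ.source := hF.mem_codChart_source
  have hχ := contMDiffOn_of_mem_maximalAtlas hF.codChart_mem_maximalAtlas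
  have hχs := contMDiffOn_symm_of_mem_maximalAtlas hF.codChart_mem_maximalAtlas
  have hφ := contMDiffOn_of_mem_maximalAtlas hF.domChart_mem_maximalAtlas
  have hφs := contMDiffOn_symm_of_mem_maximalAtlas hF.domChart_mem_maximalAtlas
  have mφ : φ.MDifferentiable (𝓡 3) (𝓡 3) :=
    ⟨hφ.mdifferentiableOn (by simp), hφs.mdifferentiableOn (by simp)⟩
  have mχ : χ.MDifferentiable (𝓡 4) (𝓡 4) :=
    ⟨hχ.mdifferentiableOn (by simp), hχs.mdifferentiableOn (by simp)⟩
  -- In these charts `ψ` is the linear inclusion `w ↦ L (w, 0)`, so its derivative is the constant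
  -- injective map `j` defined next.
  have hw : ∀ x' ∈ φ.source, χ (ψ x') = L (φ x', 0) := by
    intro x' hx'
    have hm : φ x' ∈ (hF.domChart.extend (𝓡 3)).target := by
      simpa [φ] using φ.map_source hx'
    have e := hF.writtenInCharts hm
    simp only [OpenPartialHomeomorph.extend_coe, OpenPartialHomeomorph.extend_coe_symm,
      Function.comp_apply, modelWithCornersSelf_coe, modelWithCornersSelf_coe_symm, id_eq] at e
    rwa [φ.left_inv hx'] at e
  let j : EuclideanSpace ℝ (Fin 3) →L[ℝ] EuclideanSpace ℝ (Fin 4) :=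
    (L : _ →L[ℝ] _).comp (ContinuousLinearMap.inl ℝ _ F)
  have hj : Function.Injective j := L.injective.comp (Prod.mk_left_injective 0)
  have hd : ∀ x' ∈ φ.source, MDifferentiableAt (𝓡 3) (𝓡 4) ψ x' →
      ∀ a : TangentSpace (𝓡 3) x', mfderiv (𝓡 4) (𝓡 4) χ (ψ x') (mfderiv (𝓡 3) (𝓡 4) ψ x' a)
        = j (mfderiv (𝓡 3) (𝓡 3) φ x' a) := by
    intro x' hx' hψ a
    have e1 : mfderiv (𝓡 3) (𝓡 4) (χ ∘ ψ) x' = mfderiv (𝓡 3) (𝓡 4) (j ∘ φ) x' :=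
      Filter.EventuallyEq.mfderiv_eq
        (Filter.eventuallyEq_of_mem (φ.open_source.mem_nhds hx') fun y hy => hw y hy)
    rw [mfderiv_comp (I' := 𝓡 4) x' (mχ.mdifferentiableAt (hF.source_subset_preimage_source hx')) hψ,
      mfderiv_comp (I' := 𝓡 3) x' j.mdifferentiableAt (mφ.mdifferentiableAt hx')] at e1
    have e2 := DFunLike.congr_fun e1 a
    rw [ContinuousLinearMap.mfderiv_eq] at e2
    exact e2
  -- Constant fields in the range of `j`, pulled back by the chart of the ambient manifold: tangent
  -- to the image because `ψ` is the inclusion there, and commuting because constant fields commute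
  -- and pull-back respects brackets.
  let X : EuclideanSpace ℝ (Fin 3) → ∀ q : M, TangentSpace (𝓡 4) q := fun w =>
    mpullback (𝓡 4) (𝓡 4) χ (fun _ => j w)
  have hinv : ∀ q ∈ χ.source, (mfderiv (𝓡 4) (𝓡 4) χ q).IsInvertible := fun q hq =>
    ⟨mχ.mfderiv hq, rfl⟩
  have hX : ∀ x' ∈ φ.source, MDifferentiableAt (𝓡 3) (𝓡 4) ψ x' →
      ∀ a : TangentSpace (𝓡 3) x',
        X (mfderiv (𝓡 3) (𝓡 3) φ x' a) (ψ x') = mfderiv (𝓡 3) (𝓡 4) ψ x' a := by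
    intro x' hx' hψ a
    simp only [X]
    erw [← hd x' hx' hψ a]
    exact (hinv _ (hF.source_subset_preimage_source hx')).inverse_apply_eq.2 rfl
  have hψd : ∀ᶠ x' in 𝓝 x, MDifferentiableAt (𝓡 3) (𝓡 4) ψ x' := by
    have h1 : ContMDiffAt (𝓡 3) (𝓡 4) 1 ψ x := hcd.of_le (by simp)
    exact ((contMDiffAt_iff_contMDiffAt_nhds (by simp)).1 h1).mono fun q hq =>
      hq.mdifferentiableAt (by simp)
  have hconst (w : EuclideanSpace ℝ (Fin 3)) (y : EuclideanSpace ℝ (Fin 4)) :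
      ContMDiffAt (𝓡 4) ((𝓡 4).prod (𝓡 4)) ∞
        (fun y => TotalSpace.mk' (EuclideanSpace ℝ (Fin 4))
          (E := (TangentSpace (𝓡 4) : EuclideanSpace ℝ (Fin 4) → Type _)) y (j w)) y :=
    contMDiffAt_vectorSpace_iff_contDiffAt.2 contDiffAt_const
  refine ⟨fun a b hab => ?_, X, fun w => ?_, fun w w' => ?_, ?_, fun a => ?_⟩
  · refine mφ.mfderiv_injective hxφ (hj ?_)
    erw [← hd x hxφ hψd.self_of_nhds a, ← hd x hxφ hψd.self_of_nhds b, hab]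
  · exact ContMDiffAt.mpullback_vectorField_preimage (m := ∞) (n := ∞) (hconst w _)
      (hχ.contMDiffAt (χ.open_source.mem_nhds hxχ)) (hinv _ hxχ) (by simp)
  · have : IsManifold (𝓡 4) (minSmoothness ℝ 2) M := by
      rw [minSmoothness_of_isRCLikeNormedField]; infer_instance
    have : IsManifold (𝓡 4) (minSmoothness ℝ 3) M := by
      rw [minSmoothness_of_isRCLikeNormedField]; infer_instance
    rw [← mpullback_mlieBracket (n := ∞) ((hconst w _).mdifferentiableAt (by simp))
      ((hconst w' _).mdifferentiableAt (by simp))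
      (hχ.contMDiffAt (χ.open_source.mem_nhds hxχ))
      (by rw [minSmoothness_of_isRCLikeNormedField]; exact WithTop.coe_le_coe.2 le_top),
      mpullback_apply]
    erw [mlieBracket_eq_zero_of_const (fun _ => rfl) (fun _ => rfl), map_zero]
  · filter_upwards [hψd, φ.open_source.mem_nhds hxφ] with x' hx' hs w
    obtain ⟨a, ha⟩ := mφ.mfderiv_surjective hs w
    exact ⟨a, by rw [← hX x' hs hx' a, ha]⟩
  · exact ⟨_, hX x hxφ hψd.self_of_nhds a⟩

end Immersion
end NullHorizon

namespace NullHorizon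

/-! ### Lorentzian linear algebra: null tetrads, traces and causal cones. -/

section PointwiseAlgebra

variable {M : Type*} [TopologicalSpace M] [ChartedSpace (EuclideanSpace ℝ (Fin 4)) M]
  [IsManifold (𝓡 4) ∞ M] {g : LorentzMetric M} {p : M}

theorem LorentzMetric.eq_zero_of_linearIndependent {e : Fin 4 → TangentSpace (𝓡 4) p}
    (he : LinearIndependent ℝ e) {w : TangentSpace (𝓡 4) p} (h : ∀ i, g.val p w (e i) = 0) :
    w = 0 := by
  have hfr : Module.finrank ℝ (TangentSpace (𝓡 4) p) = 4 :=
    (by simp : Module.finrank ℝ (EuclideanSpace ℝ (Fin 4)) = 4)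
  have hspan : Submodule.span ℝ (Set.range e) = ⊤ :=
    he.span_eq_top_of_card_eq_finrank (by simp [hfr])
  refine g.ext_val fun u => ?_
  have hmem : u ∈ Submodule.span ℝ (Set.range e) := by rw [hspan]; trivial
  obtain ⟨c, rfl⟩ := (Submodule.mem_span_range_iff_exists_fun ℝ).1 hmem
  simp [map_sum, h]

/-- A null tetrad at a point, with the two spacelike vectors real. -/
structure IsNullTetradAt (g : LorentzMetric M) (p : M) (l n e₁ e₂ : TangentSpace (𝓡 4) p) :
    Prop where
  l_l : g.val p l l = 0
  n_n : g.val p n n = 0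
  l_n : g.val p l n = 1
  l_e₁ : g.val p l e₁ = 0
  l_e₂ : g.val p l e₂ = 0
  n_e₁ : g.val p n e₁ = 0
  n_e₂ : g.val p n e₂ = 0
  e₁_e₁ : g.val p e₁ e₁ = -1
  e₂_e₂ : g.val p e₂ e₂ = -1
  e₁_e₂ : g.val p e₁ e₂ = 0

theorem IsNullTetradAt.expand {l n e₁ e₂ : TangentSpace (𝓡 4) p}
    (h : IsNullTetradAt g p l n e₁ e₂) (v : TangentSpace (𝓡 4) p) :
    v = g.val p v n • l + g.val p v l • n - g.val p v e₁ • e₁ - g.val p v e₂ • e₂ := by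
  have s (a b : TangentSpace (𝓡 4) p) := g.symm p a b
  have hli : LinearIndependent ℝ ![l, n, e₁, e₂] := by
    rw [Fintype.linearIndependent_iff]
    intro c hc
    rw [Fin.sum_univ_four] at hc
    simp only [Matrix.cons_val] at hc
    have t (w : TangentSpace (𝓡 4) p) := congrArg (fun v => g.val p v w) hc
    have tl := t l
    have tn := t n
    have t1 := t e₁
    have t2 := t e₂
    simp only [map_add, map_smul, _root_.add_apply, _root_.smul_apply, smul_eq_mul, map_zero,
      _root_.zero_apply, h.l_l, h.n_n, h.l_n, h.l_e₁, h.l_e₂, h.n_e₁, h.n_e₂, h.e₁_e₁, h.e₂_e₂,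
      h.e₁_e₂, s n l, s e₁ l, s e₂ l, s e₁ n, s e₂ n, s e₂ e₁] at tl tn t1 t2
    intro i
    fin_cases i <;> simp <;> linarith
  refine sub_eq_zero.1 (LorentzMetric.eq_zero_of_linearIndependent (g := g) hli fun i => ?_)
  fin_cases i <;> simp [h.l_l, h.n_n, h.l_n, h.l_e₁, h.l_e₂, h.n_e₁, h.n_e₂, h.e₁_e₁, h.e₂_e₂,
      h.e₁_e₂, s n l, s e₁ l, s e₂ l, s e₁ n, s e₂ n, s e₂ e₁]

namespace LorentzMetric

theorem frame_spec (g : LorentzMetric M) (p : M) (i j : Fin 4) :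
    g.val p (g.frame p i) (g.frame p j) = if i = j then eta i else 0 :=
  Classical.choose_spec (g.signature p) i j

theorem linearIndependent_frame (g : LorentzMetric M) (p : M) :
    LinearIndependent ℝ (g.frame p) := by
  rw [Fintype.linearIndependent_iff]
  intro c hc j
  have h : g.val p (∑ i, c i • g.frame p i) (g.frame p j) = 0 := by rw [hc]; simp
  simp only [map_sum, map_smul, _root_.sum_apply, _root_.smul_apply, frame_spec, smul_eq_mul,
    mul_ite, mul_zero, Finset.sum_ite_eq', Finset.mem_univ, if_true, eta] at h
  split_ifs at h <;> linarith

theorem frame_expand (g : LorentzMetric M) (p : M) (v : TangentSpace (𝓡 4) p) :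
    v = ∑ i, (eta i * g.val p (g.frame p i) v) • g.frame p i := by
  refine sub_eq_zero.1 (eq_zero_of_linearIndependent (g := g) (g.linearIndependent_frame p)
    fun j => ?_)
  simp only [map_sub, map_sum, map_smul, _root_.sub_apply, _root_.sum_apply, _root_.smul_apply,
    frame_spec, smul_eq_mul, mul_ite, mul_zero, Finset.sum_ite_eq', Finset.mem_univ, if_true]
  rw [g.symm p v]
  by_cases hj : j = 0 <;> simp [eta, hj]

/-- The trace of a bilinear form, computed in a null tetrad. -/
theorem sum_frame_eq {l n e₁ e₂ : TangentSpace (𝓡 4) p} (h : IsNullTetradAt g p l n e₁ e₂)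
    (Q : TangentSpace (𝓡 4) p →ₗ[ℝ] TangentSpace (𝓡 4) p →ₗ[ℝ] ℝ) :
    ∑ i, eta i * Q (g.frame p i) (g.frame p i) = Q l n + Q n l - Q e₁ e₁ - Q e₂ e₂ := by
  have hQ (v w : TangentSpace (𝓡 4) p) :
      ∑ i, eta i * g.val p (g.frame p i) v * Q (g.frame p i) w = Q v w := by
    conv_rhs => rw [g.frame_expand p v]
    simp [map_sum]
  -- Only the second slot is expanded in the null tetrad; the sum over the orthonormal frame then
  -- collapses in the first slot by `hQ`.
  have e : ∀ i, eta i * Q (g.frame p i) (g.frame p i) =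
      eta i * g.val p (g.frame p i) n * Q (g.frame p i) l
        + eta i * g.val p (g.frame p i) l * Q (g.frame p i) n
        - eta i * g.val p (g.frame p i) e₁ * Q (g.frame p i) e₁
        - eta i * g.val p (g.frame p i) e₂ * Q (g.frame p i) e₂ := by
    intro i
    have := congrArg (Q (g.frame p i)) (h.expand (g.frame p i))
    simp only [map_add, map_sub, map_smul, smul_eq_mul] at this
    rw [this]; ring
  rw [Finset.sum_congr rfl fun i _ => e i]
  simp only [Finset.sum_add_distrib, Finset.sum_sub_distrib, hQ]
  ring

/-- In the trace of `R(l, ·, l, ·)` over a null tetrad the two cross terms of `l` and `n` vanish by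
skew-symmetry in each pair, so only the spacelike directions contribute. -/
theorem ricci_null {l n e₁ e₂ : TangentSpace (𝓡 4) p} (h : IsNullTetradAt g p l n e₁ e₂) :
    g.ricci p l l = - g.riemannLow p l e₁ l e₁ - g.riemannLow p l e₂ l e₂ := by
  let Q : TangentSpace (𝓡 4) p →ₗ[ℝ] TangentSpace (𝓡 4) p →ₗ[ℝ] ℝ :=
    LinearMap.mk₂ ℝ (fun u v => g.riemannLow p l u l v)
      (fun u u' v => by
        rw [riemannLow_swap_left, riemannLow_add_left, riemannLow_swap_left (x := l),
          riemannLow_swap_left (x := l)]; ring)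
      (fun c u v => by
        rw [riemannLow_swap_left, riemannLow_smul_left, riemannLow_swap_left (x := l),
          smul_eq_mul]; ring)
      (fun u v v' => riemannLow_add_fourth) (fun c u v => riemannLow_smul_fourth)
  have hQ : g.ricci p l l = ∑ i, eta i * Q (g.frame p i) (g.frame p i) := rfl
  have h1 : g.riemannLow p l l l n = 0 := by
    linarith [riemannLow_swap_left (g := g) (x := l) (y := l) (z := l) (w := n)]
  have h2 : g.riemannLow p l n l l = 0 := by
    linarith [riemannLow_swap_right (g := g) (x := l) (y := n) (z := l) (w := l)]
  rw [hQ, sum_frame_eq h Q]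
  simp only [Q, LinearMap.mk₂_apply, h1, h2]
  ring

/-- A null vector can be completed to a null tetrad. -/
theorem exists_nullTetrad {l : TangentSpace (𝓡 4) p} (hl : l ≠ 0) (hll : g.val p l l = 0) :
    ∃ n e₁ e₂, IsNullTetradAt g p l n e₁ e₂ := by
  set f := g.frame p with hf
  have hfs (i j : Fin 4) : g.val p (f i) (f j) = if i = j then eta i else 0 := g.frame_spec p i j
  -- The spatial part of the orthonormal frame is identified with Euclidean space, where `g` becomes
  -- minus the inner product and orthonormal bases can be completed.
  let T : EuclideanSpace ℝ (Fin 3) →ₗ[ℝ] TangentSpace (𝓡 4) p :=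
    { toFun := fun x => x 0 • f 1 + x 1 • f 2 + x 2 • f 3
      map_add' := fun x y => by simp only [PiLp.add_apply]; module
      map_smul' := fun c x => by simp only [PiLp.smul_apply, smul_eq_mul, RingHom.id_apply]; module }
  have hTT (x y : EuclideanSpace ℝ (Fin 3)) : g.val p (T x) (T y) = - inner ℝ x y := by
    simp [T, hfs, eta, PiLp.inner_apply, Fin.sum_univ_three]
    ring
  have h0T (x : EuclideanSpace ℝ (Fin 3)) : g.val p (f 0) (T x) = 0 := by simp [T, hfs]
  have hT0 (x : EuclideanSpace ℝ (Fin 3)) : g.val p (T x) (f 0) = 0 := by rw [g.symm, h0T]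
  have h00 : g.val p (f 0) (f 0) = 1 := by simp [hfs, eta]
  obtain ⟨a, b, hab⟩ : ∃ (a : ℝ) (b : EuclideanSpace ℝ (Fin 3)), l = a • f 0 + T b := by
    refine ⟨g.val p (f 0) l, !₂[-g.val p (f 1) l, -g.val p (f 2) l, -g.val p (f 3) l], ?_⟩
    conv_lhs => rw [g.frame_expand p l]
    simp [Fin.sum_univ_four, T, eta, ← hf]
    module
  have hnorm : a ^ 2 = inner ℝ b b := by
    rw [hab] at hll
    simp only [map_add, map_smul, _root_.add_apply, _root_.smul_apply, smul_eq_mul, h00, h0T, hT0,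
      hTT] at hll
    nlinarith
  have ha : a ≠ 0 := by
    rintro rfl
    have : b = 0 := by
      rw [← inner_self_eq_zero (𝕜 := ℝ), ← hnorm]; simp
    exact hl (by rw [hab, this]; simp)
  -- Nullity makes `u` a unit vector and `l = a (f₀ + T u)`. The opposite null direction is `f₀ - T
  -- u`; since `g(f₀ + T u, f₀ - T u) = 2`, the normalization `g(l, n) = 1` forces the factor
  -- `(2a)⁻¹`.
  let u : EuclideanSpace ℝ (Fin 3) := a⁻¹ • b
  have hu : inner ℝ u u = 1 := by
    simp only [u, inner_smul_left, inner_smul_right, ← hnorm]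
    simp; field_simp
  have hlu : l = a • (f 0 + T u) := by
    rw [hab]; simp only [u, map_smul, smul_add, smul_smul, mul_inv_cancel₀ ha, one_smul]
  have hon : Orthonormal ℝ (({0} : Set (Fin 3)).domRestrict fun _ => u) := by
    refine ⟨fun i => ?_, fun i j hij => ?_⟩
    · have h1 : ‖u‖ ^ 2 = 1 := by rw [← real_inner_self_eq_norm_sq, hu]
      change ‖u‖ = 1
      nlinarith [norm_nonneg u]
    · exact absurd (Subsingleton.elim i j) hij
  obtain ⟨B, hB⟩ := hon.exists_orthonormalBasis_extension_of_card_eq (by simp)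
  have hB0 : B 0 = u := hB 0 rfl
  have hBB (i j : Fin 3) : inner ℝ (B i) (B j) = if i = j then (1 : ℝ) else 0 :=
    orthonormal_iff_ite.1 B.orthonormal i j
  refine ⟨(2 * a)⁻¹ • (f 0 - T u), T (B 1), T (B 2), ?_⟩
  rw [hlu, ← hB0]
  constructor <;>
  simp only [map_add, map_sub, map_smul, _root_.add_apply, _root_.sub_apply, _root_.smul_apply,
      smul_eq_mul, h00, h0T, hT0, hTT, hBB] <;> simp
  field_simp; norm_num

end LorentzMetric

/-- A vector orthogonal to a timelike one is not timelike. -/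
theorem LorentzMetric.val_self_nonpos_of_val_eq_zero {τ u : TangentSpace (𝓡 4) p}
    (hτ : 0 < g.val p τ τ) (hu : g.val p τ u = 0) : g.val p u u ≤ 0 := by
  have co (a b : TangentSpace (𝓡 4) p) : g.val p a b =
      g.val p (g.frame p 0) a * g.val p (g.frame p 0) b
      - g.val p (g.frame p 1) a * g.val p (g.frame p 1) b
      - g.val p (g.frame p 2) a * g.val p (g.frame p 2) b
      - g.val p (g.frame p 3) a * g.val p (g.frame p 3) b := by
    conv_lhs => rw [g.frame_expand p a]
    simp [Fin.sum_univ_four, LorentzMetric.eta]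
    ring
  rw [co τ τ] at hτ
  rw [co τ u] at hu
  rw [co u u]
  generalize g.val p (g.frame p 0) τ = a0 at *
  generalize g.val p (g.frame p 1) τ = a1 at *
  generalize g.val p (g.frame p 2) τ = a2 at *
  generalize g.val p (g.frame p 3) τ = a3 at *
  generalize g.val p (g.frame p 0) u = b0 at *
  generalize g.val p (g.frame p 1) u = b1 at *
  generalize g.val p (g.frame p 2) u = b2 at *
  generalize g.val p (g.frame p 3) u = b3 at *
  -- Orthogonality equates `a0 * b0` with the Euclidean product of the spatial parts, so this is the
  -- Cauchy–Schwarz inequality, via Lagrange's identity.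
  have h1 : (a0 * b0) ^ 2 ≤ (a1 ^ 2 + a2 ^ 2 + a3 ^ 2) * (b1 ^ 2 + b2 ^ 2 + b3 ^ 2) := by
    have : a0 * b0 = a1 * b1 + a2 * b2 + a3 * b3 := by linarith
    rw [this]
    nlinarith [sq_nonneg (a1 * b2 - a2 * b1), sq_nonneg (a1 * b3 - a3 * b1),
      sq_nonneg (a2 * b3 - a3 * b2)]
  have h2 : 0 ≤ b1 ^ 2 + b2 ^ 2 + b3 ^ 2 := by positivity
  have h3 : 0 < a0 ^ 2 := by nlinarith [sq_nonneg a1, sq_nonneg a2, sq_nonneg a3]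
  have h4 : a0 ^ 2 * b0 ^ 2 ≤ a0 ^ 2 * (b1 ^ 2 + b2 ^ 2 + b3 ^ 2) := by nlinarith
  have := le_of_mul_le_mul_left h4 h3
  linarith

/-- The inner product of two vectors in the closed future light cone is nonnegative. -/
theorem TimeOrientation.FutureCausal.val_nonneg {t : TimeOrientation g}
    {v w : TangentSpace (𝓡 4) p} (hv : t.FutureCausal p v) (hw : t.FutureCausal p w) :
    0 ≤ g.val p v w := by
  obtain ⟨hv1, hv2⟩ := hv
  obtain ⟨hw1, hw2⟩ := hw
  have hτ := t.timelike p
  have neg (u : TangentSpace (𝓡 4) p) (hu : g.val p (t.val p) u = 0) : g.val p u u ≤ 0 :=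
    LorentzMetric.val_self_nonpos_of_val_eq_zero hτ hu
  -- The vector is `g(τ, τ)` times the component of `s v - r w` orthogonal to the time orientation
  -- `τ`. That it is not timelike makes a quadratic form in `(s, r)` nonnegative, and its
  -- discriminant is then nonpositive.
  have key (s r : ℝ) := neg ((s * g.val p (t.val p) (t.val p)) • v
    - (r * g.val p (t.val p) (t.val p)) • w
    - (s * g.val p (t.val p) v - r * g.val p (t.val p) w) • t.val p) (by
      simp only [map_sub, map_smul, smul_eq_mul]; ring)
  simp only [map_sub, map_smul, _root_.sub_apply, _root_.smul_apply, smul_eq_mul,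
    g.symm p v (t.val p), g.symm p w (t.val p), g.symm p w v] at key
  generalize g.val p (t.val p) v = α at *
  generalize g.val p (t.val p) w = β at *
  generalize g.val p (t.val p) (t.val p) = N at *
  generalize g.val p v v = P at *
  generalize g.val p w w = Q at *
  generalize g.val p v w = c at *
  have key' (s r : ℝ) : 0 ≤ (α ^ 2 - N * P) * s ^ 2
      + (-2 * (α * β - N * c)) * s * r + (β ^ 2 - N * Q) * r ^ 2 := by
    have h' : N * -((α ^ 2 - N * P) * s ^ 2
      + (-2 * (α * β - N * c)) * s * r + (β ^ 2 - N * Q) * r ^ 2) ≤ N * 0 := by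
      linarith [key s r]
    linarith [le_of_mul_le_mul_left h' hτ]
  have hd := discrim_le_zero (a := α ^ 2 - N * P) (b := -2 * (α * β - N * c))
    (c := β ^ 2 - N * Q) fun s => by linarith [key' s 1]
  rw [discrim] at hd
  have e3 : 0 ≤ α ^ 2 - N * P := by linarith [key' 1 0]
  -- The discriminant bounds the left side by `(α² - N P)(β² - N Q)`, which is at most `α² β²`
  -- because `v` and `w` are causal. As `α β ≥ 0`, this forces `N c ≥ 0`.
  have h5 : (α * β - N * c) ^ 2 ≤ (α * β) ^ 2 := by
    have e1 := mul_nonneg e3 (mul_nonneg hτ.le hw1)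
    have e2 := mul_nonneg (sq_nonneg β) (mul_nonneg hτ.le hv1)
    linarith
  have h6 := abs_le_of_sq_le_sq h5 (mul_nonneg hv2 hw2)
  have h7 : 0 ≤ N * c := by linarith [(le_abs_self _).trans h6]
  exact nonneg_of_mul_nonneg_right h7 hτ

/-! ### Normals of a null hypersurface. -/

section Normal

variable {H : Type*} [TopologicalSpace H] [ChartedSpace (EuclideanSpace ℝ (Fin 3)) H]

/-- The tangent space of an immersed hypersurface is the orthogonal complement of a normal. -/
theorem IsNormalAt.exists_mfderiv_eq {ψ : H → M} {x : H} {N : TangentSpace (𝓡 4) (ψ x)}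
    (hN : IsNormalAt g ψ x N) (hN0 : N ≠ 0)
    (hinj : Function.Injective (mfderiv (𝓡 3) (𝓡 4) ψ x)) {v : TangentSpace (𝓡 4) (ψ x)}
    (hv : g.val (ψ x) N v = 0) : ∃ a, mfderiv (𝓡 3) (𝓡 4) ψ x a = v := by
  have : FiniteDimensional ℝ (TangentSpace (𝓡 4) (ψ x)) :=
    inferInstanceAs (FiniteDimensional ℝ (EuclideanSpace ℝ (Fin 4)))
  have h4 : Module.finrank ℝ (TangentSpace (𝓡 4) (ψ x)) = 4 :=
    (by simp : Module.finrank ℝ (EuclideanSpace ℝ (Fin 4)) = 4)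
  have h3 : Module.finrank ℝ (TangentSpace (𝓡 3) x) = 3 :=
    (by simp : Module.finrank ℝ (EuclideanSpace ℝ (Fin 3)) = 3)
  let D : TangentSpace (𝓡 3) x →ₗ[ℝ] TangentSpace (𝓡 4) (ψ x) :=
    (mfderiv (𝓡 3) (𝓡 4) ψ x).toLinearMap
  let φ : TangentSpace (𝓡 4) (ψ x) →ₗ[ℝ] ℝ := (g.val (ψ x) N).toLinearMap
  have hle : LinearMap.range D ≤ LinearMap.ker φ := by
    rintro _ ⟨a, rfl⟩
    exact hN a
  have hφ : φ ≠ 0 := fun h0 => hN0 (g.ext_val fun w => by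
    rw [map_zero]; exact DFunLike.congr_fun h0 w)
  have hr : Module.finrank ℝ (LinearMap.range D) = 3 := by
    rw [LinearMap.finrank_range_of_inj hinj, h3]
  have hk : Module.finrank ℝ (LinearMap.ker φ) = 3 := by
    have := φ.finrank_range_add_finrank_ker
    rw [LinearMap.range_eq_top.2 (LinearMap.surjective hφ), finrank_top, Module.finrank_self,
      h4] at this
    omega
  have := Submodule.eq_of_le_of_finrank_eq hle (by rw [hr, hk])
  have hm : v ∈ LinearMap.range D := by rw [this]; exact hv
  exact hm

/-- Normals of a null hypersurface are null. -/
theorem IsNormalAt.null {ψ : H → M} {x : H}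
    (hnull : ∃ N : TangentSpace (𝓡 4) (ψ x), N ≠ 0 ∧ IsNormalAt g ψ x N ∧ g.val (ψ x) N N = 0)
    (hinj : Function.Injective (mfderiv (𝓡 3) (𝓡 4) ψ x)) {l : TangentSpace (𝓡 4) (ψ x)}
    (hl : IsNormalAt g ψ x l) : g.val (ψ x) l l = 0 := by
  obtain ⟨N, hN0, hN, hNN⟩ := hnull
  -- A null normal `N` is orthogonal to itself and therefore tangent. So `l` is orthogonal to `N`,
  -- which makes `l` tangent too, hence orthogonal to itself.
  obtain ⟨a, ha⟩ := hN.exists_mfderiv_eq hN0 hinj hNN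
  have h1 : g.val (ψ x) N l = 0 := by rw [g.symm, ← ha]; exact hl a
  obtain ⟨b, hb⟩ := hN.exists_mfderiv_eq hN0 hinj h1
  conv_lhs => rw [← hb]
  rw [g.symm]
  have := hl b
  rwa [hb] at this ⊢

end Normal

end PointwiseAlgebra
end NullHorizon

namespace NullHorizon

/-! ### The second fundamental form of the horizon. -/

section HorizonGeometry

variable {M : Type*} [TopologicalSpace M] [ChartedSpace (EuclideanSpace ℝ (Fin 4)) M]
  [IsManifold (𝓡 4) ∞ M] {g : LorentzMetric M} {t : TimeOrientation g}
  {T : ∀ p : M, TangentSpace (𝓡 4) p →L[ℝ] TangentSpace (𝓡 4) p →L[ℝ] ℝ}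
  {H : Type*} [TopologicalSpace H] [ChartedSpace (EuclideanSpace ℝ (Fin 3)) H]
  [IsManifold (𝓡 3) ∞ H] {ψ : H → M} {l : ∀ p : M, TangentSpace (𝓡 4) p}

/-- The derivative along the hypersurface of a function constant on it vanishes. -/
theorem mvfderiv_mfderiv_eq_zero {f : M → ℝ} {x : H} {c : ℝ}
    (hf : MDifferentiableAt (𝓡 4) 𝓘(ℝ) f (ψ x)) (hψ : MDifferentiableAt (𝓡 3) (𝓡 4) ψ x)
    (h : ∀ᶠ x' in 𝓝 x, f (ψ x') = c) (a : TangentSpace (𝓡 3) x) :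
    mvfderiv (𝓡 4) f (ψ x) (mfderiv (𝓡 3) (𝓡 4) ψ x a) = 0 := by
  have e := mfderiv_comp x hf hψ
  have e2 : mfderiv (𝓡 3) 𝓘(ℝ) (f ∘ ψ) x = mfderiv (𝓡 3) 𝓘(ℝ) (fun _ => c) x :=
    Filter.EventuallyEq.mfderiv_eq h
  rw [e2, mfderiv_const] at e
  exact (DFunLike.congr_fun e a).symm

namespace IsNonExpandingHorizon

theorem mdiffAt (hH : IsNonExpandingHorizon g t T ψ) (x : H) :
    MDifferentiableAt (𝓡 3) (𝓡 4) ψ x :=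
  hH.embedding.isImmersion.contMDiff.mdifferentiable (by simp) x

theorem injective_mfderiv (hH : IsNonExpandingHorizon g t T ψ) (x : H) :
    Function.Injective (mfderiv (𝓡 3) (𝓡 4) ψ x) :=
  (exists_tangent_extension (hH.embedding.isImmersion.isImmersionAt x)).1

theorem val_l_l (hH : IsNonExpandingHorizon g t T ψ) (hl : IsNullNormal g ψ l) (x : H) :
    g.val (ψ x) (l (ψ x)) (l (ψ x)) = 0 :=
  (hl.normal x).null (hH.null x) (hH.injective_mfderiv x)

theorem exists_mfderiv_eq (hH : IsNonExpandingHorizon g t T ψ) (hl : IsNullNormal g ψ l) {x : H}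
    {v : TangentSpace (𝓡 4) (ψ x)} (hv : g.val (ψ x) (l (ψ x)) v = 0) :
    ∃ a, mfderiv (𝓡 3) (𝓡 4) ψ x a = v :=
  (hl.normal x).exists_mfderiv_eq (hl.ne_zero x) (hH.injective_mfderiv x) hv

theorem exists_mfderiv_eq_l (hH : IsNonExpandingHorizon g t T ψ) (hl : IsNullNormal g ψ l)
    (x : H) : ∃ a, mfderiv (𝓡 3) (𝓡 4) ψ x a = l (ψ x) :=
  hH.exists_mfderiv_eq hl (hH.val_l_l hl x)

/-- A vector orthogonal to the horizon is proportional to the null normal. -/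
theorem eq_smul_of_orthogonal (hH : IsNonExpandingHorizon g t T ψ) (hl : IsNullNormal g ψ l)
    {x : H} {v : TangentSpace (𝓡 4) (ψ x)}
    (hv : ∀ a, g.val (ψ x) v (mfderiv (𝓡 3) (𝓡 4) ψ x a) = 0) : ∃ c : ℝ, v = c • l (ψ x) := by
  obtain ⟨n, e₁, e₂, ht⟩ := LorentzMetric.exists_nullTetrad (hl.ne_zero x) (hH.val_l_l hl x)
  have hv' (w : TangentSpace (𝓡 4) (ψ x)) (hw : g.val (ψ x) (l (ψ x)) w = 0) :
      g.val (ψ x) v w = 0 := by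
    obtain ⟨a, rfl⟩ := hH.exists_mfderiv_eq hl hw
    exact hv a
  refine ⟨g.val (ψ x) v n, ?_⟩
  have := ht.expand v
  rw [hv' _ ht.l_l, hv' _ ht.l_e₁, hv' _ ht.l_e₂] at this
  conv_lhs => rw [this]
  module

theorem val_leviCivita_l_l (hH : IsNonExpandingHorizon g t T ψ) (hl : IsNullNormal g ψ l) (x : H)
    (a : TangentSpace (𝓡 3) x) :
    g.val (ψ x) (g.leviCivita l (ψ x) (mfderiv (𝓡 3) (𝓡 4) ψ x a)) (l (ψ x)) = 0 := by
  have hs := (hl.smooth x).diffAt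
  have h := mvfderiv_mfderiv_eq_zero (g.mdifferentiableAt_val hs hs) (hH.mdiffAt x)
    (Filter.Eventually.of_forall fun x' => hH.val_l_l hl x') a
  have hX := (fieldSmoothAt_extend (mfderiv (𝓡 3) (𝓡 4) ψ x a)).diffAt
  have e := g.leviCivita_metric hX hs hs
  rw [FiberBundle.extend_apply_self, h, g.symm (ψ x) (l (ψ x))] at e
  linarith

/-- For `X` tangent to the horizon and `Y` tangential near `x`,
`g(∇_X l, Y) = - g(l, ∇_X Y)`. -/
theorem val_leviCivita_l (hH : IsNonExpandingHorizon g t T ψ) (hl : IsNullNormal g ψ l) {x : H}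
    {Y : ∀ p : M, TangentSpace (𝓡 4) p} (hY : FieldDiffAt Y (ψ x))
    (hYt : ∀ᶠ x' in 𝓝 x, ∃ a, Y (ψ x') = mfderiv (𝓡 3) (𝓡 4) ψ x' a)
    (a : TangentSpace (𝓡 3) x) :
    g.val (ψ x) (g.leviCivita l (ψ x) (mfderiv (𝓡 3) (𝓡 4) ψ x a)) (Y (ψ x)) =
      - g.val (ψ x) (l (ψ x)) (g.leviCivita Y (ψ x) (mfderiv (𝓡 3) (𝓡 4) ψ x a)) := by
  have hs := (hl.smooth x).diffAt
  have h := mvfderiv_mfderiv_eq_zero (g.mdifferentiableAt_val hs hY) (hH.mdiffAt x)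
    (hYt.mono fun x' ⟨b, hb⟩ => by rw [hb]; exact hl.normal x' b) a
  have hX := (fieldSmoothAt_extend (mfderiv (𝓡 3) (𝓡 4) ψ x a)).diffAt
  have e := g.leviCivita_metric hX hs hY
  rw [FiberBundle.extend_apply_self, h] at e
  linarith

/-- Symmetry of the second fundamental form: by `val_leviCivita_l` the two sides differ by `g(l, [X,
Y])` up to sign, and the tangential extensions can be taken to commute at the point. -/
theorem val_leviCivita_comm (hH : IsNonExpandingHorizon g t T ψ) (hl : IsNullNormal g ψ l)
    (x : H) (a b : TangentSpace (𝓡 3) x) :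
    g.val (ψ x) (g.leviCivita l (ψ x) (mfderiv (𝓡 3) (𝓡 4) ψ x a)) (mfderiv (𝓡 3) (𝓡 4) ψ x b) =
    g.val (ψ x) (g.leviCivita l (ψ x) (mfderiv (𝓡 3) (𝓡 4) ψ x b))
      (mfderiv (𝓡 3) (𝓡 4) ψ x a) := by
  obtain ⟨-, X, hX, hXX, hXt, hXs⟩ :=
    exists_tangent_extension (hH.embedding.isImmersion.isImmersionAt x)
  obtain ⟨w, hw⟩ := hXs a
  obtain ⟨w', hw'⟩ := hXs b
  have e1 := hH.val_leviCivita_l hl (hX w').diffAt (hXt.mono fun x' h => h w') a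
  have e2 := hH.val_leviCivita_l hl (hX w).diffAt (hXt.mono fun x' h => h w) b
  rw [hw'] at e1
  rw [hw] at e2
  have tor := g.leviCivita_torsion (hX w).diffAt (hX w').diffAt
  rw [hw, hw'] at tor
  have tor' := congrArg (g.val (ψ x) (l (ψ x))) (tor.trans (hXX w w'))
  rw [map_sub, map_zero] at tor'
  rw [e1, e2]
  linarith

/-- The null generators are geodesics up to parametrization: since `l` is tangent, symmetry gives
`g(∇_l l, X) = g(∇_X l, l)`, which is half the derivative of `g(l, l) = 0` along `X`. -/
theorem exists_leviCivita_l_l (hH : IsNonExpandingHorizon g t T ψ) (hl : IsNullNormal g ψ l)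
    (x : H) : ∃ κ : ℝ, g.leviCivita l (ψ x) (l (ψ x)) = κ • l (ψ x) := by
  obtain ⟨b, hb⟩ := hH.exists_mfderiv_eq_l hl x
  refine hH.eq_smul_of_orthogonal hl fun a => ?_
  have := hH.val_leviCivita_comm hl x b a
  rw [hb] at this
  rw [this, hH.val_leviCivita_l_l hl x a]

/-- The component `R(l, X, l, X)` of the curvature on a horizon. -/
theorem riemannLow_l_l (hH : IsNonExpandingHorizon g t T ψ) (hl : IsNullNormal g ψ l) {x : H}
    {κ : ℝ} (hκ : g.leviCivita l (ψ x) (l (ψ x)) = κ • l (ψ x))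
    {X : ∀ p : M, TangentSpace (𝓡 4) p} (hX : FieldSmoothAt X (ψ x))
    (hXt : ∀ᶠ x' in 𝓝 x, ∃ a, X (ψ x') = mfderiv (𝓡 3) (𝓡 4) ψ x' a) :
    g.val (ψ x) (l (ψ x)) (g.leviCivita X (ψ x) (l (ψ x))) = 0 ∧
    g.riemannLow (ψ x) (l (ψ x)) (X (ψ x)) (l (ψ x)) (X (ψ x)) =
      mvfderiv (𝓡 4) (fun q => g.val q (g.leviCivita l q (X q)) (X q)) (ψ x) (l (ψ x))
      - 2 * g.val (ψ x) (g.leviCivita l (ψ x) (g.leviCivita X (ψ x) (l (ψ x)))) (X (ψ x))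
      + g.val (ψ x) (g.leviCivita l (ψ x) (g.leviCivita l (ψ x) (X (ψ x)))) (X (ψ x))
      - κ * g.val (ψ x) (g.leviCivita l (ψ x) (X (ψ x))) (X (ψ x)) := by
  have hs := hl.smooth x
  obtain ⟨a, ha⟩ := hXt.self_of_nhds
  obtain ⟨b, hb⟩ := hH.exists_mfderiv_eq_l hl x
  have h0 : g.val (ψ x) (l (ψ x)) (g.leviCivita X (ψ x) (l (ψ x))) = 0 := by
    have e := hH.val_leviCivita_l hl hX.diffAt hXt b
    rw [hb, hκ, map_smul, _root_.smul_apply, ha, hl.normal x a, smul_zero] at e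
    linarith
  refine ⟨h0, ?_⟩
  have hlX := g.fieldSmoothAt_leviCivita hX hs
  have hll := g.fieldSmoothAt_leviCivita hs hs
  have m1 := g.leviCivita_metric hs.diffAt hlX.diffAt hX.diffAt
  have m2 := g.leviCivita_metric hX.diffAt hll.diffAt hX.diffAt
  -- Since `∇_l l` is proportional to `l` at every point of the horizon, `g(∇_l l, X)` vanishes
  -- along it. Hence `g(∇_X ∇_l l, X) = - κ g(l, ∇_X X) = κ g(∇_X l, X)`.
  have z := mvfderiv_mfderiv_eq_zero (c := 0) (g.mdifferentiableAt_val hll.diffAt hX.diffAt)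
    (hH.mdiffAt x) (hXt.mono fun x' ⟨b, hb⟩ => by
      obtain ⟨k, hk⟩ := hH.exists_leviCivita_l_l hl x'
      rw [hk, hb, map_smul, _root_.smul_apply, hl.normal x' b, smul_zero]) a
  rw [← ha] at z
  have v := hH.val_leviCivita_l hl hX.diffAt hXt a
  rw [← ha] at v
  rw [z, hκ, map_smul, _root_.smul_apply, smul_eq_mul] at m2
  have tor := g.leviCivita_torsion hs.diffAt hX.diffAt
  obtain ⟨c, hc⟩ := hH.exists_mfderiv_eq hl h0
  -- Here `∇_l X` is tangent by `h0`, so symmetry turns `g(∇_X l, ∇_l X)` into `g(∇_{∇_l X} l, X)`.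
  -- The same term arises from `[l, X] = ∇_l X - ∇_X l`, which explains the factor 2.
  have comm := hH.val_leviCivita_comm hl x a c
  rw [hc, ← ha] at comm
  rw [LorentzMetric.riemannLow, LorentzMetric.riemann_eq_curv hs hX hs, LorentzMetric.curv, ← tor]
  simp only [map_sub, _root_.sub_apply]
  rw [comm] at m1
  linear_combination -m1 + m2 + κ * v

/-- The vanishing of the expansion in a basis which need not be orthonormal. -/
theorem expansion_gram (hH : IsNonExpandingHorizon g t T ψ) (hl : IsNullNormal g ψ l) {x : H}
    {u v : TangentSpace (𝓡 4) (ψ x)} (hu : ∃ a, u = mfderiv (𝓡 3) (𝓡 4) ψ x a)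
    (hv : ∃ a, v = mfderiv (𝓡 3) (𝓡 4) ψ x a) (huu : g.val (ψ x) u u < 0)
    (huv : 0 < g.val (ψ x) u u * g.val (ψ x) v v - g.val (ψ x) u v ^ 2) :
    g.val (ψ x) v v * g.val (ψ x) (g.leviCivita l (ψ x) u) u
      + g.val (ψ x) u u * g.val (ψ x) (g.leviCivita l (ψ x) v) v
      - 2 * g.val (ψ x) u v * g.val (ψ x) (g.leviCivita l (ψ x) u) v = 0 := by
  obtain ⟨a, rfl⟩ := hu
  obtain ⟨b, rfl⟩ := hv
  set D := mfderiv (𝓡 3) (𝓡 4) ψ x with hD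
  have comm := hH.val_leviCivita_comm hl x a b
  rw [← hD] at comm
  set P := g.val (ψ x) (D a) (D a) with hP
  set Q := g.val (ψ x) (D b) (D b) with hQ
  set c := g.val (ψ x) (D a) (D b) with hc
  have hc' : g.val (ψ x) (D b) (D a) = c := g.symm _ _ _
  have hΔ : 0 < -P / (P * Q - c ^ 2) := div_pos (by linarith) huv
  have hi : 0 < -(1 / P) := by rw [neg_pos]; exact one_div_neg.2 huu
  obtain ⟨s, hs⟩ : ∃ s : ℝ, s ^ 2 = -(1 / P) := ⟨_, Real.sq_sqrt hi.le⟩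
  obtain ⟨r, hr⟩ : ∃ r : ℝ, r ^ 2 = -P / (P * Q - c ^ 2) := ⟨_, Real.sq_sqrt hΔ.le⟩
  have hP0 : P ≠ 0 := huu.ne
  have hΔ0 : P * Q - c ^ 2 ≠ 0 := huv.ne'
  -- Gram–Schmidt: `s` and `r` normalize `a` and the part of `b` orthogonal to `a` to square `-1`.
  have key := hH.expansion_eq_zero l hl x (s • a) (r • (b - (c / P) • a)) ?_ ?_ ?_
  · simp only [expansion, ← hD, map_sub, map_smul, _root_.sub_apply, _root_.smul_apply,
      smul_eq_mul, ← comm] at key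
    set A := g.val (ψ x) (g.leviCivita l (ψ x) (D a)) (D a)
    set B := g.val (ψ x) (g.leviCivita l (ψ x) (D b)) (D b)
    set C := g.val (ψ x) (g.leviCivita l (ψ x) (D a)) (D b)
    have key' : s ^ 2 * A + r ^ 2 * (B - 2 * (c / P) * C + (c / P) ^ 2 * A) = 0 := by
      linear_combination -key
    rw [hs, hr] at key'
    field_simp at key'
    have : P * (Q * A + P * B - 2 * c * C) = 0 := by linear_combination -key'
    exact (mul_eq_zero.1 this).resolve_left hP0
  all_goals
    simp only [← hD, map_sub, map_smul, _root_.sub_apply, _root_.smul_apply, smul_eq_mul, ← hP,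
      ← hQ, ← hc, hc']
  · have : s * (s * P) = s ^ 2 * P := by ring
    rw [this, hs]; field_simp
  · have e : r ^ 2 * (Q - c ^ 2 / P) = -1 := by rw [hr]; field_simp
    field_simp at e ⊢
    linear_combination e
  · field_simp; ring

end IsNonExpandingHorizon
end HorizonGeometry
end NullHorizon

namespace NullHorizon

/-! ### Raychaudhuri's equation and vanishing of the shear. -/

section Raychaudhuri

variable {M : Type*} [TopologicalSpace M] [ChartedSpace (EuclideanSpace ℝ (Fin 4)) M]
  [IsManifold (𝓡 4) ∞ M] {g : LorentzMetric M} {t : TimeOrientation g}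
  {T : ∀ p : M, TangentSpace (𝓡 4) p →L[ℝ] TangentSpace (𝓡 4) p →L[ℝ] ℝ}
  {H : Type*} [TopologicalSpace H] [ChartedSpace (EuclideanSpace ℝ (Fin 3)) H]
  [IsManifold (𝓡 3) ∞ H] {ψ : H → M} {l : ∀ p : M, TangentSpace (𝓡 4) p}

/-- The derivative of `Q A + P B - 2 c C`. -/
theorem mvfderiv_gram_combination {P Q c A B C : M → ℝ} {p : M}
    (hP : MDifferentiableAt (𝓡 4) 𝓘(ℝ) P p) (hQ : MDifferentiableAt (𝓡 4) 𝓘(ℝ) Q p)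
    (hc : MDifferentiableAt (𝓡 4) 𝓘(ℝ) c p) (hA : MDifferentiableAt (𝓡 4) 𝓘(ℝ) A p)
    (hB : MDifferentiableAt (𝓡 4) 𝓘(ℝ) B p) (hC : MDifferentiableAt (𝓡 4) 𝓘(ℝ) C p)
    (v : TangentSpace (𝓡 4) p) :
    MDifferentiableAt (𝓡 4) 𝓘(ℝ) (fun q => Q q * A q + P q * B q - 2 * c q * C q) p ∧
    mvfderiv (𝓡 4) (fun q => Q q * A q + P q * B q - 2 * c q * C q) p v =
      Q p * mvfderiv (𝓡 4) A p v + A p * mvfderiv (𝓡 4) Q p v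
      + (P p * mvfderiv (𝓡 4) B p v + B p * mvfderiv (𝓡 4) P p v)
      - 2 * (c p * mvfderiv (𝓡 4) C p v + C p * mvfderiv (𝓡 4) c p v) := by
  have h2 : MDifferentiableAt (𝓡 4) 𝓘(ℝ) (fun q => 2 * c q) p := mdifferentiableAt_const.mul hc
  have hQA : MDifferentiableAt (𝓡 4) 𝓘(ℝ) (fun q => Q q * A q) p := hQ.mul hA
  have hPB : MDifferentiableAt (𝓡 4) 𝓘(ℝ) (fun q => P q * B q) p := hP.mul hB
  have hcC : MDifferentiableAt (𝓡 4) 𝓘(ℝ) (fun q => 2 * c q * C q) p := h2.mul hC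
  have hs : MDifferentiableAt (𝓡 4) 𝓘(ℝ) (fun q => Q q * A q + P q * B q) p := hQA.add hPB
  refine ⟨hs.sub hcC, ?_⟩
  rw [mvfderiv_fun_sub hs hcC, mvfderiv_fun_add hQA hPB, mvfderiv_fun_mul hQ hA, mvfderiv_fun_mul hP hB,
    mvfderiv_fun_mul h2 hC, mvfderiv_fun_mul mdifferentiableAt_const hc]
  simp [mvfderiv_const]
  ring

namespace IsNonExpandingHorizon

set_option maxHeartbeats 1000000 in
/-- The Raychaudhuri equation on a horizon: `Ric(l, l)` is the square of the shear. -/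
theorem ricci_l_l (hH : IsNonExpandingHorizon g t T ψ) (hl : IsNullNormal g ψ l) {x : H}
    {n e₁ e₂ : TangentSpace (𝓡 4) (ψ x)} (ht : IsNullTetradAt g (ψ x) (l (ψ x)) n e₁ e₂) :
    g.ricci (ψ x) (l (ψ x)) (l (ψ x)) = g.val (ψ x) (g.leviCivita l (ψ x) e₁) e₁ ^ 2
      + 2 * g.val (ψ x) (g.leviCivita l (ψ x) e₁) e₂ ^ 2
      + g.val (ψ x) (g.leviCivita l (ψ x) e₂) e₂ ^ 2 := by
  obtain ⟨-, X, hX, -, hXt, hXs⟩ :=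
    exists_tangent_extension (hH.embedding.isImmersion.isImmersionAt x)
  obtain ⟨a₁, ha₁⟩ := hH.exists_mfderiv_eq hl ht.l_e₁
  obtain ⟨a₂, ha₂⟩ := hH.exists_mfderiv_eq hl ht.l_e₂
  obtain ⟨b, hb⟩ := hH.exists_mfderiv_eq_l hl x
  obtain ⟨w₁, hw₁⟩ := hXs a₁
  obtain ⟨w₂, hw₂⟩ := hXs a₂
  obtain ⟨κ, hκ⟩ := hH.exists_leviCivita_l_l hl x
  have ht₁ := hXt.mono fun x' h => h w₁
  have ht₂ := hXt.mono fun x' h => h w₂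
  have hE₁ := hX w₁
  have hE₂ := hX w₂
  generalize X w₁ = E₁ at *
  generalize X w₂ = E₂ at *
  rw [ha₁] at hw₁
  rw [ha₂] at hw₂
  have hs := hl.smooth x
  obtain ⟨o₁, r₁⟩ := hH.riemannLow_l_l hl hκ hE₁ ht₁
  obtain ⟨o₂, r₂⟩ := hH.riemannLow_l_l hl hκ hE₂ ht₂
  have G {Y Z : ∀ p : M, TangentSpace (𝓡 4) p} (hY : FieldSmoothAt Y (ψ x))
    (hZ : FieldSmoothAt Z (ψ x)) := g.contMDiffAt_val hY hZ
  have hL₁ := g.fieldSmoothAt_leviCivita hE₁ hs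
  have hL₂ := g.fieldSmoothAt_leviCivita hE₂ hs
  have hψc : ContinuousAt ψ x := hH.embedding.isImmersion.contMDiff.continuous.continuousAt
  have hneg : ∀ᶠ x' in 𝓝 x, g.val (ψ x') (E₁ (ψ x')) (E₁ (ψ x')) < 0 :=
    hψc.eventually ((G hE₁ hE₁).continuousAt.eventually_lt continuousAt_const (by
      rw [hw₁, ht.e₁_e₁]; norm_num))
  have hpos : ∀ᶠ x' in 𝓝 x, 0 < g.val (ψ x') (E₁ (ψ x')) (E₁ (ψ x'))
      * g.val (ψ x') (E₂ (ψ x')) (E₂ (ψ x')) - g.val (ψ x') (E₁ (ψ x')) (E₂ (ψ x')) ^ 2 :=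
    hψc.eventually (continuousAt_const.eventually_lt
      (((G hE₁ hE₁).continuousAt.mul (G hE₂ hE₂).continuousAt).sub
        ((G hE₁ hE₂).continuousAt.pow 2)) (by
      change 0 < g.val (ψ x) (E₁ (ψ x)) (E₁ (ψ x)) * g.val (ψ x) (E₂ (ψ x)) (E₂ (ψ x))
        - g.val (ψ x) (E₁ (ψ x)) (E₂ (ψ x)) ^ 2
      rw [hw₁, hw₂, ht.e₁_e₁, ht.e₂_e₂, ht.e₁_e₂]; norm_num))
  -- The fields `E₁`, `E₂` are tangential but orthonormal only at `x`. The Gram form of the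
  -- zero-expansion condition holds at all nearby horizon points and so can be differentiated along
  -- `l`.
  have hF : ∀ᶠ x' in 𝓝 x, g.val (ψ x') (E₂ (ψ x')) (E₂ (ψ x'))
        * g.val (ψ x') (g.leviCivita l (ψ x') (E₁ (ψ x'))) (E₁ (ψ x'))
      + g.val (ψ x') (E₁ (ψ x')) (E₁ (ψ x'))
        * g.val (ψ x') (g.leviCivita l (ψ x') (E₂ (ψ x'))) (E₂ (ψ x'))
      - 2 * g.val (ψ x') (E₁ (ψ x')) (E₂ (ψ x'))
        * g.val (ψ x') (g.leviCivita l (ψ x') (E₁ (ψ x'))) (E₂ (ψ x')) = 0 := by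
    filter_upwards [hneg, hpos, ht₁, ht₂] with x' h1 h2 h3 h4
    exact hH.expansion_gram hl h3 h4 h1 h2
  have F0 := hF.self_of_nhds
  have md {f : M → ℝ} (hf : ContMDiffAt (𝓡 4) 𝓘(ℝ) ∞ f (ψ x)) := hf.mdifferentiableAt (by simp)
  obtain ⟨dF, dF'⟩ := mvfderiv_gram_combination (md (G hE₁ hE₁)) (md (G hE₂ hE₂))
    (md (G hE₁ hE₂)) (md (G hL₁ hE₁)) (md (G hL₂ hE₂)) (md (G hL₁ hE₂)) (l (ψ x))
  have z := mvfderiv_mfderiv_eq_zero dF (hH.mdiffAt x) hF b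
  rw [hb, dF'] at z
  rw [g.leviCivita_metric hs.diffAt hE₁.diffAt hE₁.diffAt,
    g.leviCivita_metric hs.diffAt hE₂.diffAt hE₂.diffAt,
    g.leviCivita_metric hs.diffAt hE₁.diffAt hE₂.diffAt] at z
  have comm := hH.val_leviCivita_comm hl x a₁ a₂
  rw [ha₁, ha₂] at comm
  have bl (e : TangentSpace (𝓡 4) (ψ x)) (he : g.val (ψ x) (l (ψ x)) e = 0) :
      g.val (ψ x) (g.leviCivita l (ψ x) (l (ψ x))) e = 0 := by
    rw [hκ, map_smul, _root_.smul_apply, he, smul_zero]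
  have ex (v : TangentSpace (𝓡 4) (ψ x)) (hv : g.val (ψ x) (l (ψ x)) v = 0) :
      v = g.val (ψ x) v n • l (ψ x) - g.val (ψ x) v e₁ • e₁ - g.val (ψ x) v e₂ • e₂ := by
    have := ht.expand v
    rwa [g.symm (ψ x) v (l (ψ x)), hv, zero_smul, add_zero] at this
  -- The component of `v` along `l` does not contribute because `∇_l l` is a multiple of `l`; thus
  -- `g(∇_v l, e)` is determined by the values on `e₁` and `e₂`.
  have exB (v e : TangentSpace (𝓡 4) (ψ x)) (hv : g.val (ψ x) (l (ψ x)) v = 0)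
      (he : g.val (ψ x) (l (ψ x)) e = 0) :
      g.val (ψ x) (g.leviCivita l (ψ x) v) e =
        - g.val (ψ x) v e₁ * g.val (ψ x) (g.leviCivita l (ψ x) e₁) e
        - g.val (ψ x) v e₂ * g.val (ψ x) (g.leviCivita l (ψ x) e₂) e := by
    conv_lhs => rw [ex v hv]
    simp only [map_sub, map_smul, _root_.sub_apply, _root_.smul_apply, smul_eq_mul, bl e he]
    ring
  have p₁ : g.val (ψ x) (l (ψ x)) (g.leviCivita l (ψ x) e₁) = 0 := by
    rw [g.symm, ← ha₁]; exact hH.val_leviCivita_l_l hl x a₁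
  have p₂ : g.val (ψ x) (l (ψ x)) (g.leviCivita l (ψ x) e₂) = 0 := by
    rw [g.symm, ← ha₂]; exact hH.val_leviCivita_l_l hl x a₂
  rw [hw₁] at r₁
  rw [hw₂] at r₂
  rw [exB _ _ o₁ ht.l_e₁, exB _ _ p₁ ht.l_e₁] at r₁
  rw [exB _ _ o₂ ht.l_e₂, exB _ _ p₂ ht.l_e₂] at r₂
  rw [hw₁, hw₂, ht.e₁_e₁, ht.e₂_e₂, ht.e₁_e₂] at z F0
  rw [g.symm (ψ x) e₁ (g.leviCivita E₁ (ψ x) (l (ψ x))),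
    g.symm (ψ x) e₂ (g.leviCivita E₂ (ψ x) (l (ψ x))),
    g.symm (ψ x) e₁ (g.leviCivita E₂ (ψ x) (l (ψ x)))] at z
  rw [LorentzMetric.ricci_null ht, r₁, r₂]
  rw [← comm] at *
  generalize g.val (ψ x) (g.leviCivita l (ψ x) e₁) e₁ = B₁ at *
  generalize g.val (ψ x) (g.leviCivita l (ψ x) e₁) e₂ = B₁₂ at *
  generalize g.val (ψ x) (g.leviCivita l (ψ x) e₂) e₂ = B₂ at *
  -- Zero expansion at `x` itself. It removes the `κ` terms, and it makes the derivatives of the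
  -- Gram entries in `z` match the `∇_l E_i` terms of the two curvature components.
  have hB : B₂ = -B₁ := by linarith
  subst hB
  linear_combination z

/-- Two signs collide: `Ric(l, l)` is a sum of squares by Raychaudhuri's equation and equals `- 8 π
T(l, l)` by Einstein's equations, where `T(l, l)` is an inner product of two vectors in the future
cone and hence nonnegative. -/
theorem leviCivita_l_tangent_eq_zero (hH : IsNonExpandingHorizon g t T ψ)
    (hl : IsNullNormal g ψ l) {x : H} {n e₁ e₂ : TangentSpace (𝓡 4) (ψ x)}
    (ht : IsNullTetradAt g (ψ x) (l (ψ x)) n e₁ e₂) :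
    g.val (ψ x) (g.leviCivita l (ψ x) e₁) e₁ = 0 ∧ g.val (ψ x) (g.leviCivita l (ψ x) e₁) e₂ = 0 ∧
      g.val (ψ x) (g.leviCivita l (ψ x) e₂) e₂ = 0 := by
  have key : g.ricci (ψ x) (l (ψ x)) (l (ψ x)) ≤ 0 := by
    have hll := hH.val_l_l hl x
    have aux (N : TangentSpace (𝓡 4) (ψ x)) (hN0 : N ≠ 0) (hN : IsNormalAt g ψ x N)
        (hNN : g.val (ψ x) N N = 0) (hf : 0 ≤ g.val (ψ x) (t.val (ψ x)) N) :
        0 ≤ T (ψ x) N N := by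
      have hfc : t.FutureCausal (ψ x) N := ⟨hNN.ge, hf⟩
      obtain ⟨w, hw⟩ := (g.flatEquiv (ψ x)).surjective (T (ψ x) N)
      rw [g.flatEquiv_apply] at hw
      have hw' (u : TangentSpace (𝓡 4) (ψ x)) : g.val (ψ x) w u = T (ψ x) N u :=
        DFunLike.congr_fun hw u
      rw [← hw']
      exact (hH.energy x N w hN0 hN hfc hw').val_nonneg hfc
    have hT : 0 ≤ T (ψ x) (l (ψ x)) (l (ψ x)) := by
      -- No time direction is prescribed for `l`; if `l` is past pointing, the energy condition is
      -- applied to `-l`, and `T(l, l)` is even in `l`.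
      rcases le_total 0 (g.val (ψ x) (t.val (ψ x)) (l (ψ x))) with h | h
      · exact aux _ (hl.ne_zero x) (hl.normal x) hll h
      · have := aux (-l (ψ x)) (neg_ne_zero.2 (hl.ne_zero x))
          (fun a => by rw [map_neg, _root_.neg_apply, hl.normal x a, neg_zero])
          (by simp [hll]) (by rw [map_neg]; linarith)
        simpa using this
    have e := hH.einstein x (l (ψ x)) (l (ψ x))
    rw [hll, mul_zero, sub_zero] at e
    rw [e]
    have := mul_nonneg (mul_nonneg (by norm_num : (0 : ℝ) ≤ 8) Real.pi_pos.le) hT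
    linarith
  rw [hH.ricci_l_l hl ht] at key
  refine ⟨?_, ?_, ?_⟩ <;> nlinarith [sq_nonneg (g.val (ψ x) (g.leviCivita l (ψ x) e₁) e₁),
    sq_nonneg (g.val (ψ x) (g.leviCivita l (ψ x) e₁) e₂),
    sq_nonneg (g.val (ψ x) (g.leviCivita l (ψ x) e₂) e₂)]

/-- On a horizon, `∇_X l` is proportional to `l` for tangent `X`. -/
theorem exists_leviCivita_eq_smul (hH : IsNonExpandingHorizon g t T ψ)
    (hl : IsNullNormal g ψ l) (x : H) (a : TangentSpace (𝓡 3) x) :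
    ∃ c : ℝ, g.leviCivita l (ψ x) (mfderiv (𝓡 3) (𝓡 4) ψ x a) = c • l (ψ x) := by
  obtain ⟨n, e₁, e₂, ht⟩ := LorentzMetric.exists_nullTetrad (hl.ne_zero x) (hH.val_l_l hl x)
  obtain ⟨z₁, z₁₂, z₂⟩ := hH.leviCivita_l_tangent_eq_zero hl ht
  obtain ⟨a₁, ha₁⟩ := hH.exists_mfderiv_eq hl ht.l_e₁
  obtain ⟨a₂, ha₂⟩ := hH.exists_mfderiv_eq hl ht.l_e₂
  have z₂₁ := hH.val_leviCivita_comm hl x a₁ a₂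
  rw [ha₁, ha₂, z₁₂] at z₂₁
  obtain ⟨κ, hκ⟩ := hH.exists_leviCivita_l_l hl x
  -- The tangent space is spanned by `l`, `e₁`, `e₂`, and the second fundamental form vanishes on
  -- all pairs of these.
  refine hH.eq_smul_of_orthogonal hl fun b => ?_
  have ex (c : TangentSpace (𝓡 3) x) := ht.expand (mfderiv (𝓡 3) (𝓡 4) ψ x c)
  have hn (c : TangentSpace (𝓡 3) x) :
      g.val (ψ x) (mfderiv (𝓡 3) (𝓡 4) ψ x c) (l (ψ x)) = 0 := by
    rw [g.symm]; exact hl.normal x c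
  have ll (c : TangentSpace (𝓡 3) x) := hH.val_leviCivita_l_l hl x c
  have l₁ := ll a₁
  have l₂ := ll a₂
  rw [ha₁] at l₁
  rw [ha₂] at l₂
  rw [ex a, ex b, hn, hn]
  simp only [map_add, map_sub, map_smul, _root_.add_apply, _root_.sub_apply, _root_.smul_apply,
    smul_eq_mul, hκ, z₁, z₁₂, z₂, ← z₂₁, l₁, l₂, ht.l_l, ht.l_e₁, ht.l_e₂]
  simp

end IsNonExpandingHorizon
end Raychaudhuri
end NullHorizon

namespace NullHorizon

/-! ### One-forms in coordinates and naturality of the exterior derivative. -/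

section Forms

variable {j k : ℕ} {N : Type*} [TopologicalSpace N]
    [ChartedSpace (EuclideanSpace ℝ (Fin k)) N] [IsManifold (𝓡 k) ∞ N]
    {N' : Type*} [TopologicalSpace N']
    [ChartedSpace (EuclideanSpace ℝ (Fin j)) N'] [IsManifold (𝓡 j) ∞ N']

/-- Smoothness of a 1-form at a point. -/
abbrev SmoothOneFormAt (α : ∀ x : N, TangentSpace (𝓡 k) x →L[ℝ] ℝ) (x : N) : Prop :=
  ContMDiffAt (𝓡 k) ((𝓡 k).prod 𝓘(ℝ, EuclideanSpace ℝ (Fin k) →L[ℝ] ℝ)) ∞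
    (fun x => TotalSpace.mk' (EuclideanSpace ℝ (Fin k) →L[ℝ] ℝ) x (α x)) x

/-- The coordinate expression of a 1-form in the preferred chart at `x`. -/
noncomputable def coordForm (α : ∀ x : N, TangentSpace (𝓡 k) x →L[ℝ] ℝ) (x : N)
    (y : EuclideanSpace ℝ (Fin k)) : EuclideanSpace ℝ (Fin k) →L[ℝ] ℝ :=
  (α ((extChartAt (𝓡 k) x).symm y)).comp
    (mfderiv 𝓘(ℝ, EuclideanSpace ℝ (Fin k)) (𝓡 k) (extChartAt (𝓡 k) x).symm y)

/-- The trivialization of the cotangent bundle over the preferred chart sends the form to its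
coordinate expression, which reduces smoothness of a section to ordinary smoothness on Euclidean
space. -/
theorem smoothOneFormAt_iff {α : ∀ x : N, TangentSpace (𝓡 k) x →L[ℝ] ℝ} {x : N} :
    SmoothOneFormAt α x ↔ ContDiffAt ℝ ∞ (coordForm α x) (extChartAt (𝓡 k) x x) := by
  have h1 : SmoothOneFormAt α x ↔ ContMDiffAt (𝓡 k) 𝓘(ℝ, EuclideanSpace ℝ (Fin k) →L[ℝ] ℝ) ∞
      (fun x' => coordForm α x (extChartAt (𝓡 k) x x')) x := by
    unfold SmoothOneFormAt
    rw [contMDiffAt_totalSpace]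
    refine (and_iff_right contMDiffAt_id).trans ?_
    refine Filter.EventuallyEq.contMDiffAt_iff (I := 𝓡 k)
      (I' := 𝓘(ℝ, EuclideanSpace ℝ (Fin k) →L[ℝ] ℝ)) ?_
    filter_upwards [extChartAt_source_mem_nhds (I := 𝓡 k) x] with x' hx'
    rw [hom_trivializationAt_apply]
    simp only [ContinuousLinearMap.inCoordinates]
    have hx'' : x' ∈ (chartAt (EuclideanSpace ℝ (Fin k)) x).source := by simpa using hx'
    erw [TangentBundle.symmL_trivializationAt (I := 𝓡 k) hx'']
    ext v
    -- The form sits in the fibre over `z = φ⁻¹(φ(x'))`, equal but not identical to `x'`; all fibres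
    -- are the same model space, so substituting the equality moves between them.
    have aux (D : EuclideanSpace ℝ (Fin k) →L[ℝ] EuclideanSpace ℝ (Fin k)) (z : N) (hz : z = x') :
        (show EuclideanSpace ℝ (Fin k) →L[ℝ] ℝ from α x') (D v)
          = (show EuclideanSpace ℝ (Fin k) →L[ℝ] ℝ from α z) (D v) := by
      subst hz; rfl
    simp [coordForm]
    exact aux _ _ ((chartAt (EuclideanSpace ℝ (Fin k)) x).left_inv hx'')
  rw [h1, ← contMDiffAt_iff_contDiffAt]
  constructor
  · intro h
    have h2 : ContMDiffAt (𝓡 k) (𝓡 k) ∞ (extChartAt (𝓡 k) x).symm (extChartAt (𝓡 k) x x) :=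
      (contMDiffOn_extChartAt_symm x).contMDiffAt (extChartAt_target_mem_nhds x)
    have h3 := ContMDiffAt.comp_of_eq h h2 (extChartAt_to_inv x)
    refine h3.congr_of_eventuallyEq ?_
    filter_upwards [extChartAt_target_mem_nhds (I := 𝓡 k) x] with y hy
    simp only [Function.comp_apply, (extChartAt (𝓡 k) x).right_inv hy]
  · intro h
    exact ContMDiffAt.comp x h contMDiffAt_extChartAt

theorem coordForm_congr {α α' : ∀ x : N, TangentSpace (𝓡 k) x →L[ℝ] ℝ} {x : N}
    (h : ∀ᶠ x' in 𝓝 x, α x' = α' x') :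
    coordForm α x =ᶠ[𝓝 (extChartAt (𝓡 k) x x)] coordForm α' x := by
  have hc : ContinuousAt (extChartAt (𝓡 k) x).symm (extChartAt (𝓡 k) x x) :=
    continuousAt_extChartAt_symm x
  have h' : ∀ᶠ x' in 𝓝 ((extChartAt (𝓡 k) x).symm (extChartAt (𝓡 k) x x)), α x' = α' x' := by
    rwa [extChartAt_to_inv]
  filter_upwards [hc.eventually h'] with y hy
  rw [coordForm, coordForm, hy]

theorem SmoothOneFormAt.congr {α α' : ∀ x : N, TangentSpace (𝓡 k) x →L[ℝ] ℝ} {x : N}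
    (hα : SmoothOneFormAt α x) (h : ∀ᶠ x' in 𝓝 x, α' x' = α x') : SmoothOneFormAt α' x :=
  smoothOneFormAt_iff.2 ((smoothOneFormAt_iff.1 hα).congr_of_eventuallyEq (coordForm_congr h))

theorem extDerivOneForm_congr {α α' : ∀ x : N, TangentSpace (𝓡 k) x →L[ℝ] ℝ} {x : N}
    (h : ∀ᶠ x' in 𝓝 x, α x' = α' x') (u v : TangentSpace (𝓡 k) x) :
    extDerivOneForm α x u v = extDerivOneForm α' x u v := by
  have := (coordForm_congr h).fun_comp (ContinuousAlternatingMap.ofSubsingleton ℝ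
    (EuclideanSpace ℝ (Fin k)) ℝ (0 : Fin 1))
  exact DFunLike.congr_fun this.extDeriv_eq _

theorem mfderiv_extChartAt_symm_comp {x x' : N} (hx : x' ∈ (extChartAt (𝓡 k) x).source)
    (v : TangentSpace (𝓡 k) x') :
    mfderiv 𝓘(ℝ, EuclideanSpace ℝ (Fin k)) (𝓡 k) (extChartAt (𝓡 k) x).symm
      (extChartAt (𝓡 k) x x') (mfderiv (𝓡 k) 𝓘(ℝ, EuclideanSpace ℝ (Fin k)) (extChartAt (𝓡 k) x) x' v)
      = v := by
  have := mfderivWithin_extChartAt_symm_comp_mfderiv_extChartAt' (I := 𝓡 k) hx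
  simp only [modelWithCornersSelf_coe, Set.range_id, mfderivWithin_univ] at this
  exact DFunLike.congr_fun this v

theorem coordForm_apply {α : ∀ x : N, TangentSpace (𝓡 k) x →L[ℝ] ℝ} {x x' : N}
    (hx : x' ∈ (extChartAt (𝓡 k) x).source) (v : TangentSpace (𝓡 k) x') :
    coordForm α x (extChartAt (𝓡 k) x x')
      (mfderiv (𝓡 k) 𝓘(ℝ, EuclideanSpace ℝ (Fin k)) (extChartAt (𝓡 k) x) x' v) = α x' v := by
  have aux (z : N) (hz : z = x') (w : EuclideanSpace ℝ (Fin k)) (hw : w = v) :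
      (show EuclideanSpace ℝ (Fin k) →L[ℝ] ℝ from α z) w = α x' v := by
    subst hz; subst hw; rfl
  exact aux _ ((extChartAt (𝓡 k) x).left_inv hx) _ (mfderiv_extChartAt_symm_comp hx v)

variable (j k) in
/-- The expression of a map in the preferred charts. -/
noncomputable def coordMap (F : N' → N) (s : N') :
    EuclideanSpace ℝ (Fin j) → EuclideanSpace ℝ (Fin k) :=
  extChartAt (𝓡 k) (F s) ∘ F ∘ (extChartAt (𝓡 j) s).symm

/-- The chain rule in charts. It expresses the manifold pull-back as a pull-back between Euclidean
spaces, where smoothness and naturality of the exterior derivative are available. -/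
theorem coordForm_pullback {F : N' → N} {s : N'} (hF : ContMDiffAt (𝓡 j) (𝓡 k) ∞ F s)
    (α : ∀ x : N, TangentSpace (𝓡 k) x →L[ℝ] ℝ) :
    coordForm (k := j) (pullbackForm (j := j) F α) s =ᶠ[𝓝 (extChartAt (𝓡 j) s s)]
      fun y => (coordForm α (F s) (coordMap j k F s y)).comp (fderiv ℝ (coordMap j k F s) y) := by
  have hc : ContinuousAt (extChartAt (𝓡 j) s).symm (extChartAt (𝓡 j) s s) :=
    continuousAt_extChartAt_symm s
  have h1 : ∀ᶠ s' in 𝓝 s, MDifferentiableAt (𝓡 j) (𝓡 k) F s' :=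
    ((contMDiffAt_iff_contMDiffAt_nhds (by simp)).1 (hF.of_le (m := 1) (by simp))).mono
      fun q hq => hq.mdifferentiableAt (by simp)
  have h2 : ∀ᶠ s' in 𝓝 s, F s' ∈ (extChartAt (𝓡 k) (F s)).source :=
    hF.continuousAt.eventually (extChartAt_source_mem_nhds (I := 𝓡 k) (F s))
  have h3 : ∀ᶠ y in 𝓝 (extChartAt (𝓡 j) s s),
      MDifferentiableAt (𝓡 j) (𝓡 k) F ((extChartAt (𝓡 j) s).symm y) ∧
      F ((extChartAt (𝓡 j) s).symm y) ∈ (extChartAt (𝓡 k) (F s)).source :=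
    hc.eventually (by rw [extChartAt_to_inv]; exact h1.and h2)
  filter_upwards [h3, extChartAt_target_mem_nhds (I := 𝓡 j) s] with y ⟨hy, hy'⟩ hyt
  have d1 : MDifferentiableAt 𝓘(ℝ, EuclideanSpace ℝ (Fin j)) (𝓡 j) (extChartAt (𝓡 j) s).symm y := by
    have := mdifferentiableWithinAt_extChartAt_symm (I := 𝓡 j) hyt
    simpa only [modelWithCornersSelf_coe, Set.range_id, mdifferentiableWithinAt_univ] using this
  have d3 : MDifferentiableAt (𝓡 k) 𝓘(ℝ, EuclideanSpace ℝ (Fin k)) (extChartAt (𝓡 k) (F s))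
      (F ((extChartAt (𝓡 j) s).symm y)) :=
    mdifferentiableAt_extChartAt (by simpa using hy')
  have c1 := mfderiv_comp (I' := 𝓡 k) y d3 (MDifferentiableAt.comp (I' := 𝓡 j) y hy d1)
  have c2 := mfderiv_comp (I' := 𝓡 j) y hy d1
  have e (w : EuclideanSpace ℝ (Fin j)) : fderiv ℝ (coordMap j k F s) y w =
      mfderiv (𝓡 k) 𝓘(ℝ, EuclideanSpace ℝ (Fin k)) (extChartAt (𝓡 k) (F s))
        (F ((extChartAt (𝓡 j) s).symm y))
        (mfderiv (𝓡 j) (𝓡 k) F ((extChartAt (𝓡 j) s).symm y)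
          (mfderiv 𝓘(ℝ, EuclideanSpace ℝ (Fin j)) (𝓡 j) (extChartAt (𝓡 j) s).symm y w)) := by
    rw [← mfderiv_eq_fderiv]
    exact (DFunLike.congr_fun c1 w).trans (congrArg _ (DFunLike.congr_fun c2 w))
  ext w
  refine Eq.trans ?_ (congrArg (coordForm α (F s) (coordMap j k F s y)) (e w)).symm
  exact (coordForm_apply hy' _).symm

theorem contDiffAt_coordMap {F : N' → N} {s : N'} (hF : ContMDiffAt (𝓡 j) (𝓡 k) ∞ F s) :
    ContDiffAt ℝ ∞ (coordMap j k F s) (extChartAt (𝓡 j) s s) := by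
  have := (contMDiffAt_iff.1 hF).2
  simp only [modelWithCornersSelf_coe, Set.range_id, contDiffWithinAt_univ] at this
  exact this

theorem coordMap_self (F : N' → N) (s : N') :
    coordMap j k F s (extChartAt (𝓡 j) s s) = extChartAt (𝓡 k) (F s) (F s) := by
  simp only [coordMap, Function.comp_apply, extChartAt_to_inv]

theorem SmoothOneFormAt.pullback {F : N' → N} {s : N'} (hF : ContMDiffAt (𝓡 j) (𝓡 k) ∞ F s)
    {α : ∀ x : N, TangentSpace (𝓡 k) x →L[ℝ] ℝ} (hα : SmoothOneFormAt α (F s)) :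
    SmoothOneFormAt (k := j) (pullbackForm (j := j) F α) s := by
  rw [smoothOneFormAt_iff] at hα ⊢
  refine ContDiffAt.congr_of_eventuallyEq ?_ (coordForm_pullback hF α)
  rw [← coordMap_self (j := j) F s] at hα
  have hf := contDiffAt_coordMap hF
  exact (hα.comp _ hf).clm_comp (hf.fderiv_right (m := ∞) (by simp))

/-- The exterior derivative commutes with pull-backs. -/
theorem extDerivOneForm_pullback {F : N' → N} {s : N'} (hF : ContMDiffAt (𝓡 j) (𝓡 k) ∞ F s)
    {α : ∀ x : N, TangentSpace (𝓡 k) x →L[ℝ] ℝ} (hα : SmoothOneFormAt α (F s))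
    (u v : TangentSpace (𝓡 j) s) :
    extDerivOneForm (k := j) (pullbackForm (j := j) F α) s u v =
      extDerivOneForm α (F s) (mfderiv (𝓡 j) (𝓡 k) F s u) (mfderiv (𝓡 j) (𝓡 k) F s v) := by
  have hf := contDiffAt_coordMap hF
  have hα' := (smoothOneFormAt_iff.1 hα).differentiableAt (by simp)
  rw [← coordMap_self (j := j) F s] at hα'
  -- Linear forms viewed as alternating forms of degree one; as a linear isometry it preserves
  -- differentiability.
  let J (n : ℕ) := ContinuousAlternatingMap.ofSubsingletonLIE (𝕜 := ℝ)
    (E := EuclideanSpace ℝ (Fin n)) (F := ℝ) (0 : Fin 1)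
  have hω : DifferentiableAt ℝ (fun z => J k (coordForm α (F s) z))
      (coordMap j k F s (extChartAt (𝓡 j) s s)) :=
    (J k).differentiableAt.comp _ hα'
  have e1 := (coordForm_pullback hF α).fun_comp (J j)
  have e2 := extDeriv_pullback hω hf
    (by rw [minSmoothness_of_isRCLikeNormedField]; exact WithTop.coe_le_coe.2 le_top)
  have hd (w : TangentSpace (𝓡 j) s) :
      fderiv ℝ (coordMap j k F s) (extChartAt (𝓡 j) s s)
        (mfderiv (𝓡 j) 𝓘(ℝ, EuclideanSpace ℝ (Fin j)) (extChartAt (𝓡 j) s) s w)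
      = mfderiv (𝓡 k) 𝓘(ℝ, EuclideanSpace ℝ (Fin k)) (extChartAt (𝓡 k) (F s)) (F s)
          (mfderiv (𝓡 j) (𝓡 k) F s w) := by
    have d1 : MDifferentiableAt (𝓡 j) 𝓘(ℝ, EuclideanSpace ℝ (Fin j)) (extChartAt (𝓡 j) s) s :=
      mdifferentiableAt_extChartAt (mem_chart_source _ s)
    have d2 : MDifferentiableAt (𝓡 k) 𝓘(ℝ, EuclideanSpace ℝ (Fin k)) (extChartAt (𝓡 k) (F s))
        (F s) := mdifferentiableAt_extChartAt (mem_chart_source _ _)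
    have d3 : MDifferentiableAt 𝓘(ℝ, EuclideanSpace ℝ (Fin j)) 𝓘(ℝ, EuclideanSpace ℝ (Fin k))
      (coordMap j k F s) (extChartAt (𝓡 j) s s) := (hf.differentiableAt (by simp)).mdifferentiableAt
    have e : coordMap j k F s ∘ extChartAt (𝓡 j) s =ᶠ[𝓝 s] extChartAt (𝓡 k) (F s) ∘ F := by
      filter_upwards [extChartAt_source_mem_nhds (I := 𝓡 j) s] with s' hs'
      simp only [coordMap, Function.comp_apply, (extChartAt (𝓡 j) s).left_inv hs']
    have e' := e.mfderiv_eq (I := 𝓡 j) (I' := 𝓘(ℝ, EuclideanSpace ℝ (Fin k)))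
    rw [mfderiv_comp (I' := 𝓘(ℝ, EuclideanSpace ℝ (Fin j))) s d3 d1,
      mfderiv_comp (I' := 𝓡 k) s d2 (hF.mdifferentiableAt (by simp)), mfderiv_eq_fderiv] at e'
    exact DFunLike.congr_fun e' w
  have e3 (c : Fin 2 → EuclideanSpace ℝ (Fin j)) :=
    (DFunLike.congr_fun (e1.extDeriv_eq.trans e2) c).trans
    (ContinuousAlternatingMap.compContinuousLinearMap_apply _ _ _)
  refine (e3 _).trans ?_
  rw [coordMap_self]
  unfold extDerivOneForm
  congr 1
  ext i : 1
  fin_cases i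
  · exact hd u
  · exact hd v

end Forms
end NullHorizon

namespace NullHorizon

/-! ### The exterior derivative through commuting vector fields. -/

section AmbientForms

variable {M : Type*} [TopologicalSpace M] [ChartedSpace (EuclideanSpace ℝ (Fin 4)) M]
  [IsManifold (𝓡 4) ∞ M] {A : ∀ q : M, TangentSpace (𝓡 4) q →L[ℝ] ℝ} {p : M}

/-- The coordinate vector fields of the preferred chart at `p`. -/
noncomputable def coordField (p : M) (w : EuclideanSpace ℝ (Fin 4)) (q : M) :
    TangentSpace (𝓡 4) q :=
  mpullback (𝓡 4) (𝓡 4) (extChartAt (𝓡 4) p) (fun _ => w) q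

theorem isInvertible_mfderiv_extChartAt_self (p : M) :
    (mfderiv (𝓡 4) (𝓡 4) (extChartAt (𝓡 4) p) p).IsInvertible :=
  isInvertible_mfderiv_extChartAt (mem_extChartAt_source p)

theorem contMDiffAt_const_field (w y : EuclideanSpace ℝ (Fin 4)) :
    ContMDiffAt (𝓡 4) ((𝓡 4).prod (𝓡 4)) ∞
      (fun y => TotalSpace.mk' (EuclideanSpace ℝ (Fin 4))
        (E := (TangentSpace (𝓡 4) : EuclideanSpace ℝ (Fin 4) → Type _)) y w) y :=
  contMDiffAt_vectorSpace_iff_contDiffAt.2 contDiffAt_const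

theorem fieldSmoothAt_coordField (p : M) (w : EuclideanSpace ℝ (Fin 4)) :
    FieldSmoothAt (coordField p w) p :=
  ContMDiffAt.mpullback_vectorField_preimage (m := ∞) (n := ∞) (contMDiffAt_const_field w _)
    contMDiffAt_extChartAt (isInvertible_mfderiv_extChartAt_self p) (by simp)

theorem mlieBracket_coordField (p : M) (w w' : EuclideanSpace ℝ (Fin 4)) :
    mlieBracket (𝓡 4) (coordField p w) (coordField p w') p = 0 := by
  have : IsManifold (𝓡 4) (minSmoothness ℝ 2) M := by
    rw [minSmoothness_of_isRCLikeNormedField]; infer_instance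
  have : IsManifold (𝓡 4) (minSmoothness ℝ 3) M := by
    rw [minSmoothness_of_isRCLikeNormedField]; infer_instance
  unfold coordField
  rw [← mpullback_mlieBracket (n := ∞)
    ((contMDiffAt_const_field w _).mdifferentiableAt (by simp))
    ((contMDiffAt_const_field w' _).mdifferentiableAt (by simp)) contMDiffAt_extChartAt
    (by rw [minSmoothness_of_isRCLikeNormedField]; exact WithTop.coe_le_coe.2 le_top),
    mpullback_apply]
  erw [mlieBracket_eq_zero_of_const (fun _ => rfl) (fun _ => rfl), map_zero]

theorem coordField_apply {q : M} (hq : q ∈ (extChartAt (𝓡 4) p).source)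
    (v : TangentSpace (𝓡 4) q) :
    coordField p (mfderiv (𝓡 4) (𝓡 4) (extChartAt (𝓡 4) p) q v) q = v :=
  (isInvertible_mfderiv_extChartAt hq).inverse_apply_eq.2 rfl

/-- The derivatives of the chart and of its inverse are mutually inverse. This converts derivatives
of coordinate expressions into derivatives of functions on the manifold. -/
theorem coordForm_eq_coordField {y : EuclideanSpace ℝ (Fin 4)}
    (hy : y ∈ (extChartAt (𝓡 4) p).target) (w : EuclideanSpace ℝ (Fin 4)) :
    coordForm A p y w =
      A ((extChartAt (𝓡 4) p).symm y) (coordField p w ((extChartAt (𝓡 4) p).symm y)) := by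
  have h1 := mfderiv_extChartAt_comp_mfderivWithin_extChartAt_symm (I := 𝓡 4) hy
  simp only [modelWithCornersSelf_coe, Set.range_id, mfderivWithin_univ] at h1
  have h2 := coordField_apply ((extChartAt (𝓡 4) p).map_target hy)
    (mfderiv 𝓘(ℝ, EuclideanSpace ℝ (Fin 4)) (𝓡 4) (extChartAt (𝓡 4) p).symm y w)
  have h3 := DFunLike.congr_fun h1 w
  refine congrArg (A ((extChartAt (𝓡 4) p).symm y)) (h2.symm.trans ?_)
  exact congrArg (fun w => coordField p w ((extChartAt (𝓡 4) p).symm y)) h3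

theorem coordForm_eventuallyEq (w : EuclideanSpace ℝ (Fin 4)) :
    (fun y => coordForm A p y w) =ᶠ[𝓝 (extChartAt (𝓡 4) p p)]
      (fun q => A q (coordField p w q)) ∘ (extChartAt (𝓡 4) p).symm := by
  filter_upwards [extChartAt_target_mem_nhds (I := 𝓡 4) p] with y hy
  exact coordForm_eq_coordField hy w

/-- A 1-form is smooth if its values on smooth vector fields are. -/
theorem smoothOneFormAt_of_apply (h : ∀ X : ∀ q : M, TangentSpace (𝓡 4) q, FieldSmoothAt X p →
    ContMDiffAt (𝓡 4) 𝓘(ℝ) ∞ (fun q => A q (X q)) p) : SmoothOneFormAt A p := by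
  rw [smoothOneFormAt_iff]
  have h2 : ContMDiffAt (𝓡 4) (𝓡 4) ∞ (extChartAt (𝓡 4) p).symm (extChartAt (𝓡 4) p p) :=
    (contMDiffOn_extChartAt_symm p).contMDiffAt (extChartAt_target_mem_nhds p)
  have hw (w : EuclideanSpace ℝ (Fin 4)) :
      ContDiffAt ℝ ∞ (fun y => coordForm A p y w) (extChartAt (𝓡 4) p p) := by
    rw [← contMDiffAt_iff_contDiffAt]
    exact (ContMDiffAt.comp_of_eq (h _ (fieldSmoothAt_coordField p w)) h2
      (extChartAt_to_inv p)).congr_of_eventuallyEq (coordForm_eventuallyEq w)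
  have e : coordForm A p = fun y => ∑ i : Fin 4,
      coordForm A p y (EuclideanSpace.single i 1) •
        (EuclideanSpace.proj i : EuclideanSpace ℝ (Fin 4) →L[ℝ] ℝ) := by
    ext y w
    conv_lhs => rw [← (EuclideanSpace.basisFun (Fin 4) ℝ).sum_repr w]
    simp [mul_comm]
  rw [e]
  exact ContDiffAt.sum fun i _ => (hw _).smul contDiffAt_const

/-- The exterior derivative of a smooth 1-form, through commuting extensions. -/
theorem exists_extDerivOneForm_eq (h : ∀ X : ∀ q : M, TangentSpace (𝓡 4) q, FieldSmoothAt X p →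
    ContMDiffAt (𝓡 4) 𝓘(ℝ) ∞ (fun q => A q (X q)) p) (u v : TangentSpace (𝓡 4) p) :
    ∃ X Y : ∀ q : M, TangentSpace (𝓡 4) q, FieldSmoothAt X p ∧ FieldSmoothAt Y p ∧ X p = u ∧
      Y p = v ∧ mlieBracket (𝓡 4) X Y p = 0 ∧
      extDerivOneForm A p u v = mvfderiv (𝓡 4) (fun q => A q (Y q)) p u
        - mvfderiv (𝓡 4) (fun q => A q (X q)) p v := by
  have hp := mem_extChartAt_source (I := 𝓡 4) p
  refine ⟨coordField p (mfderiv (𝓡 4) (𝓡 4) (extChartAt (𝓡 4) p) p u),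
    coordField p (mfderiv (𝓡 4) (𝓡 4) (extChartAt (𝓡 4) p) p v), fieldSmoothAt_coordField p _,
    fieldSmoothAt_coordField p _, coordField_apply hp u, coordField_apply hp v,
    mlieBracket_coordField p _ _, ?_⟩
  have hd := ((smoothOneFormAt_iff.1 (smoothOneFormAt_of_apply h)).differentiableAt (by simp))
  let J := ContinuousAlternatingMap.ofSubsingletonLIE (𝕜 := ℝ)
    (E := EuclideanSpace ℝ (Fin 4)) (F := ℝ) (0 : Fin 1)
  have hω : DifferentiableAt ℝ (fun z => J (coordForm A p z)) (extChartAt (𝓡 4) p p) :=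
    J.differentiableAt.comp _ hd
  have key (w : EuclideanSpace ℝ (Fin 4)) (u : TangentSpace (𝓡 4) p) :
      fderiv ℝ (fun y => coordForm A p y w) (extChartAt (𝓡 4) p p)
        (mfderiv (𝓡 4) (𝓡 4) (extChartAt (𝓡 4) p) p u)
      = mvfderiv (𝓡 4) (fun q => A q (coordField p w q)) p u := by
    have d2 : MDifferentiableAt (𝓡 4) (𝓡 4) (extChartAt (𝓡 4) p).symm (extChartAt (𝓡 4) p p) :=
      ((contMDiffOn_extChartAt_symm (n := ∞) p).contMDiffAt
        (extChartAt_target_mem_nhds p)).mdifferentiableAt (by simp)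
    have d1 : MDifferentiableAt (𝓡 4) 𝓘(ℝ) (fun q => A q (coordField p w q)) p :=
      (h _ (fieldSmoothAt_coordField p w)).mdifferentiableAt (by simp)
    have d3 := mfderiv_comp_of_eq d1 d2 (extChartAt_to_inv p)
    rw [(coordForm_eventuallyEq w).fderiv_eq, ← mfderiv_eq_fderiv]
    refine (DFunLike.congr_fun d3 _).trans ?_
    have aux (z : M) (hz : z = p) (a b : EuclideanSpace ℝ (Fin 4)) (hab : a = b) :
        mfderiv (𝓡 4) 𝓘(ℝ) (fun q => A q (coordField p w q)) z a =
          mvfderiv (𝓡 4) (fun q => A q (coordField p w q)) p b := by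
      subst hz; subst hab; rfl
    exact aux _ (extChartAt_to_inv p) _ _ (mfderiv_extChartAt_symm_comp hp u)
  -- The general formula for the exterior derivative without its bracket term, since `U` and `V` are
  -- constant in the chart.
  have e (U V : EuclideanSpace ℝ (Fin 4)) :
      extDeriv (fun z => J (coordForm A p z)) (extChartAt (𝓡 4) p p) ![U, V] =
        fderiv ℝ (fun y => coordForm A p y V) (extChartAt (𝓡 4) p p) U
        - fderiv ℝ (fun y => coordForm A p y U) (extChartAt (𝓡 4) p p) V := by
    rw [extDeriv_apply hω, Fin.sum_univ_two]
    simp [J, Fin.removeNth, sub_eq_add_neg]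
  refine (e _ _).trans ?_
  exact congrArg₂ (· - ·) (key _ u) (key _ v)

end AmbientForms
end NullHorizon

namespace NullHorizon

/-! ### Existence, smoothness and exterior derivative of the rotational form. -/

section RotationalForm

variable {M : Type*} [TopologicalSpace M] [ChartedSpace (EuclideanSpace ℝ (Fin 4)) M]
  [IsManifold (𝓡 4) ∞ M] {g : LorentzMetric M} {t : TimeOrientation g}
  {T : ∀ p : M, TangentSpace (𝓡 4) p →L[ℝ] TangentSpace (𝓡 4) p →L[ℝ] ℝ}
  {H : Type*} [TopologicalSpace H] [ChartedSpace (EuclideanSpace ℝ (Fin 3)) H]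
  [IsManifold (𝓡 3) ∞ H] {ψ : H → M} {l n : ∀ p : M, TangentSpace (𝓡 4) p}
  {S : Type*} [TopologicalSpace S] [ChartedSpace (EuclideanSpace ℝ (Fin 2)) S]
  [IsManifold (𝓡 2) ∞ S] {σ : S → H}
  {rot : ∀ x : H, TangentSpace (𝓡 3) x →L[ℝ] ℝ}

/-- The 1-form `X ↦ g(n, ∇_X l)` on the ambient space. -/
noncomputable def rotForm (g : LorentzMetric M) (l n : ∀ p : M, TangentSpace (𝓡 4) p) (q : M) :
    TangentSpace (𝓡 4) q →L[ℝ] ℝ :=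
  (g.val q (n q)).comp (g.leviCivita l q)

theorem contMDiffAt_rotForm {p : M} (hl : FieldSmoothAt l p) (hn : FieldSmoothAt n p)
    {X : ∀ p : M, TangentSpace (𝓡 4) p} (hX : FieldSmoothAt X p) :
    ContMDiffAt (𝓡 4) 𝓘(ℝ) ∞ (fun q => rotForm g l n q (X q)) p :=
  g.contMDiffAt_val hn (g.fieldSmoothAt_leviCivita hX hl)

theorem IsRotationalForm.apply_eq (hrot : IsRotationalForm g ψ l rot) {x : H}
    {n : TangentSpace (𝓡 4) (ψ x)} (hn : g.val (ψ x) (l (ψ x)) n = 1) (X : TangentSpace (𝓡 3) x) :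
    rot x X = g.val (ψ x) n (g.leviCivita l (ψ x) (mfderiv (𝓡 3) (𝓡 4) ψ x X)) := by
  rw [hrot x X, map_smul, g.symm, hn, smul_eq_mul, mul_one]

/-- Contracting `∇_X l = ω(X) l` with `n` isolates `ω(X)`. Smoothness and the exterior derivative of
`ω` are thereby reduced to a form on spacetime. -/
theorem IsRotationalForm.eq_pullback (hrot : IsRotationalForm g ψ l rot) {x : H}
    (hn : g.val (ψ x) (l (ψ x)) (n (ψ x)) = 1) :
    rot x = pullbackForm (j := 3) ψ (rotForm g l n) x :=
  ContinuousLinearMap.ext fun X => hrot.apply_eq hn X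

namespace IsNonExpandingHorizon

/-- Existence is the proportionality of `∇_X l` to `l`, which rests on the vanishing shear. The
factor is read off with any `n` satisfying `g(l, n) = 1`, so a pointwise choice of `n` suffices. -/
theorem existsUnique_rotationalForm (hH : IsNonExpandingHorizon g t T ψ)
    (hl : IsNullNormal g ψ l) :
    ∃! rot : ∀ x : H, TangentSpace (𝓡 3) x →L[ℝ] ℝ, IsRotationalForm g ψ l rot := by
  have hn (x : H) : ∃ n : TangentSpace (𝓡 4) (ψ x), g.val (ψ x) (l (ψ x)) n = 1 := by
    obtain ⟨n, _, _, ht⟩ := LorentzMetric.exists_nullTetrad (hl.ne_zero x) (hH.val_l_l hl x)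
    exact ⟨n, ht.l_n⟩
  choose n hn using hn
  refine ⟨fun x => ((g.val (ψ x) (n x)).comp (g.leviCivita l (ψ x))).comp
    (mfderiv (𝓡 3) (𝓡 4) ψ x), fun x X => ?_, fun rot hrot => ?_⟩
  · obtain ⟨c, hc⟩ := hH.exists_leviCivita_eq_smul hl x X
    simp only [ContinuousLinearMap.comp_apply, hc, map_smul]
    rw [g.symm, hn, smul_eq_mul, mul_one]
  · funext x
    exact ContinuousLinearMap.ext fun X => hrot.apply_eq (hn x) X

theorem contMDiff (hH : IsNonExpandingHorizon g t T ψ) : ContMDiff (𝓡 3) (𝓡 4) ∞ ψ :=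
  hH.embedding.isImmersion.contMDiff

/-- Smoothness is local: a vector `n` at one point is extended smoothly and divided by `g(l, n)`,
which stays nonzero nearby. -/
theorem smooth_rotationalForm (hH : IsNonExpandingHorizon g t T ψ)
    (hl : IsNullNormal g ψ l) (hrot : IsRotationalForm g ψ l rot) : SmoothOneForm rot := by
  intro x
  obtain ⟨n, _, _, ht⟩ := LorentzMetric.exists_nullTetrad (hl.ne_zero x) (hH.val_l_l hl x)
  let N₀ : ∀ q : M, TangentSpace (𝓡 4) q := FiberBundle.extend (EuclideanSpace ℝ (Fin 4)) n
  have hN₀ : FieldSmoothAt N₀ (ψ x) := fieldSmoothAt_extend n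
  have h1 : g.val (ψ x) (l (ψ x)) (N₀ (ψ x)) = 1 := by
    simp only [N₀, FiberBundle.extend_apply_self]
    exact ht.l_n
  have hf := g.contMDiffAt_val (hl.smooth x) hN₀
  have hev : ∀ᶠ q in 𝓝 (ψ x), g.val q (l q) (N₀ q) ≠ 0 :=
    hf.continuousAt.eventually_ne (by rw [h1]; norm_num)
  let N : ∀ q : M, TangentSpace (𝓡 4) q := (fun q => (g.val q (l q) (N₀ q))⁻¹) • N₀
  have hN : FieldSmoothAt N (ψ x) := FieldSmoothAt.smul (hf.inv₀ (by rw [h1]; norm_num)) hN₀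
  have hr : ∀ᶠ x' in 𝓝 x, rot x' = pullbackForm (j := 3) ψ (rotForm g l N) x' := by
    filter_upwards [hH.contMDiff.continuous.continuousAt.eventually hev] with x' hx'
    refine hrot.eq_pullback ?_
    change g.val (ψ x') (l (ψ x')) ((g.val (ψ x') (l (ψ x')) (N₀ (ψ x')))⁻¹ • N₀ (ψ x')) = 1
    rw [map_smul, smul_eq_mul, inv_mul_cancel₀ hx']
  exact SmoothOneFormAt.congr (SmoothOneFormAt.pullback (hH.contMDiff x)
    (smoothOneFormAt_of_apply fun X hX => contMDiffAt_rotForm (hl.smooth x) hN hX)) hr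

/-- `g(l, ∇_X n) = - ω(X)` for `X` tangent to the horizon. -/
theorem val_l_leviCivita_n (hH : IsNonExpandingHorizon g t T ψ) (hl : IsNullNormal g ψ l)
    (hrot : IsRotationalForm g ψ l rot) {x : H} (hn : FieldSmoothAt n (ψ x))
    (hln : ∀ᶠ x' in 𝓝 x, g.val (ψ x') (l (ψ x')) (n (ψ x')) = 1) (a : TangentSpace (𝓡 3) x) :
    g.val (ψ x) (l (ψ x)) (g.leviCivita n (ψ x) (mfderiv (𝓡 3) (𝓡 4) ψ x a)) = - rot x a := by
  have hs := (hl.smooth x).diffAt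
  have h := mvfderiv_mfderiv_eq_zero (g.mdifferentiableAt_val hs hn.diffAt) (hH.mdiffAt x) hln a
  have hX := (fieldSmoothAt_extend (mfderiv (𝓡 3) (𝓡 4) ψ x a)).diffAt
  have e := g.leviCivita_metric hX hs hn.diffAt
  rw [FiberBundle.extend_apply_self, h, hrot x a, map_smul, _root_.smul_apply, hln.self_of_nhds,
    smul_eq_mul, mul_one] at e
  linarith

/-- The exterior derivative of the rotational 1-form, pulled back to a section, is a component of
the curvature. -/
theorem extDerivOneForm_rot (hH : IsNonExpandingHorizon g t T ψ) (hl : IsNullNormal g ψ l)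
    (hrot : IsRotationalForm g ψ l rot) (hσ : ContMDiff (𝓡 2) (𝓡 3) ∞ σ) {s : S}
    (hn : FieldSmoothAt n (ψ (σ s)))
    (hln : ∀ᶠ x in 𝓝 (σ s), g.val (ψ x) (l (ψ x)) (n (ψ x)) = 1) (u v : TangentSpace (𝓡 2) s) :
    extDerivOneForm (k := 2) (pullbackForm σ rot) s u v =
      g.riemannLow (ψ (σ s)) (push ψ σ s u) (push ψ σ s v) (l (ψ (σ s))) (n (ψ (σ s))) := by
  have hls := hl.smooth (σ s)
  have e (s' : S) : mfderiv (𝓡 2) (𝓡 4) (ψ ∘ σ) s' =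
      (mfderiv (𝓡 3) (𝓡 4) ψ (σ s')).comp (mfderiv (𝓡 2) (𝓡 3) σ s') :=
    mfderiv_comp s' (hH.mdiffAt (σ s')) (hσ.mdifferentiable (by simp) s')
  have h1 : ∀ᶠ s' in 𝓝 s, pullbackForm (j := 2) σ rot s' =
      pullbackForm (j := 2) (ψ ∘ σ) (rotForm g l n) s' := by
    filter_upwards [hσ.continuous.continuousAt.eventually hln] with s' hs'
    rw [pullbackForm, hrot.eq_pullback hs', pullbackForm, pullbackForm, e s']
    rfl
  have hA (X : ∀ q : M, TangentSpace (𝓡 4) q) (hX : FieldSmoothAt X (ψ (σ s))) :=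
    contMDiffAt_rotForm (g := g) hls hn hX
  have h2 := extDerivOneForm_pullback (F := ψ ∘ σ) (s := s)
    (ContMDiffAt.comp (I' := 𝓡 3) s (hH.contMDiff (σ s)) (hσ s))
    (smoothOneFormAt_of_apply hA) u v
  rw [extDerivOneForm_congr h1, h2, e s]
  change extDerivOneForm (rotForm g l n) (ψ (σ s)) (push ψ σ s u) (push ψ σ s v) = _
  obtain ⟨X, Y, hX, hY, hXu, hYv, hXY, hd⟩ :=
    exists_extDerivOneForm_eq hA (push ψ σ s u) (push ψ σ s v)
  rw [hd]
  -- The commuting extensions `X`, `Y` need not be tangent to the horizon away from the point: the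
  -- relation `∇_X l = ω(X) l` is used only at the point itself.
  have m1 := g.leviCivita_metric hX.diffAt hn.diffAt (g.fieldSmoothAt_leviCivita hY hls).diffAt
  have m2 := g.leviCivita_metric hY.diffAt hn.diffAt (g.fieldSmoothAt_leviCivita hX hls).diffAt
  have r1 : g.leviCivita l (ψ (σ s)) (Y (ψ (σ s)))
      = rot (σ s) (mfderiv (𝓡 2) (𝓡 3) σ s v) • l (ψ (σ s)) := by
    rw [hYv]; exact hrot (σ s) _
  have r2 : g.leviCivita l (ψ (σ s)) (X (ψ (σ s)))
      = rot (σ s) (mfderiv (𝓡 2) (𝓡 3) σ s u) • l (ψ (σ s)) := by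
    rw [hXu]; exact hrot (σ s) _
  have n1 := hH.val_l_leviCivita_n hl hrot hn hln (mfderiv (𝓡 2) (𝓡 3) σ s u)
  have n2 := hH.val_l_leviCivita_n hl hrot hn hln (mfderiv (𝓡 2) (𝓡 3) σ s v)
  rw [r1, map_smul, g.symm _ _ (l (ψ (σ s))), hXu] at m1
  rw [r2, map_smul, g.symm _ _ (l (ψ (σ s))), hYv] at m2
  -- The extra term `g(∇_X n, ∇_Y l)` equals `- ω(X) ω(Y)`; being symmetric, it cancels in the
  -- difference and leaves the curvature applied to `l`, paired with `n`.
  have m1' : mvfderiv (𝓡 4) (fun q => rotForm g l n q (Y q)) (ψ (σ s)) (push ψ σ s u) = _ :=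
    m1.trans (congrArg (fun z => _ • z + _) n1)
  have m2' : mvfderiv (𝓡 4) (fun q => rotForm g l n q (X q)) (ψ (σ s)) (push ψ σ s v) = _ :=
    m2.trans (congrArg (fun z => _ • z + _) n2)
  rw [m1', m2', LorentzMetric.riemannLow, ← hXu, ← hYv, LorentzMetric.riemann_eq_curv hX hY hls,
    LorentzMetric.curv, hXY, map_zero, sub_zero, g.symm _ _ (n (ψ (σ s))), map_sub]
  simp only [smul_eq_mul]
  ring

end IsNonExpandingHorizon
end RotationalForm
end NullHorizon

namespace NullHorizon

/-! ### Adapted tetrads: spin coefficients, area form and `Ψ₂`. -/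

section AdaptedTetrad

variable {M : Type*} [TopologicalSpace M] [ChartedSpace (EuclideanSpace ℝ (Fin 4)) M]
  [IsManifold (𝓡 4) ∞ M] {g : LorentzMetric M} {t : TimeOrientation g}
  {T : ∀ p : M, TangentSpace (𝓡 4) p →L[ℝ] TangentSpace (𝓡 4) p →L[ℝ] ℝ}
  {H : Type*} [TopologicalSpace H] [ChartedSpace (EuclideanSpace ℝ (Fin 3)) H]
  [IsManifold (𝓡 3) ∞ H] {ψ : H → M} {l n : ∀ p : M, TangentSpace (𝓡 4) p}
  {m : ∀ p : M, TangentSpace (𝓡 4) p × TangentSpace (𝓡 4) p} {U : Set M}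
  {S : Type*} [TopologicalSpace S] [ChartedSpace (EuclideanSpace ℝ (Fin 2)) S]
  [IsManifold (𝓡 2) ∞ S] {σ : S → H}
  {rot : ∀ x : H, TangentSpace (𝓡 3) x →L[ℝ] ℝ} {s : S}

theorem LorentzMetric.ricci_neg_right {p : M} (x y : TangentSpace (𝓡 4) p) :
    g.ricci p x (-y) = - g.ricci p x y := by
  have h (u : TangentSpace (𝓡 4) p) :
      g.riemannLow p x u (-y) u = - g.riemannLow p x u y u := by
    rw [← neg_one_smul ℝ y, LorentzMetric.riemannLow_smul_third]; simp
  simp only [LorentzMetric.ricci, h, mul_neg, Finset.sum_neg_distrib]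

namespace IsAdaptedTetrad

/-- The inner products of an adapted tetrad at a point of the section. -/
theorem val_section (ht : IsAdaptedTetrad g ψ σ l n m U) (hs : ψ (σ s) ∈ U) :
    g.val _ (m (ψ (σ s))).1 (m (ψ (σ s))).1 = -(1 / 2) ∧
    g.val _ (m (ψ (σ s))).2 (m (ψ (σ s))).2 = -(1 / 2) ∧
    g.val _ (m (ψ (σ s))).1 (m (ψ (σ s))).2 = 0 := by
  have h1 := ht.m_m s hs
  have h2 := ht.m_conj_m s hs
  simp only [complexBilin, conjVec, map_neg, g.symm _ (m (ψ (σ s))).2 (m (ψ (σ s))).1,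
    Complex.ext_iff, Complex.add_re, Complex.add_im, Complex.mul_re, Complex.mul_im,
    Complex.ofReal_re, Complex.ofReal_im, Complex.I_re, Complex.I_im, Complex.zero_re,
    Complex.zero_im, Complex.neg_re, Complex.one_re] at h1 h2
  refine ⟨?_, ?_, ?_⟩ <;> linarith [h1.1, h1.2, h2.1]

theorem val_n (ht : IsAdaptedTetrad g ψ σ l n m U) {x : H} (hx : ψ x ∈ U) :
    g.val _ (m (ψ x)).1 (n (ψ x)) = 0 ∧ g.val _ (m (ψ x)).2 (n (ψ x)) = 0 := by
  have h := ht.m_n x hx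
  simp only [lowerC, complexLin, Complex.ext_iff, Complex.add_re, Complex.add_im, Complex.mul_re,
    Complex.mul_im, Complex.ofReal_re, Complex.ofReal_im, Complex.I_re, Complex.I_im,
    Complex.zero_re, Complex.zero_im] at h
  constructor <;> linarith [h.1, h.2]

theorem val_l (ht : IsAdaptedTetrad g ψ σ l n m U) (hl : IsNullNormal g ψ l) {x : H}
    (hx : ψ x ∈ U) :
    g.val _ (l (ψ x)) (m (ψ x)).1 = 0 ∧ g.val _ (l (ψ x)) (m (ψ x)).2 = 0 := by
  obtain ⟨a, b, hab⟩ := ht.tangent x hx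
  rw [hab]
  exact ⟨hl.normal x a, hl.normal x b⟩

/-- The real and imaginary parts of `m` have square `-1/2`, so their multiples by `√2` complete `l`,
`n` to a null tetrad; this is the origin of the coefficients 2. -/
theorem expand (ht : IsAdaptedTetrad g ψ σ l n m U) (hH : IsNonExpandingHorizon g t T ψ)
    (hl : IsNullNormal g ψ l) (hs : ψ (σ s) ∈ U) (v : TangentSpace (𝓡 4) (ψ (σ s))) :
    v = g.val _ v (n (ψ (σ s))) • l (ψ (σ s)) + g.val _ v (l (ψ (σ s))) • n (ψ (σ s))
      - (2 * g.val _ v (m (ψ (σ s))).1) • (m (ψ (σ s))).1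
      - (2 * g.val _ v (m (ψ (σ s))).2) • (m (ψ (σ s))).2 := by
  obtain ⟨haa, hbb, hab⟩ := ht.val_section hs
  obtain ⟨han, hbn⟩ := ht.val_n hs
  obtain ⟨hla, hlb⟩ := ht.val_l hl hs
  have h2 : √2 * √2 = (2 : ℝ) := Real.mul_self_sqrt (by norm_num)
  have h : IsNullTetradAt g (ψ (σ s)) (l (ψ (σ s))) (n (ψ (σ s))) (√2 • (m (ψ (σ s))).1)
      (√2 • (m (ψ (σ s))).2) := by
    have hn := g.symm (ψ (σ s)) (n (ψ (σ s)))
    constructor <;> simp only [map_smul, _root_.smul_apply, smul_eq_mul, hH.val_l_l hl,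
      ht.n_null _ hs, ht.l_n _ hs, hla, hlb, hn, han, hbn, haa, hbb, hab, mul_zero] <;>
      linarith
  have e := h.expand v
  simp only [map_smul, smul_eq_mul, smul_smul] at e
  rw [mul_right_comm, h2, mul_right_comm, h2] at e
  exact e

/-- `∇_l m = ∇_m l` on the horizon. -/
theorem leviCivita_m (ht : IsAdaptedTetrad g ψ σ l n m U) (hl : IsNullNormal g ψ l) {x : H}
    (hx : ψ x ∈ U) :
    g.leviCivita (fun q => (m q).1) (ψ x) (l (ψ x)) = g.leviCivita l (ψ x) (m (ψ x)).1 ∧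
    g.leviCivita (fun q => (m q).2) (ψ x) (l (ψ x)) = g.leviCivita l (ψ x) (m (ψ x)).2 := by
  have h1 := g.leviCivita_torsion (hl.smooth x).diffAt (ht.smooth_m_re _ hx).diffAt
  have h2 := g.leviCivita_torsion (hl.smooth x).diffAt (ht.smooth_m_im _ hx).diffAt
  exact ⟨sub_eq_zero.1 (h1.trans (ht.lie_re x hx)), sub_eq_zero.1 (h2.trans (ht.lie_im x hx))⟩

theorem eventually_mem (ht : IsAdaptedTetrad g ψ σ l n m U) (hH : IsNonExpandingHorizon g t T ψ)
    {x : H} (hx : ψ x ∈ U) : ∀ᶠ x' in 𝓝 x, ψ x' ∈ U :=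
  hH.contMDiff.continuous.continuousAt.eventually (ht.isOpen.mem_nhds hx)

/-- The rotational 1-form in terms of the spin coefficients. -/
theorem spin_coefficients (ht : IsAdaptedTetrad g ψ σ l n m U)
    (hH : IsNonExpandingHorizon g t T ψ) (hl : IsNullNormal g ψ l) (hs : ψ (σ s) ∈ U) :
    ∃ κ α β : ℝ, g.leviCivita l _ (l (ψ (σ s))) = κ • l (ψ (σ s)) ∧
      g.leviCivita l _ (m (ψ (σ s))).1 = α • l (ψ (σ s)) ∧
      g.leviCivita l _ (m (ψ (σ s))).2 = β • l (ψ (σ s)) ∧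
      spinEps g l n m (ψ (σ s)) = (κ / 2 : ℝ) ∧
      spinPi g l n m (ψ (σ s)) = α - β * Complex.I := by
  obtain ⟨κ, hκ⟩ := hH.exists_leviCivita_l_l hl (σ s)
  obtain ⟨a, b, hab⟩ := ht.tangent _ hs
  obtain ⟨α, hα⟩ := hH.exists_leviCivita_eq_smul hl (σ s) a
  obtain ⟨β, hβ⟩ := hH.exists_leviCivita_eq_smul hl (σ s) b
  have ha : mfderiv (𝓡 3) (𝓡 4) ψ (σ s) a = (m (ψ (σ s))).1 := by rw [hab]
  have hb : mfderiv (𝓡 3) (𝓡 4) ψ (σ s) b = (m (ψ (σ s))).2 := by rw [hab]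
  rw [ha] at hα
  rw [hb] at hβ
  refine ⟨κ, α, β, hκ, hα, hβ, ?_, ?_⟩
  all_goals
    obtain ⟨d1, d2⟩ := ht.leviCivita_m hl hs
    rw [hα] at d1
    rw [hβ] at d2
    obtain ⟨hla, hlb⟩ := ht.val_l hl hs
  -- `D m = ∇_m l` is a multiple of `l` and so orthogonal to `m̄`; only `n^a D l_a = κ` contributes
  -- to `ε`.
  · have hnl : g.val _ (n (ψ (σ s))) (l (ψ (σ s))) = 1 := by rw [g.symm]; exact ht.l_n _ hs
    have h1 := g.symm (ψ (σ s)) (m (ψ (σ s))).1 (l (ψ (σ s)))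
    have h2 := g.symm (ψ (σ s)) (m (ψ (σ s))).2 (l (ψ (σ s)))
    rw [hla] at h1
    rw [hlb] at h2
    simp only [spinEps, opD, opDC, complexBilin, conjVec, d1, d2, hκ, map_smul, map_neg,
      _root_.neg_apply, hnl, h1, h2, smul_eq_mul]
    push_cast
    ring
  -- Differentiating `g(m, n) = 0` along the tangent vector `l` moves `D` from `n` to `m`, so that
  -- `π = ω(m̄) = α - i β`.
  · obtain ⟨b₀, hb₀⟩ := hH.exists_mfderiv_eq_l hl (σ s)
    have hn := (ht.smooth_n _ hs).diffAt
    have hls := (hl.smooth (σ s)).diffAt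
    have key (Y : ∀ q : M, TangentSpace (𝓡 4) q) (hY : FieldDiffAt Y (ψ (σ s)))
        (hYn : ∀ x, ψ x ∈ U → g.val (ψ x) (Y (ψ x)) (n (ψ x)) = 0) (c : ℝ)
        (hc : g.leviCivita Y (ψ (σ s)) (l (ψ (σ s))) = c • l (ψ (σ s))) :
        g.val _ (Y (ψ (σ s))) (g.leviCivita n (ψ (σ s)) (l (ψ (σ s)))) = -c := by
      have z := mvfderiv_mfderiv_eq_zero (g.mdifferentiableAt_val hY hn) (hH.mdiffAt (σ s))
        ((ht.eventually_mem hH hs).mono hYn) b₀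
      rw [hb₀, g.leviCivita_metric hls hY hn, hc, map_smul, _root_.smul_apply, ht.l_n _ hs,
        smul_eq_mul, mul_one] at z
      linarith
    have k1 := key _ (ht.smooth_m_re _ hs).diffAt (fun x hx => (ht.val_n hx).1) α d1
    have k2 := key _ (ht.smooth_m_im _ hs).diffAt (fun x hx => (ht.val_n hx).2) β d2
    simp only [spinPi, opD, complexLin, conjVec, map_neg, _root_.neg_apply, k1, k2]
    push_cast
    ring

/-- With `m = a + i b`, expanding a tangent `V` in the tetrad gives `ω(V) = κ g(V, n) - 2 α g(V, a)
- 2 β g(V, b)`. Here `κ = ε + ε̄`, and the last two terms are `- 2 Re(π g(m, V))` for `π = α - i β`.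
-/
theorem rot_eq (ht : IsAdaptedTetrad g ψ σ l n m U)
    (hH : IsNonExpandingHorizon g t T ψ) (hl : IsNullNormal g ψ l)
    (hrot : IsRotationalForm g ψ l rot) (hs : ψ (σ s) ∈ U) (X : TangentSpace (𝓡 3) (σ s)) :
    (rot (σ s) X : ℂ) =
      (spinEps g l n m (ψ (σ s)) + starRingEnd ℂ (spinEps g l n m (ψ (σ s))))
        * (g.val (ψ (σ s)) (n (ψ (σ s))) (mfderiv (𝓡 3) (𝓡 4) ψ (σ s) X) : ℂ)
      - spinPi g l n m (ψ (σ s))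
        * lowerC g (ψ (σ s)) (m (ψ (σ s))) (mfderiv (𝓡 3) (𝓡 4) ψ (σ s) X)
      - starRingEnd ℂ (spinPi g l n m (ψ (σ s)))
        * lowerC g (ψ (σ s)) (conjVec (m (ψ (σ s)))) (mfderiv (𝓡 3) (𝓡 4) ψ (σ s) X) := by
  obtain ⟨κ, α, β, hκ, hα, hβ, hε, hπ⟩ := ht.spin_coefficients hH hl hs
  have e := ht.expand hH hl hs (mfderiv (𝓡 3) (𝓡 4) ψ (σ s) X)
  have h := hrot (σ s) X
  have hlX : g.val _ (mfderiv (𝓡 3) (𝓡 4) ψ (σ s) X) (l (ψ (σ s))) = 0 := by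
    rw [g.symm]; exact hl.normal _ X
  rw [hε, hπ]
  simp only [lowerC, complexLin, conjVec, map_neg, _root_.neg_apply, map_sub, map_mul,
    Complex.conj_ofReal, Complex.conj_I]
  rw [g.symm _ (n (ψ (σ s))), g.symm _ (m (ψ (σ s))).1, g.symm _ (m (ψ (σ s))).2]
  generalize mfderiv (𝓡 3) (𝓡 4) ψ (σ s) X = V at *
  rw [e, hlX] at h
  simp only [map_sub, map_smul, hκ, hα, hβ, zero_smul, add_zero] at h
  have h' : (rot (σ s) X - (g.val _ V (n (ψ (σ s))) * κ - 2 * g.val _ V (m (ψ (σ s))).1 * α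
      - 2 * g.val _ V (m (ψ (σ s))).2 * β)) • l (ψ (σ s)) = 0 := by
    linear_combination (norm := module) -h
  have h'' := (smul_eq_zero.1 h').resolve_right (hl.ne_zero _)
  rw [sub_eq_zero.1 h'']
  push_cast
  linear_combination (-2 * β * (g.val _ V (m (ψ (σ s))).2 : ℂ)) * Complex.I_sq

/-- Vectors tangent to the section are combinations of the real and imaginary part of `m`. -/
theorem exists_push_eq (ht : IsAdaptedTetrad g ψ σ l n m U) (hs : ψ (σ s) ∈ U)
    (u : TangentSpace (𝓡 2) s) :
    ∃ x y : ℝ, push ψ σ s u = x • (m (ψ (σ s))).1 + y • (m (ψ (σ s))).2 := by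
  obtain ⟨a, b, hab⟩ := ht.tangent_section s hs
  obtain ⟨haa, hbb, hab'⟩ := ht.val_section hs
  have ha : push ψ σ s a = (m (ψ (σ s))).1 := by rw [hab]
  have hb : push ψ σ s b = (m (ψ (σ s))).2 := by rw [hab]
  let P : TangentSpace (𝓡 2) s →ₗ[ℝ] TangentSpace (𝓡 4) (ψ (σ s)) :=
    ((mfderiv (𝓡 3) (𝓡 4) ψ (σ s)).comp (mfderiv (𝓡 2) (𝓡 3) σ s)).toLinearMap
  have hP (u) : P u = push ψ σ s u := rfl
  have hli : LinearIndependent ℝ ![a, b] := by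
    rw [LinearIndependent.pair_iff]
    intro x y hxy
    have h := congrArg P hxy
    rw [map_add, map_smul, map_smul, hP, hP, ha, hb, map_zero] at h
    have h1 := congrArg (fun v => g.val _ v (m (ψ (σ s))).1) h
    have h2 := congrArg (fun v => g.val _ v (m (ψ (σ s))).2) h
    simp only [map_add, map_smul, _root_.add_apply, _root_.smul_apply, smul_eq_mul, map_zero,
      _root_.zero_apply, g.symm _ (m (ψ (σ s))).2 (m (ψ (σ s))).1, haa, hbb, hab'] at h1 h2
    constructor <;> linarith
  have hfr : Module.finrank ℝ (TangentSpace (𝓡 2) s) = 2 :=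
    (by simp : Module.finrank ℝ (EuclideanSpace ℝ (Fin 2)) = 2)
  have hspan : Submodule.span ℝ (Set.range ![a, b]) = ⊤ :=
    hli.span_eq_top_of_card_eq_finrank (by simp [hfr])
  have hmem : u ∈ Submodule.span ℝ (Set.range ![a, b]) := by rw [hspan]; trivial
  obtain ⟨c, hc⟩ := (Submodule.mem_span_range_iff_exists_fun ℝ).1 hmem
  rw [Fin.sum_univ_two] at hc
  refine ⟨c 0, c 1, ?_⟩
  rw [← hP, ← hc, map_add, map_smul, map_smul]
  exact congrArg₂ (fun v w => c 0 • v + c 1 • w) ha hb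

/-- For `m = a + i b` the form is `2 (a ∧ b)` on lowered vectors, and lowering contributes two
factors `-1/2`. -/
theorem areaForm_eq (ht : IsAdaptedTetrad g ψ σ l n m U) (hs : ψ (σ s) ∈ U) (x y x' y' : ℝ) :
    areaForm g m (ψ (σ s)) (x • (m (ψ (σ s))).1 + y • (m (ψ (σ s))).2)
      (x' • (m (ψ (σ s))).1 + y' • (m (ψ (σ s))).2) = ((x * y' - y * x') / 2 : ℝ) := by
  obtain ⟨haa, hbb, hab⟩ := ht.val_section hs
  simp only [areaForm, lowerC, complexLin, conjVec, map_add, map_smul, map_neg, _root_.neg_apply,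
    smul_eq_mul, g.symm _ (m (ψ (σ s))).2 (m (ψ (σ s))).1, haa, hbb, hab]
  push_cast
  linear_combination (-(x * y' - y * x') / 2 : ℂ) * Complex.I_sq

/-- With `m = a + i b`, the imaginary part is `C(l, b, a, n) - C(l, a, b, n)`. Because `l` and `n`
are orthogonal to `a`, `b`, the surviving Ricci and scalar terms are symmetric in `a`, `b` and
cancel; the Bianchi identity turns the Riemann difference into `R(a, b, l, n)`. -/
theorem im_weylPsi2 (ht : IsAdaptedTetrad g ψ σ l n m U) (hl : IsNullNormal g ψ l)
    (hs : ψ (σ s) ∈ U) : (weylPsi2 g l n m (ψ (σ s))).im =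
      g.riemannLow _ (m (ψ (σ s))).1 (m (ψ (σ s))).2 (l (ψ (σ s))) (n (ψ (σ s))) := by
  obtain ⟨haa, hbb, hab⟩ := ht.val_section hs
  obtain ⟨han, hbn⟩ := ht.val_n hs
  obtain ⟨hla, hlb⟩ := ht.val_l hl hs
  have hneg (u v w z : TangentSpace (𝓡 4) (ψ (σ s))) :
      g.riemannLow _ u v (-w) z = - g.riemannLow _ u v w z := by
    rw [← neg_one_smul ℝ w, LorentzMetric.riemannLow_smul_third]; simp
  have hb := LorentzMetric.riemannLow_bianchi (g := g) (x := l (ψ (σ s))) (y := (m (ψ (σ s))).2)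
    (z := (m (ψ (σ s))).1) (w := n (ψ (σ s)))
  have h1 := LorentzMetric.riemannLow_swap_left (g := g) (x := l (ψ (σ s)))
    (y := (m (ψ (σ s))).1) (z := (m (ψ (σ s))).2) (w := n (ψ (σ s)))
  have h2 := LorentzMetric.riemannLow_swap_left (g := g) (x := (m (ψ (σ s))).1)
    (y := (m (ψ (σ s))).2) (z := l (ψ (σ s))) (w := n (ψ (σ s)))
  have hr := LorentzMetric.ricci_symm (g := g) (x := (m (ψ (σ s))).1) (y := (m (ψ (σ s))).2)
  simp only [weylPsi2, complexBilin, conjVec, Complex.add_im, Complex.mul_im, Complex.ofReal_re,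
    Complex.ofReal_im, Complex.I_re, Complex.I_im, LorentzMetric.weyl, hneg,
    LorentzMetric.ricci_neg_right, map_neg, g.symm _ (m (ψ (σ s))).2 (m (ψ (σ s))).1, hab, hla,
    hlb, han, hbn, ht.l_n _ hs, hr]
  linarith

end IsAdaptedTetrad
end AdaptedTetrad
end NullHorizon

/-! ### Assembly of the theorem. -/

theorem mainTheorem5
    {M : Type*} [TopologicalSpace M] [ChartedSpace (EuclideanSpace ℝ (Fin 4)) M]
    [IsManifold (𝓡 4) ∞ M]
    {H : Type*} [TopologicalSpace H] [ChartedSpace (EuclideanSpace ℝ (Fin 3)) H]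
    [IsManifold (𝓡 3) ∞ H]
    (g : LorentzMetric M) (t : TimeOrientation g)
    (T : ∀ p : M, TangentSpace (𝓡 4) p →L[ℝ] TangentSpace (𝓡 4) p →L[ℝ] ℝ)
    (ψ : H → M) (hH : IsNonExpandingHorizon g t T ψ)
    (l : ∀ p : M, TangentSpace (𝓡 4) p) (hl : IsNullNormal g ψ l)
    {S : Type*} [TopologicalSpace S] [ChartedSpace (EuclideanSpace ℝ (Fin 2)) S]
    [IsManifold (𝓡 2) ∞ S]
    (σ : S → H) (hS : IsSphericalSection g ψ σ) :
    (∃! rot : ∀ x : H, TangentSpace (𝓡 3) x →L[ℝ] ℝ, IsRotationalForm g ψ l rot) ∧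
    ∀ rot : ∀ x : H, TangentSpace (𝓡 3) x →L[ℝ] ℝ, IsRotationalForm g ψ l rot →
      SmoothOneForm rot ∧
      SmoothOneForm (k := 2) (pullbackForm σ rot) ∧
      ∀ (n : ∀ p : M, TangentSpace (𝓡 4) p)
        (m : ∀ p : M, TangentSpace (𝓡 4) p × TangentSpace (𝓡 4) p) (U : Set M),
        IsAdaptedTetrad g ψ σ l n m U → ∀ s : S, ψ (σ s) ∈ U →
        -- `ω_a = (ε + ε̄) n_a - π m_a - π̄ m̄_a`
        (∀ X : TangentSpace (𝓡 3) (σ s), (rot (σ s) X : ℂ) =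
          (spinEps g l n m (ψ (σ s))
              + starRingEnd ℂ (spinEps g l n m (ψ (σ s))))
            * (g.val (ψ (σ s)) (n (ψ (σ s))) (mfderiv (𝓡 3) (𝓡 4) ψ (σ s) X) : ℂ)
          - spinPi g l n m (ψ (σ s))
            * lowerC g (ψ (σ s)) (m (ψ (σ s))) (mfderiv (𝓡 3) (𝓡 4) ψ (σ s) X)
          - starRingEnd ℂ (spinPi g l n m (ψ (σ s)))
            * lowerC g (ψ (σ s)) (conjVec (m (ψ (σ s))))
                (mfderiv (𝓡 3) (𝓡 4) ψ (σ s) X)) ∧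
        -- on `S` this pulls back to `- π m - π̄ m̄`
        (∀ u : TangentSpace (𝓡 2) s, (pullbackForm (j := 2) σ rot s u : ℂ) =
          - spinPi g l n m (ψ (σ s))
            * lowerC g (ψ (σ s)) (m (ψ (σ s))) (push ψ σ s u)
          - starRingEnd ℂ (spinPi g l n m (ψ (σ s)))
            * lowerC g (ψ (σ s)) (conjVec (m (ψ (σ s))))
                (push ψ σ s u)) ∧
        -- the 2-form `i (m ⊗ m̄ - m̄ ⊗ m)` is an area form of `S`
        (∀ u v : TangentSpace (𝓡 2) s,
          areaForm g m (ψ (σ s)) (push ψ σ s u)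
              (push ψ σ s v) ^ 2 =
            ((g.val (ψ (σ s)) (push ψ σ s u) (push ψ σ s u)
                * g.val (ψ (σ s)) (push ψ σ s v) (push ψ σ s v)
              - g.val (ψ (σ s)) (push ψ σ s u) (push ψ σ s v) ^ 2 : ℝ) :
              ℂ)) ∧
        -- `dω = 2 Im Ψ₂ ε` on `S`
        (∀ u v : TangentSpace (𝓡 2) s,
          (extDerivOneForm (k := 2) (pullbackForm σ rot) s u v : ℂ) =
            2 * ((weylPsi2 g l n m (ψ (σ s))).im : ℂ)
              * areaForm g m (ψ (σ s)) (push ψ σ s u)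
                  (push ψ σ s v)) := by
  refine ⟨hH.existsUnique_rotationalForm hl, fun rot hrot =>
    ⟨hH.smooth_rotationalForm hl hrot, fun s => SmoothOneFormAt.pullback
      (hS.embedding.isImmersion.contMDiff s) (hH.smooth_rotationalForm hl hrot (σ s)),
      fun n m U ht s hs => ⟨ht.rot_eq hH hl hrot hs, fun u => ?_, fun u v => ?_, fun u v => ?_⟩⟩⟩
  · refine (ht.rot_eq hH hl hrot hs (mfderiv (𝓡 2) (𝓡 3) σ s u)).trans ?_
    -- Vectors tangent to the section are combinations of the two real parts of `m`, hence
    -- orthogonal to `n`: the `ε + ε̄` term drops out.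
    obtain ⟨x, y, hxy⟩ := ht.exists_push_eq hs u
    obtain ⟨han, hbn⟩ := ht.val_n hs
    have hn : g.val (ψ (σ s)) (n (ψ (σ s)))
        (mfderiv (𝓡 3) (𝓡 4) ψ (σ s) (mfderiv (𝓡 2) (𝓡 3) σ s u)) = 0 := by
      rw [g.symm]
      change g.val (ψ (σ s)) (push ψ σ s u) (n (ψ (σ s))) = 0
      simp only [hxy, map_add, map_smul, _root_.add_apply, _root_.smul_apply, han, hbn, smul_zero,
        add_zero]
    rw [hn, Complex.ofReal_zero, mul_zero, zero_sub, neg_mul]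
    rfl
  all_goals
    obtain ⟨x, y, hu⟩ := ht.exists_push_eq hs u
    obtain ⟨x', y', hv⟩ := ht.exists_push_eq hs v
  · obtain ⟨haa, hbb, hab⟩ := ht.val_section hs
    rw [hu, hv, ht.areaForm_eq hs]
    simp only [map_add, map_smul, _root_.add_apply, _root_.smul_apply, smul_eq_mul,
      g.symm _ (m (ψ (σ s))).2 (m (ψ (σ s))).1, haa, hbb, hab]
    push_cast
    ring
  · have hln : ∀ᶠ x in 𝓝 (σ s), g.val (ψ x) (l (ψ x)) (n (ψ x)) = 1 :=
      (ht.eventually_mem hH hs).mono ht.l_n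
    rw [hH.extDerivOneForm_rot hl hrot hS.embedding.isImmersion.contMDiff (ht.smooth_n _ hs) hln,
      hu, hv, ht.areaForm_eq hs, ht.im_weylPsi2 hl hs,
      LorentzMetric.riemannLow_add_left, LorentzMetric.riemannLow_smul_left,
      LorentzMetric.riemannLow_smul_left]
    -- The curvature is alternating in its first pair, so on the section it equals the coefficient
    -- determinant of `u`, `v` times its value on the real and imaginary parts of `m`. The area form
    -- is half that determinant, which yields the factor 2.
    have hs (a c : TangentSpace (𝓡 4) (ψ (σ s))) := LorentzMetric.riemannLow_swap_left (g := g)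
      (x := a) (y := c) (z := l (ψ (σ s))) (w := n (ψ (σ s)))
    have h0 (a : TangentSpace (𝓡 4) (ψ (σ s))) :
        g.riemannLow (ψ (σ s)) a a (l (ψ (σ s))) (n (ψ (σ s))) = 0 := by linarith [hs a a]
    rw [hs (x' • (m (ψ (σ s))).1 + y' • (m (ψ (σ s))).2),
      hs (x' • (m (ψ (σ s))).1 + y' • (m (ψ (σ s))).2),
      LorentzMetric.riemannLow_add_left, LorentzMetric.riemannLow_smul_left,
      LorentzMetric.riemannLow_smul_left, LorentzMetric.riemannLow_add_left,
      LorentzMetric.riemannLow_smul_left, LorentzMetric.riemannLow_smul_left, h0, h0,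
      hs (m (ψ (σ s))).1]
    push_cast
    ring
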